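/- **Fubini's rule II for lax ends.** Conventions. "2-category" and "2-functor" mean strict ones, $\mathcal A^{op}$ reverses 1-cells only, and $\mathrm{Cat}$ is the 2-category of categories. *Lax ends.* Let $\mathcal X$ be a 2-category and $S:\mathcal X^{op}\times\mathcal X\to\mathrm{Cat}$ a 2-functor. A lax wedge from a category $C$ to $S$ consists of functors $\sigma_x:C\to S(x,x)$ and natural transformations $\sigma_f:S(1,f)\sigma_x\Rightarrow S(f,1)\sigma_{y}$ for $f:x\to y$, such that $\sigma_{1}=1$; $(S(\alpha,1)\sigma_y)\circ\sigma_f=\sigma_{f'}\circ (S(1,\alpha)\sigma_x)$ for every 2-cell $\alpha:f\Rightarrow f'$; and $\sigma_{gf}=(S(f,1)\sigma_g)\circ(S(1,g)\sigma_f)$ for composable $f,g$. The lax end $\int_{x}S(x,x)$ is the category that carries the universal lax wedge, for wedges and for their modifications. Explicitly, its objects are the lax wedges from the terminal category, that is, families $(s_x\in S(x,x),\ s_f:S(1,f)s_x\to S(f,1)s_y)$ satisfying these equations, and its morphisms are the families $t_x:s_x\to s'_x$ with $s'_f\circ S(1,f)t_x=S(f,1)t_y\circ s_f$. *Gray tensor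 products.* An $\mathcal F$-category is a 2-category with a class of tight 1-cells that contains the identities and is closed under composition. For $\mathcal F$-categories $\mathcal X,\mathcal Y$ the 2-category $\mathcal X\otimes_{s,l}\mathcal Y$ has objects the pairs $(x,y)$. It is generated by 1-cells $(f,1)$ and $(1,g)$, by 2-cells $(\alpha,1)$ and $(1,\beta)$, which compose as in $\mathcal X$ and in $\mathcal Y$, and by 2-cells $\Sigma_{f,g}:(1,g)\circ(f,1)\Rightarrow(f,1)\circ(1,g)$ for $f$ in $\mathcal X$ and $g$ in $\mathcal Y$. The $\Sigma_{f,g}$ are natural in 2-cells of each variable, compatible with composition in each variable, and identities as soon as $f$ or $g$ is tight. The lax Gray tensor product $\mathcal A\otimes_l\mathcal B$ of two 2-categories is the case where only identities are tight. Sending every $\Sigma$ to an identity gives a quotient 2-functor $\mathcal A\otimes_l\mathcal B\to\mathcal A\times\mathcal B$. Let $\mathrm{Fun}_{s,l}(\mathcal X,\mathrm{Cat})$ be the 2-category of 2-functors, lax natural transformations that are strict on tight 1-cells, and modifications. Every 2-functor $\mathcal X\otimes_{s,l}\mathcal Y\to\mathrm{Cat}$ has a transpose $\mathcal X\to\mathrm{Fun}_{s,l}(\mathcal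 Y,\mathrm{Cat})$. **Statement.** Let $\mathcal A,\mathcal B$ be 2-categories and $T:\mathcal A^{op}\times\mathcal B^{op}\times(\mathcal A\otimes_l\mathcal B)\to\mathrm{Cat}$ a 2-functor. (i) *Two-variable lax end.* Let $\int_{a,b}T(a,b,a,b)$ be the lax end over $\mathcal X=\mathcal A\otimes_l\mathcal B$ of the composite of $T$ with $(\mathcal A\otimes_l\mathcal B)^{op}\times(\mathcal A\otimes_l\mathcal B)\to\mathcal A^{op}\times\mathcal B^{op}\times(\mathcal A\otimes_l\mathcal B)$, the quotient 2-functor in the contravariant variable. (ii) *Iterated lax end.* Regard $\mathcal A^{op}\times\mathcal A$ and $\mathcal B^{op}\times\mathcal B$ as $\mathcal F$-categories whose tight 1-cells are those of the form $(f,1)$. Exchanging the two middle factors is a 2-functor $j:(\mathcal A^{op}\times\mathcal A)\otimes_{s,l}(\mathcal B^{op}\times\mathcal B)\to\mathcal A^{op}\times\mathcal B^{op}\times(\mathcal A\otimes_l\mathcal B)$, so $T\circ j$ has a transpose $\widehat T:\mathcal A^{op}\times\mathcal A\to\mathrm{Fun}_{s,l}(\mathcal B^{op}\times\mathcal B,\mathrm{Cat})$,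 $(a,a')\mapsto T(a,-,a',-)$. The lax end over $\mathcal B$ is a 2-functor $\int_b:\mathrm{Fun}_{s,l}(\mathcal B^{op}\times\mathcal B,\mathrm{Cat})\to\mathrm{Cat}$: a 1-cell $\eta:S\to S'$ sends $(s_b,s_g)$ to the object with components $\eta_{b,b}(s_b)$ and with cell at $g:b\to b'$ the lax naturality cell of $\eta$ at $(1,g)$ and $s_b$, followed by $\eta_{b,b'}(s_g)$, where $\eta_{b,b'}S(g,1)=S'(g,1)\eta_{b',b'}$. Let $\int_a\int_bT(a,b,a,b)$ be the lax end over $\mathcal A$ of $\int_b\circ\,\widehat T:\mathcal A^{op}\times\mathcal A\to\mathrm{Cat}$. Then there is an isomorphism of categories $$\int_{a,b}T(a,b,a,b)\;\cong\;\int_a\int_b T(a,b,a,b)$$ that commutes with the projections to $T(a,b,a,b)$ for all objects $a$ of $\mathcal A$ and $b$ of $\mathcal B$. -/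

import Mathlib

universe w₁ v₁ u₁ w₂ v₂ u₂ w₃ v₃ u₃ w₄ v₄ u₄

open CategoryTheory Bicategory Opposite

namespace LaxFubini

/-- The structure of an `F`-category on a 2-category `X`: a class of tight 1-cells, which contains
the identities and is closed under composition. -/
structure FStr (X : Type u₁) [Bicategory.{w₁, v₁} X] where
  Tight : ∀ {x y : X}, (x ⟶ y) → Prop
  tight_id : ∀ x : X, Tight (𝟙 x)
  tight_comp : ∀ {x y z : X} {f : x ⟶ y} {g : y ⟶ z}, Tight f → Tight g → Tight (f ≫ g)

/-- The semi-strict lax Gray tensor product of two `F`-categories `(X, P)` and `(Y, Q)`. Its objects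
are the pairs `(x, y)`. Its 1-cells are generated by the `(f, 1)` and the `(1, g)`, and its 2-cells by
the `(α, 1)`, the `(1, β)` and the Gray cells `Σ : (1, g) ∘ (f, 1) ⟶ (f, 1) ∘ (1, g)`, subject to the
relations below; `Σ` is an identity as soon as `f` or `g` is tight. -/
@[ext]
structure Gray {X : Type u₁} [Bicategory.{w₁, v₁} X] {Y : Type u₂} [Bicategory.{w₂, v₂} Y]
    (P : FStr X) (Q : FStr Y) where
  fst : X
  snd : Y

namespace Gray

section
variable {X : Type u₁} [Bicategory.{w₁, v₁} X] {Y : Type u₂} [Bicategory.{w₂, v₂} Y]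
  (P : FStr X) (Q : FStr Y)

/-- Formal composites of the 1-cells `(f, 1)` and `(1, g)`. -/
inductive Path : Gray P Q → Gray P Q → Type (max u₁ u₂ v₁ v₂)
  | nil (p : Gray P Q) : Path p p
  | left {x x' : X} (f : x ⟶ x') (y : Y) : Path ⟨x, y⟩ ⟨x', y⟩
  | right (x : X) {y y' : Y} (g : y ⟶ y') : Path ⟨x, y⟩ ⟨x, y'⟩
  | comp {p q r : Gray P Q} (s : Path p q) (t : Path q r) : Path p r

variable {P Q}
/-- The relations between the 1-cells. -/
inductive PathRel : ∀ {p q : Gray P Q}, Path P Q p q → Path P Q p q → Prop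
  | comp_left {p q r : Gray P Q} {s s' : Path P Q p q} (t : Path P Q q r) (h : PathRel s s') :
      PathRel (s.comp t) (s'.comp t)
  | comp_right {p q r : Gray P Q} (s : Path P Q p q) {t t' : Path P Q q r} (h : PathRel t t') :
      PathRel (s.comp t) (s.comp t')
  | nil_comp {p q : Gray P Q} (s : Path P Q p q) : PathRel ((Path.nil p).comp s) s
  | comp_nil {p q : Gray P Q} (s : Path P Q p q) : PathRel (s.comp (Path.nil q)) s
  | assoc {p q r t : Gray P Q} (f : Path P Q p q) (g : Path P Q q r) (h : Path P Q r t) :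
      PathRel ((f.comp g).comp h) (f.comp (g.comp h))
  | left_id (x : X) (y : Y) : PathRel (Path.left (𝟙 x) y) (Path.nil ⟨x, y⟩)
  | left_comp {x x' x'' : X} (f : x ⟶ x') (f' : x' ⟶ x'') (y : Y) :
      PathRel (Path.left (f ≫ f') y) ((Path.left f y).comp (Path.left f' y))
  | right_id (x : X) (y : Y) : PathRel (Path.right x (𝟙 y)) (Path.nil ⟨x, y⟩)
  | right_comp (x : X) {y y' y'' : Y} (g : y ⟶ y') (g' : y' ⟶ y'') :
      PathRel (Path.right x (g ≫ g')) ((Path.right x g).comp (Path.right x g'))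
  | tight {x x' : X} (f : x ⟶ x') {y y' : Y} (g : y ⟶ y') (h : P.Tight f ∨ Q.Tight g) :
      PathRel ((Path.left f y).comp (Path.right x' g)) ((Path.right x g).comp (Path.left f y'))

instance : CategoryStruct (Gray P Q) where
  Hom p q := Quot (PathRel (p := p) (q := q))
  id p := Quot.mk _ (Path.nil p)
  comp s t := Quot.map₂ Path.comp (fun s _ _ h => PathRel.comp_right s h)
    (fun _ _ t h => PathRel.comp_left t h) s t

variable (P Q) in
/-- The 1-cell `(f, 1)`. -/
def inl {x x' : X} (f : x ⟶ x') (y : Y) : (⟨x, y⟩ : Gray P Q) ⟶ ⟨x', y⟩ := Quot.mk _ (.left f y)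

variable (P Q) in
/-- The 1-cell `(1, g)`. -/
def inr (x : X) {y y' : Y} (g : y ⟶ y') : (⟨x, y⟩ : Gray P Q) ⟶ ⟨x, y'⟩ := Quot.mk _ (.right x g)

theorem id_comp' {p q : Gray P Q} (s : p ⟶ q) : 𝟙 p ≫ s = s :=
  Quot.inductionOn s fun s => Quot.sound (.nil_comp s)

theorem comp_id' {p q : Gray P Q} (s : p ⟶ q) : s ≫ 𝟙 q = s :=
  Quot.inductionOn s fun s => Quot.sound (.comp_nil s)

theorem assoc' {p q r t : Gray P Q} (f : p ⟶ q) (g : q ⟶ r) (h : r ⟶ t) :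
    (f ≫ g) ≫ h = f ≫ g ≫ h :=
  Quot.inductionOn f fun f => Quot.inductionOn g fun g => Quot.inductionOn h fun h =>
    Quot.sound (.assoc f g h)

theorem inl_id (x : X) (y : Y) : inl P Q (𝟙 x) y = 𝟙 _ := Quot.sound (.left_id x y)

theorem inl_comp {x x' x'' : X} (f : x ⟶ x') (f' : x' ⟶ x'') (y : Y) :
    inl P Q (f ≫ f') y = inl P Q f y ≫ inl P Q f' y := Quot.sound (.left_comp f f' y)

theorem inr_id (x : X) (y : Y) : inr P Q x (𝟙 y) = 𝟙 _ := Quot.sound (.right_id x y)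

theorem inr_comp (x : X) {y y' y'' : Y} (g : y ⟶ y') (g' : y' ⟶ y'') :
    inr P Q x (g ≫ g') = inr P Q x g ≫ inr P Q x g' := Quot.sound (.right_comp x g g')

theorem inl_inr {x x' : X} (f : x ⟶ x') {y y' : Y} (g : y ⟶ y') (h : P.Tight f ∨ Q.Tight g) :
    inl P Q f y ≫ inr P Q x' g = inr P Q x g ≫ inl P Q f y' := Quot.sound (.tight f g h)

variable (P Q) in
/-- Formal composites of the 2-cells `(α, 1)`, `(1, β)` and `Σ`. -/
inductive Cell : ∀ {p q : Gray P Q}, (p ⟶ q) → (p ⟶ q) → Type (max u₁ u₂ v₁ v₂ w₁ w₂)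
  | id {p q : Gray P Q} (f : p ⟶ q) : Cell f f
  | comp {p q : Gray P Q} {f g h : p ⟶ q} (η : Cell f g) (θ : Cell g h) : Cell f h
  | whiskerLeft {p q r : Gray P Q} (f : p ⟶ q) {g h : q ⟶ r} (η : Cell g h) :
      Cell (f ≫ g) (f ≫ h)
  | whiskerRight {p q r : Gray P Q} {f g : p ⟶ q} (η : Cell f g) (h : q ⟶ r) :
      Cell (f ≫ h) (g ≫ h)
  | left {x x' : X} {f f' : x ⟶ x'} (α : f ⟶ f') (y : Y) : Cell (inl P Q f y) (inl P Q f' y)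
  | right (x : X) {y y' : Y} {g g' : y ⟶ y'} (β : g ⟶ g') : Cell (inr P Q x g) (inr P Q x g')
  | sigma {x x' : X} (f : x ⟶ x') {y y' : Y} (g : y ⟶ y') :
      Cell (inl P Q f y ≫ inr P Q x' g) (inr P Q x g ≫ inl P Q f y')

/-- The identity 2-cell between equal 1-cells. -/
def Cell.ofEq {p q : Gray P Q} {f g : p ⟶ q} (h : f = g) : Cell P Q f g := h ▸ Cell.id f

/-- The relations between the 2-cells. -/
inductive CellRel : ∀ {p q : Gray P Q} {f g : p ⟶ q}, Cell P Q f g → Cell P Q f g → Prop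
  | comp_left {p q : Gray P Q} {f g h : p ⟶ q} {η η' : Cell P Q f g} (θ : Cell P Q g h)
      (r : CellRel η η') : CellRel (η.comp θ) (η'.comp θ)
  | comp_right {p q : Gray P Q} {f g h : p ⟶ q} (η : Cell P Q f g) {θ θ' : Cell P Q g h}
      (r : CellRel θ θ') : CellRel (η.comp θ) (η.comp θ')
  | whiskerLeft_congr {p q r : Gray P Q} (f : p ⟶ q) {g h : q ⟶ r} {η η' : Cell P Q g h}
      (r : CellRel η η') : CellRel (η.whiskerLeft f) (η'.whiskerLeft f)
  | whiskerRight_congr {p q r : Gray P Q} {f g : p ⟶ q} {η η' : Cell P Q f g} (h : q ⟶ r)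
      (r : CellRel η η') : CellRel (η.whiskerRight h) (η'.whiskerRight h)
  -- the 2-cells between two fixed objects form a category
  | id_comp {p q : Gray P Q} {f g : p ⟶ q} (η : Cell P Q f g) : CellRel ((Cell.id f).comp η) η
  | comp_id {p q : Gray P Q} {f g : p ⟶ q} (η : Cell P Q f g) : CellRel (η.comp (Cell.id g)) η
  | assoc {p q : Gray P Q} {f g h i : p ⟶ q} (η : Cell P Q f g) (θ : Cell P Q g h)
      (κ : Cell P Q h i) : CellRel ((η.comp θ).comp κ) (η.comp (θ.comp κ))
  -- whiskering makes this a strict 2-category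
  | whiskerLeft_id {p q r : Gray P Q} (f : p ⟶ q) (g : q ⟶ r) :
      CellRel ((Cell.id g).whiskerLeft f) (Cell.id (f ≫ g))
  | whiskerLeft_comp {p q r : Gray P Q} (f : p ⟶ q) {g h i : q ⟶ r} (η : Cell P Q g h)
      (θ : Cell P Q h i) :
      CellRel ((η.comp θ).whiskerLeft f) ((η.whiskerLeft f).comp (θ.whiskerLeft f))
  | id_whiskerLeft {p q : Gray P Q} {f g : p ⟶ q} (η : Cell P Q f g) :
      CellRel (η.whiskerLeft (𝟙 p))
        ((Cell.ofEq (id_comp' f)).comp (η.comp (Cell.ofEq (id_comp' g).symm)))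
  | comp_whiskerLeft {p q r s : Gray P Q} (f : p ⟶ q) (g : q ⟶ r) {h i : r ⟶ s}
      (η : Cell P Q h i) :
      CellRel (η.whiskerLeft (f ≫ g)) ((Cell.ofEq (assoc' f g h)).comp
        (((η.whiskerLeft g).whiskerLeft f).comp (Cell.ofEq (assoc' f g i).symm)))
  | id_whiskerRight {p q r : Gray P Q} (f : p ⟶ q) (g : q ⟶ r) :
      CellRel ((Cell.id f).whiskerRight g) (Cell.id (f ≫ g))
  | comp_whiskerRight {p q r : Gray P Q} {f g h : p ⟶ q} (η : Cell P Q f g) (θ : Cell P Q g h)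
      (i : q ⟶ r) :
      CellRel ((η.comp θ).whiskerRight i) ((η.whiskerRight i).comp (θ.whiskerRight i))
  | whiskerRight_id {p q : Gray P Q} {f g : p ⟶ q} (η : Cell P Q f g) :
      CellRel (η.whiskerRight (𝟙 q))
        ((Cell.ofEq (comp_id' f)).comp (η.comp (Cell.ofEq (comp_id' g).symm)))
  | whiskerRight_comp {p q r s : Gray P Q} {f g : p ⟶ q} (η : Cell P Q f g) (h : q ⟶ r)
      (i : r ⟶ s) :
      CellRel (η.whiskerRight (h ≫ i)) ((Cell.ofEq (assoc' f h i).symm).comp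
        (((η.whiskerRight h).whiskerRight i).comp (Cell.ofEq (assoc' g h i))))
  | whisker_assoc {p q r s : Gray P Q} (f : p ⟶ q) {g h : q ⟶ r} (η : Cell P Q g h)
      (i : r ⟶ s) :
      CellRel ((η.whiskerLeft f).whiskerRight i) ((Cell.ofEq (assoc' f g i)).comp
        (((η.whiskerRight i).whiskerLeft f).comp (Cell.ofEq (assoc' f h i).symm)))
  | whisker_exchange {p q r : Gray P Q} {f g : p ⟶ q} {h i : q ⟶ r} (η : Cell P Q f g)
      (θ : Cell P Q h i) :
      CellRel ((θ.whiskerLeft f).comp (η.whiskerRight i))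
        ((η.whiskerRight h).comp (θ.whiskerLeft g))
  -- the 2-cells `(α, 1)` and `(1, β)` compose as in the two factors
  | left_id {x x' : X} (f : x ⟶ x') (y : Y) :
      CellRel (Cell.left (𝟙 f) y) (Cell.id (inl P Q f y))
  | left_comp {x x' : X} {f f' f'' : x ⟶ x'} (α : f ⟶ f') (α' : f' ⟶ f'') (y : Y) :
      CellRel (Cell.left (α ≫ α') y) ((Cell.left α y).comp (Cell.left α' y))
  | left_whiskerLeft {x x' x'' : X} (f : x ⟶ x') {h h' : x' ⟶ x''} (α : h ⟶ h') (y : Y) :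
      CellRel (Cell.left (f ◁ α) y) ((Cell.ofEq (inl_comp f h y)).comp
        (((Cell.left α y).whiskerLeft (inl P Q f y)).comp (Cell.ofEq (inl_comp f h' y).symm)))
  | left_whiskerRight {x x' x'' : X} {f f' : x ⟶ x'} (α : f ⟶ f') (h : x' ⟶ x'') (y : Y) :
      CellRel (Cell.left (α ▷ h) y) ((Cell.ofEq (inl_comp f h y)).comp
        (((Cell.left α y).whiskerRight (inl P Q h y)).comp (Cell.ofEq (inl_comp f' h y).symm)))
  | right_id (x : X) {y y' : Y} (g : y ⟶ y') :
      CellRel (Cell.right x (𝟙 g)) (Cell.id (inr P Q x g))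
  | right_comp (x : X) {y y' : Y} {g g' g'' : y ⟶ y'} (β : g ⟶ g') (β' : g' ⟶ g'') :
      CellRel (Cell.right x (β ≫ β')) ((Cell.right x β).comp (Cell.right x β'))
  | right_whiskerLeft (x : X) {y y' y'' : Y} (g : y ⟶ y') {h h' : y' ⟶ y''} (β : h ⟶ h') :
      CellRel (Cell.right x (g ◁ β)) ((Cell.ofEq (inr_comp x g h)).comp
        (((Cell.right x β).whiskerLeft (inr P Q x g)).comp (Cell.ofEq (inr_comp x g h').symm)))
  | right_whiskerRight (x : X) {y y' y'' : Y} {g g' : y ⟶ y'} (β : g ⟶ g') (h : y' ⟶ y'') :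
      CellRel (Cell.right x (β ▷ h)) ((Cell.ofEq (inr_comp x g h)).comp
        (((Cell.right x β).whiskerRight (inr P Q x h)).comp (Cell.ofEq (inr_comp x g' h).symm)))
  -- coherence of the Gray cells
  | sigma_left {x x' : X} {f f' : x ⟶ x'} (α : f ⟶ f') {y y' : Y} (g : y ⟶ y') :
      CellRel (((Cell.left α y).whiskerRight (inr P Q x' g)).comp (Cell.sigma f' g))
        ((Cell.sigma f g).comp ((Cell.left α y').whiskerLeft (inr P Q x g)))
  | sigma_right {x x' : X} (f : x ⟶ x') {y y' : Y} {g g' : y ⟶ y'} (β : g ⟶ g') :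
      CellRel (((Cell.right x' β).whiskerLeft (inl P Q f y)).comp (Cell.sigma f g'))
        ((Cell.sigma f g).comp ((Cell.right x β).whiskerRight (inl P Q f y')))
  | sigma_comp_left {x x' x'' : X} (f : x ⟶ x') (f' : x' ⟶ x'') {y y' : Y} (g : y ⟶ y') :
      CellRel (Cell.sigma (f ≫ f') g)
        ((Cell.ofEq (by rw [inl_comp, assoc'])).comp
          (((Cell.sigma f' g).whiskerLeft (inl P Q f y)).comp
            ((Cell.ofEq (assoc' _ _ _).symm).comp
              (((Cell.sigma f g).whiskerRight (inl P Q f' y')).comp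
                (Cell.ofEq (by rw [inl_comp, assoc']))))))
  | sigma_comp_right {x x' : X} (f : x ⟶ x') {y y' y'' : Y} (g : y ⟶ y') (g' : y' ⟶ y'') :
      CellRel (Cell.sigma f (g ≫ g'))
        ((Cell.ofEq (by rw [inr_comp, assoc'])).comp
          (((Cell.sigma f g).whiskerRight (inr P Q x' g')).comp
            ((Cell.ofEq (assoc' _ _ _)).comp
              (((Cell.sigma f g').whiskerLeft (inr P Q x g)).comp
                (Cell.ofEq (by rw [inr_comp, assoc']))))))
  | sigma_tight {x x' : X} (f : x ⟶ x') {y y' : Y} (g : y ⟶ y') (h : P.Tight f ∨ Q.Tight g) :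
      CellRel (Cell.sigma f g) (Cell.ofEq (inl_inr f g h))

instance homCategory (p q : Gray P Q) : Category (p ⟶ q) where
  Hom f g := Quot (CellRel (P := P) (Q := Q) (f := f) (g := g))
  id f := Quot.mk _ (Cell.id f)
  comp η θ := Quot.map₂ Cell.comp (fun η _ _ h => CellRel.comp_right η h)
    (fun _ _ θ h => CellRel.comp_left θ h) η θ
  id_comp η := Quot.inductionOn η fun η => Quot.sound (.id_comp η)
  comp_id η := Quot.inductionOn η fun η => Quot.sound (.comp_id η)
  assoc η θ κ := Quot.inductionOn η fun η => Quot.inductionOn θ fun θ =>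
    Quot.inductionOn κ fun κ => Quot.sound (.assoc η θ κ)

theorem mk_ofEq {p q : Gray P Q} {f g : p ⟶ q} (h : f = g) :
    (Quot.mk _ (Cell.ofEq h) : f ⟶ g) = eqToHom h := by
  cases h; rfl

/-- Left whiskering in the Gray tensor product. -/
def wL {p q r : Gray P Q} (f : p ⟶ q) {g h : q ⟶ r} (η : g ⟶ h) : f ≫ g ⟶ f ≫ h :=
  Quot.map (Cell.whiskerLeft f) (fun _ _ r => .whiskerLeft_congr f r) η

/-- Right whiskering in the Gray tensor product. -/
def wR {p q r : Gray P Q} {f g : p ⟶ q} (η : f ⟶ g) (h : q ⟶ r) : f ≫ h ⟶ g ≫ h :=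
  Quot.map (fun η => Cell.whiskerRight η h) (fun _ _ r => .whiskerRight_congr h r) η

theorem wL_eqToHom {p q r : Gray P Q} (f : p ⟶ q) {g h : q ⟶ r} (e : g = h) :
    wL f (eqToHom e) = eqToHom (e ▸ rfl) := by
  cases e; exact Quot.sound (.whiskerLeft_id f g)

theorem wR_eqToHom {p q r : Gray P Q} {f g : p ⟶ q} (e : f = g) (h : q ⟶ r) :
    wR (eqToHom e) h = eqToHom (e ▸ rfl) := by
  cases e; exact Quot.sound (.id_whiskerRight f h)

instance bicategory : Bicategory (Gray P Q) where
  homCategory := homCategory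
  whiskerLeft f _ _ η := wL f η
  whiskerRight η h := wR η h
  associator f g h := eqToIso (assoc' f g h)
  leftUnitor f := eqToIso (id_comp' f)
  rightUnitor f := eqToIso (comp_id' f)
  whiskerLeft_id f g := Quot.sound (.whiskerLeft_id f g)
  whiskerLeft_comp f _ _ _ η θ := Quot.inductionOn η fun η => Quot.inductionOn θ fun θ =>
    Quot.sound (.whiskerLeft_comp f η θ)
  id_whiskerLeft η := by
    simp only [eqToIso.hom, eqToIso.inv, ← mk_ofEq]
    exact Quot.inductionOn η fun η => Quot.sound (.id_whiskerLeft η)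
  comp_whiskerLeft f g _ _ η := by
    simp only [eqToIso.hom, eqToIso.inv, ← mk_ofEq]
    exact Quot.inductionOn η fun η => Quot.sound (.comp_whiskerLeft f g η)
  id_whiskerRight f g := Quot.sound (.id_whiskerRight f g)
  comp_whiskerRight η θ i := Quot.inductionOn η fun η => Quot.inductionOn θ fun θ =>
    Quot.sound (.comp_whiskerRight η θ i)
  whiskerRight_id η := by
    simp only [eqToIso.hom, eqToIso.inv, ← mk_ofEq]
    exact Quot.inductionOn η fun η => Quot.sound (.whiskerRight_id η)
  whiskerRight_comp η g h := by
    simp only [eqToIso.hom, eqToIso.inv, ← mk_ofEq]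
    exact Quot.inductionOn η fun η => Quot.sound (.whiskerRight_comp η g h)
  whisker_assoc f _ _ η h := by
    simp only [eqToIso.hom, eqToIso.inv, ← mk_ofEq]
    exact Quot.inductionOn η fun η => Quot.sound (.whisker_assoc f η h)
  whisker_exchange η θ := Quot.inductionOn η fun η => Quot.inductionOn θ fun θ =>
    Quot.sound (.whisker_exchange η θ)
  pentagon f g h i := by simp [wL_eqToHom, wR_eqToHom]
  triangle f g := by simp [wL_eqToHom, wR_eqToHom]

instance : Bicategory.Strict (Gray P Q) where
  id_comp := id_comp'
  comp_id := comp_id'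
  assoc := assoc'
  leftUnitor_eqToIso _ := rfl
  rightUnitor_eqToIso _ := rfl
  associator_eqToIso _ _ _ := rfl

variable (P Q) in
/-- The 2-cell `(α, 1)`. -/
def inl₂ {x x' : X} {f f' : x ⟶ x'} (α : f ⟶ f') (y : Y) : inl P Q f y ⟶ inl P Q f' y :=
  Quot.mk _ (.left α y)

variable (P Q) in
/-- The 2-cell `(1, β)`. -/
def inr₂ (x : X) {y y' : Y} {g g' : y ⟶ y'} (β : g ⟶ g') : inr P Q x g ⟶ inr P Q x g' :=
  Quot.mk _ (.right x β)

variable (P Q) in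
/-- The Gray cell `Σ : (1, g) ∘ (f, 1) ⟶ (f, 1) ∘ (1, g)` (in diagrammatic order
`(f, 1) ≫ (1, g) ⟶ (1, g) ≫ (f, 1)`). -/
def gray {x x' : X} (f : x ⟶ x') {y y' : Y} (g : y ⟶ y') :
    inl P Q f y ≫ inr P Q x' g ⟶ inr P Q x g ≫ inl P Q f y' :=
  Quot.mk _ (.sigma f g)
end
end Gray

namespace Gray

section
variable {X : Type u₁} [Bicategory.{w₁, v₁} X] {Y : Type u₂} [Bicategory.{w₂, v₂} Y]
  (P : FStr X) (Q : FStr Y)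

theorem inl₂_id {x x' : X} (f : x ⟶ x') (y : Y) : inl₂ P Q (𝟙 f) y = 𝟙 _ :=
  Quot.sound (.left_id f y)

theorem inl₂_comp {x x' : X} {f f' f'' : x ⟶ x'} (α : f ⟶ f') (α' : f' ⟶ f'') (y : Y) :
    inl₂ P Q (α ≫ α') y = inl₂ P Q α y ≫ inl₂ P Q α' y := Quot.sound (.left_comp α α' y)

theorem inl₂_whiskerLeft {x x' x'' : X} (f : x ⟶ x') {h h' : x' ⟶ x''} (α : h ⟶ h') (y : Y) :
    inl₂ P Q (f ◁ α) y = eqToHom (inl_comp f h y) ≫ inl P Q f y ◁ inl₂ P Q α y ≫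
      eqToHom (inl_comp f h' y).symm := by
  rw [← mk_ofEq, ← mk_ofEq]; exact Quot.sound (.left_whiskerLeft f α y)

theorem inl₂_whiskerRight {x x' x'' : X} {f f' : x ⟶ x'} (α : f ⟶ f') (h : x' ⟶ x'') (y : Y) :
    inl₂ P Q (α ▷ h) y = eqToHom (inl_comp f h y) ≫ inl₂ P Q α y ▷ inl P Q h y ≫
      eqToHom (inl_comp f' h y).symm := by
  rw [← mk_ofEq, ← mk_ofEq]; exact Quot.sound (.left_whiskerRight α h y)

theorem inr₂_id (x : X) {y y' : Y} (g : y ⟶ y') : inr₂ P Q x (𝟙 g) = 𝟙 _ :=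
  Quot.sound (.right_id x g)

theorem inr₂_comp (x : X) {y y' : Y} {g g' g'' : y ⟶ y'} (β : g ⟶ g') (β' : g' ⟶ g'') :
    inr₂ P Q x (β ≫ β') = inr₂ P Q x β ≫ inr₂ P Q x β' := Quot.sound (.right_comp x β β')

theorem inr₂_whiskerLeft (x : X) {y y' y'' : Y} (g : y ⟶ y') {h h' : y' ⟶ y''} (β : h ⟶ h') :
    inr₂ P Q x (g ◁ β) = eqToHom (inr_comp x g h) ≫ inr P Q x g ◁ inr₂ P Q x β ≫
      eqToHom (inr_comp x g h').symm := by
  rw [← mk_ofEq, ← mk_ofEq]; exact Quot.sound (.right_whiskerLeft x g β)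

theorem inr₂_whiskerRight (x : X) {y y' y'' : Y} {g g' : y ⟶ y'} (β : g ⟶ g') (h : y' ⟶ y'') :
    inr₂ P Q x (β ▷ h) = eqToHom (inr_comp x g h) ≫ inr₂ P Q x β ▷ inr P Q x h ≫
      eqToHom (inr_comp x g' h).symm := by
  rw [← mk_ofEq, ← mk_ofEq]; exact Quot.sound (.right_whiskerRight x β h)

theorem gray_left {x x' : X} {f f' : x ⟶ x'} (α : f ⟶ f') {y y' : Y} (g : y ⟶ y') :
    inl₂ P Q α y ▷ inr P Q x' g ≫ gray P Q f' g =
      gray P Q f g ≫ inr P Q x g ◁ inl₂ P Q α y' := Quot.sound (.sigma_left α g)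

theorem gray_right {x x' : X} (f : x ⟶ x') {y y' : Y} {g g' : y ⟶ y'} (β : g ⟶ g') :
    inl P Q f y ◁ inr₂ P Q x' β ≫ gray P Q f g' =
      gray P Q f g ≫ inr₂ P Q x β ▷ inl P Q f y' := Quot.sound (.sigma_right f β)

theorem gray_comp_left {x x' x'' : X} (f : x ⟶ x') (f' : x' ⟶ x'') {y y' : Y} (g : y ⟶ y') :
    gray P Q (f ≫ f') g =
      eqToHom (by rw [inl_comp, assoc']) ≫ inl P Q f y ◁ gray P Q f' g ≫
        eqToHom (assoc' _ _ _).symm ≫ gray P Q f g ▷ inl P Q f' y' ≫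
          eqToHom (by rw [inl_comp, assoc']) := by
  simp only [← mk_ofEq]; exact Quot.sound (.sigma_comp_left f f' g)

theorem gray_comp_right {x x' : X} (f : x ⟶ x') {y y' y'' : Y} (g : y ⟶ y') (g' : y' ⟶ y'') :
    gray P Q f (g ≫ g') =
      eqToHom (by rw [inr_comp, assoc']) ≫ gray P Q f g ▷ inr P Q x' g' ≫
        eqToHom (assoc' _ _ _) ≫ inr P Q x g ◁ gray P Q f g' ≫
          eqToHom (by rw [inr_comp, assoc']) := by
  simp only [← mk_ofEq]; exact Quot.sound (.sigma_comp_right f g g')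

theorem gray_tight {x x' : X} (f : x ⟶ x') {y y' : Y} (g : y ⟶ y')
    (h : P.Tight f ∨ Q.Tight g) : gray P Q f g = eqToHom (inl_inr f g h) := by
  rw [← mk_ofEq]; exact Quot.sound (.sigma_tight f g h)

/-- The data of a 2-functor out of a semi-strict Gray tensor product. -/
structure Bifunctor (C : Type u₃) [Bicategory.{w₃, v₃} C] where
  obj : X → Y → C
  mapL : ∀ {x x' : X} (_ : x ⟶ x') (y : Y), obj x y ⟶ obj x' y
  mapR : ∀ (x : X) {y y' : Y} (_ : y ⟶ y'), obj x y ⟶ obj x y'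
  mapL₂ : ∀ {x x' : X} {f f' : x ⟶ x'} (_ : f ⟶ f') (y : Y), mapL f y ⟶ mapL f' y
  mapR₂ : ∀ (x : X) {y y' : Y} {g g' : y ⟶ y'} (_ : g ⟶ g'), mapR x g ⟶ mapR x g'
  swap : ∀ {x x' : X} (f : x ⟶ x') {y y' : Y} (g : y ⟶ y'),
    mapL f y ≫ mapR x' g ⟶ mapR x g ≫ mapL f y'
  mapL_id : ∀ (x : X) (y : Y), mapL (𝟙 x) y = 𝟙 _
  mapL_comp : ∀ {x x' x'' : X} (f : x ⟶ x') (f' : x' ⟶ x'') (y : Y),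
    mapL (f ≫ f') y = mapL f y ≫ mapL f' y
  mapR_id : ∀ (x : X) (y : Y), mapR x (𝟙 y) = 𝟙 _
  mapR_comp : ∀ (x : X) {y y' y'' : Y} (g : y ⟶ y') (g' : y' ⟶ y''),
    mapR x (g ≫ g') = mapR x g ≫ mapR x g'
  mapL₂_id : ∀ {x x' : X} (f : x ⟶ x') (y : Y), mapL₂ (𝟙 f) y = 𝟙 _
  mapL₂_comp : ∀ {x x' : X} {f f' f'' : x ⟶ x'} (α : f ⟶ f') (α' : f' ⟶ f'') (y : Y),
    mapL₂ (α ≫ α') y = mapL₂ α y ≫ mapL₂ α' y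
  mapL₂_whiskerLeft : ∀ {x x' x'' : X} (f : x ⟶ x') {h h' : x' ⟶ x''} (α : h ⟶ h') (y : Y),
    mapL₂ (f ◁ α) y = eqToHom (mapL_comp f h y) ≫ mapL f y ◁ mapL₂ α y ≫
      eqToHom (mapL_comp f h' y).symm
  mapL₂_whiskerRight : ∀ {x x' x'' : X} {f f' : x ⟶ x'} (α : f ⟶ f') (h : x' ⟶ x'') (y : Y),
    mapL₂ (α ▷ h) y = eqToHom (mapL_comp f h y) ≫ mapL₂ α y ▷ mapL h y ≫
      eqToHom (mapL_comp f' h y).symm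
  mapR₂_id : ∀ (x : X) {y y' : Y} (g : y ⟶ y'), mapR₂ x (𝟙 g) = 𝟙 _
  mapR₂_comp : ∀ (x : X) {y y' : Y} {g g' g'' : y ⟶ y'} (β : g ⟶ g') (β' : g' ⟶ g''),
    mapR₂ x (β ≫ β') = mapR₂ x β ≫ mapR₂ x β'
  mapR₂_whiskerLeft : ∀ (x : X) {y y' y'' : Y} (g : y ⟶ y') {h h' : y' ⟶ y''} (β : h ⟶ h'),
    mapR₂ x (g ◁ β) = eqToHom (mapR_comp x g h) ≫ mapR x g ◁ mapR₂ x β ≫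
      eqToHom (mapR_comp x g h').symm
  mapR₂_whiskerRight : ∀ (x : X) {y y' y'' : Y} {g g' : y ⟶ y'} (β : g ⟶ g') (h : y' ⟶ y''),
    mapR₂ x (β ▷ h) = eqToHom (mapR_comp x g h) ≫ mapR₂ x β ▷ mapR x h ≫
      eqToHom (mapR_comp x g' h).symm
  swap_left : ∀ {x x' : X} {f f' : x ⟶ x'} (α : f ⟶ f') {y y' : Y} (g : y ⟶ y'),
    mapL₂ α y ▷ mapR x' g ≫ swap f' g = swap f g ≫ mapR x g ◁ mapL₂ α y'
  swap_right : ∀ {x x' : X} (f : x ⟶ x') {y y' : Y} {g g' : y ⟶ y'} (β : g ⟶ g'),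
    mapL f y ◁ mapR₂ x' β ≫ swap f g' = swap f g ≫ mapR₂ x β ▷ mapL f y'
  swap_comp_left : ∀ {x x' x'' : X} (f : x ⟶ x') (f' : x' ⟶ x'') {y y' : Y} (g : y ⟶ y'),
    swap (f ≫ f') g = eqToHom (mapL_comp f f' y) ▷ mapR x'' g ≫ (α_ _ _ _).hom ≫
      mapL f y ◁ swap f' g ≫ (α_ _ _ _).inv ≫ swap f g ▷ mapL f' y' ≫ (α_ _ _ _).hom ≫
        mapR x g ◁ eqToHom (mapL_comp f f' y').symm
  swap_comp_right : ∀ {x x' : X} (f : x ⟶ x') {y y' y'' : Y} (g : y ⟶ y') (g' : y' ⟶ y''),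
    swap f (g ≫ g') = mapL f y ◁ eqToHom (mapR_comp x' g g') ≫ (α_ _ _ _).inv ≫
      swap f g ▷ mapR x' g' ≫ (α_ _ _ _).hom ≫ mapR x g ◁ swap f g' ≫ (α_ _ _ _).inv ≫
        eqToHom (mapR_comp x g g').symm ▷ mapL f y''
  swap_tight : ∀ {x x' : X} (f : x ⟶ x') {y y' : Y} (g : y ⟶ y'), P.Tight f ∨ Q.Tight g →
    ∃ h : mapL f y ≫ mapR x' g = mapR x g ≫ mapL f y', swap f g = eqToHom h

namespace Bifunctor
variable {P Q} {C : Type u₃} [Bicategory.{w₃, v₃} C] [Strict C] (D : Bifunctor P Q C)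

/-- The value of `D` on a formal composite of 1-cells. -/
def evalPath : ∀ {p q : Gray P Q}, Path P Q p q → (D.obj p.fst p.snd ⟶ D.obj q.fst q.snd)
  | _, _, .nil _ => 𝟙 _
  | _, _, .left f y => D.mapL f y
  | _, _, .right x g => D.mapR x g
  | _, _, .comp s t => evalPath s ≫ evalPath t

theorem evalPath_rel {p q : Gray P Q} {s t : Path P Q p q} (h : PathRel s t) :
    D.evalPath s = D.evalPath t := by
  induction h with
  | comp_left t h ih => simp only [evalPath, ih]
  | comp_right s h ih => simp only [evalPath, ih]
  | nil_comp s => exact Strict.id_comp _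
  | comp_nil s => exact Strict.comp_id _
  | assoc f g h => exact Strict.assoc _ _ _
  | left_id x y => exact D.mapL_id x y
  | left_comp f f' y => exact D.mapL_comp f f' y
  | right_id x y => exact D.mapR_id x y
  | right_comp x g g' => exact D.mapR_comp x g g'
  | tight f g h => exact (D.swap_tight f g h).1

/-- The value of `D` on a 1-cell. -/
def evalHom {p q : Gray P Q} (s : p ⟶ q) : D.obj p.fst p.snd ⟶ D.obj q.fst q.snd :=
  Quot.lift D.evalPath (fun _ _ h => D.evalPath_rel h) s

theorem evalHom_comp {p q r : Gray P Q} (s : p ⟶ q) (t : q ⟶ r) :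
    D.evalHom (s ≫ t) = D.evalHom s ≫ D.evalHom t :=
  Quot.inductionOn s fun _ => Quot.inductionOn t fun _ => rfl

/-- The value of `D` on a formal composite of 2-cells. -/
def evalCell : ∀ {p q : Gray P Q} {s t : p ⟶ q}, Cell P Q s t → (D.evalHom s ⟶ D.evalHom t)
  | _, _, _, _, .id s => 𝟙 (D.evalHom s)
  | _, _, _, _, .comp η θ => evalCell η ≫ evalCell θ
  | _, _, _, _, .whiskerLeft f η =>
      eqToHom (D.evalHom_comp _ _) ≫ D.evalHom f ◁ evalCell η ≫ eqToHom (D.evalHom_comp _ _).symm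
  | _, _, _, _, .whiskerRight η h =>
      eqToHom (D.evalHom_comp _ _) ≫ evalCell η ▷ D.evalHom h ≫ eqToHom (D.evalHom_comp _ _).symm
  | _, _, _, _, .left α y => D.mapL₂ α y
  | _, _, _, _, .right x β => D.mapR₂ x β
  | _, _, _, _, .sigma f g => D.swap f g

theorem evalCell_ofEq {p q : Gray P Q} {s t : p ⟶ q} (h : s = t) :
    D.evalCell (Cell.ofEq h) = eqToHom (congrArg D.evalHom h) := by
  cases h; rfl

theorem wl_conj {a b c : C} {f f' : a ⟶ b} (h : f = f') {g g' : b ⟶ c} (η : g ⟶ g') :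
    f ◁ η = eqToHom (by rw [h]) ≫ f' ◁ η ≫ eqToHom (by rw [h]) := by
  cases h; simp

theorem wr_conj {a b c : C} {f f' : a ⟶ b} (η : f ⟶ f') {g g' : b ⟶ c} (h : g = g') :
    η ▷ g = eqToHom (by rw [h]) ≫ η ▷ g' ≫ eqToHom (by rw [h]) := by
  cases h; simp

theorem evalHom_id (p : Gray P Q) : D.evalHom (𝟙 p) = 𝟙 _ := rfl

theorem evalCell_rel {p q : Gray P Q} {s t : p ⟶ q} {η θ : Cell P Q s t} (h : CellRel η θ) :
    D.evalCell η = D.evalCell θ := by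
  induction h with
  | comp_left t h ih => simp only [evalCell, ih]
  | comp_right s h ih => simp only [evalCell, ih]
  | whiskerLeft_congr t h ih => simp only [evalCell, ih]
  | whiskerRight_congr s h ih => simp only [evalCell, ih]
  | id_comp => simp [evalCell]
  | comp_id => simp [evalCell]
  | assoc => simp [evalCell]
  | whiskerLeft_id f g => simp [evalCell]
  | whiskerLeft_comp => simp [evalCell]
  | id_whiskerLeft η => 
    simp only [evalCell, evalCell_ofEq]
    rw [wl_conj (D.evalHom_id _)]
    simp [Strict.leftUnitor_eqToIso]
  | comp_whiskerLeft f g η =>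
    simp only [evalCell, evalCell_ofEq]
    rw [wl_conj (D.evalHom_comp _ _)]
    simp [Strict.associator_eqToIso]
  | id_whiskerRight => simp [evalCell]
  | comp_whiskerRight => simp [evalCell]
  | whiskerRight_id η => 
    simp only [evalCell, evalCell_ofEq]
    rw [wr_conj _ (D.evalHom_id _)]
    simp [Strict.rightUnitor_eqToIso]
  | whiskerRight_comp η => 
    simp only [evalCell, evalCell_ofEq]
    rw [wr_conj _ (D.evalHom_comp _ _)]
    simp [Strict.associator_eqToIso]
  | whisker_assoc => 
    simp [evalCell, evalCell_ofEq, Strict.associator_eqToIso]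
  | whisker_exchange η θ => 
    simp [evalCell, whisker_exchange_assoc]
  | left_id => exact D.mapL₂_id _ _
  | left_comp => exact D.mapL₂_comp _ _ _
  | left_whiskerLeft f α y =>
    simp [evalCell, evalCell_ofEq]
    exact D.mapL₂_whiskerLeft f α y
  | left_whiskerRight α f y =>
    simp [evalCell, evalCell_ofEq]
    exact D.mapL₂_whiskerRight α f y
  | right_id => exact D.mapR₂_id _ _
  | right_comp => exact D.mapR₂_comp _ _ _
  | right_whiskerLeft x f α =>
    simp [evalCell, evalCell_ofEq]
    exact D.mapR₂_whiskerLeft x f α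
  | right_whiskerRight x α f =>
    simp [evalCell, evalCell_ofEq]
    exact D.mapR₂_whiskerRight x α f
  | sigma_left α g =>
    change (𝟙 (_ ≫ _) ≫ D.mapL₂ α _ ▷ D.mapR _ g ≫ 𝟙 (_ ≫ _)) ≫ D.swap _ g =
      D.swap _ g ≫ 𝟙 (_ ≫ _) ≫ D.mapR _ g ◁ D.mapL₂ α _ ≫ 𝟙 (_ ≫ _)
    simpa using D.swap_left α g
  | sigma_right f β =>
    change (𝟙 (_ ≫ _) ≫ D.mapL f _ ◁ D.mapR₂ _ β ≫ 𝟙 (_ ≫ _)) ≫ D.swap f _ =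
      D.swap f _ ≫ 𝟙 (_ ≫ _) ≫ D.mapR₂ _ β ▷ D.mapL f _ ≫ 𝟙 (_ ≫ _)
    simpa using D.swap_right f β
  | sigma_comp_left f f' g =>
    simp [evalCell, evalCell_ofEq]
    refine (D.swap_comp_left f f' g).trans ?_
    simp [Strict.associator_eqToIso]
    rfl
  | sigma_comp_right f g g' =>
    simp [evalCell, evalCell_ofEq]
    refine (D.swap_comp_right f g g').trans ?_
    simp [Strict.associator_eqToIso]
    rfl
  | sigma_tight f g h =>
    rw [evalCell_ofEq]
    exact (D.swap_tight f g h).2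

/-- The 2-functor out of the Gray tensor product with data `D`. -/
def lift : StrictPseudofunctor (Gray P Q) C := StrictPseudofunctor.mk''
  { obj p := D.obj p.fst p.snd
    map s := D.evalHom s
    map₂ η := Quot.lift D.evalCell (fun _ _ h => D.evalCell_rel h) η
    map₂_id _ := rfl
    map₂_comp η θ := Quot.inductionOn η fun _ => Quot.inductionOn θ fun _ => rfl
    map_id _ := rfl
    map_comp := D.evalHom_comp
    map₂_whisker_left _ _ _ η := Quot.inductionOn η fun _ => rfl
    map₂_whisker_right η _ := Quot.inductionOn η fun _ => rfl }

end Bifunctor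
end
end Gray

section
variable (X : Type u₁) [Bicategory.{w₁, v₁} X] 

/-- Being an identity 1-cell. -/
inductive IsIdCell : ∀ {x y : X}, (x ⟶ y) → Prop
  | mk (x : X) : IsIdCell (𝟙 x)

/-- The smallest `F`-category structure: only the identities are tight. -/
def FStr.min [Strict X] : FStr X where
  Tight := IsIdCell X
  tight_id := .mk
  tight_comp := by
    rintro a _ _ _ _ ⟨_⟩ ⟨_⟩
    rw [Strict.id_comp]; exact .mk a

variable (Y : Type u₂) [Bicategory.{w₂, v₂} Y]

/-- Being a 1-cell `(f, 1)` of a product. -/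
inductive IsFstCell : ∀ {p q : X × Y}, (p ⟶ q) → Prop
  | mk {x x' : X} (f : x ⟶ x') (y : Y) : IsFstCell (p := (x, y)) (q := (x', y)) (f, 𝟙 y)

/-- The `F`-category structure on `X × Y` whose tight 1-cells are the `(f, 1)`. -/
def FStr.fst [Strict Y] : FStr (X × Y) where
  Tight := IsFstCell X Y
  tight_id p := .mk (𝟙 p.1) p.2
  tight_comp := by
    rintro _ _ _ _ _ ⟨f, y⟩ ⟨g, _⟩
    have h := IsFstCell.mk (X := X) (f ≫ g) y
    rw [← Strict.id_comp (𝟙 y)] at h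
    exact h
end

section
variable {X : Type u₁} [Bicategory.{w₁, v₁} X]

theorem op_unop2_eqToHom {a b : Xᵒᵖ} {f g : a ⟶ b} (h : f = g) :
    (eqToHom h).unop2 = eqToHom (congrArg Quiver.Hom.unop h) := by
  cases h; rfl

theorem op_hom2_ext {a b : Xᵒᵖ} {f g : a ⟶ b} {η θ : f ⟶ g} (h : η.unop2 = θ.unop2) : η = θ :=
  congrArg Bicategory.Opposite.Hom2.op2' h

instance opStrict [Strict X] : Strict Xᵒᵖ where
  id_comp f := congrArg Quiver.Hom.op (Strict.comp_id f.unop)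
  comp_id f := congrArg Quiver.Hom.op (Strict.id_comp f.unop)
  assoc f g h := congrArg Quiver.Hom.op (Strict.assoc h.unop g.unop f.unop).symm
  leftUnitor_eqToIso f := by
    ext; apply op_hom2_ext; simp [op_unop2_eqToHom, Strict.rightUnitor_eqToIso]
  rightUnitor_eqToIso f := by
    ext; apply op_hom2_ext; simp [op_unop2_eqToHom, Strict.leftUnitor_eqToIso]
  associator_eqToIso f g h := by
    ext; apply op_hom2_ext; simp [op_unop2_eqToHom, Strict.associator_eqToIso]

variable {Y : Type u₂} [Bicategory.{w₂, v₂} Y]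

theorem prod_eqToHom_fst {p q : X × Y} {f g : p ⟶ q} (h : f = g) :
    (eqToHom h).1 = eqToHom (congrArg Prod.fst h) := by
  cases h; rfl

theorem prod_eqToHom_snd {p q : X × Y} {f g : p ⟶ q} (h : f = g) :
    (eqToHom h).2 = eqToHom (congrArg Prod.snd h) := by
  cases h; rfl

theorem prod_hom₂_ext {p q : X × Y} {f g : p ⟶ q} {η θ : f ⟶ g} (h₁ : η.1 = θ.1)
    (h₂ : η.2 = θ.2) : η = θ := Prod.ext h₁ h₂

end

/-- The lax Gray tensor product of two 2-categories: only the identities are tight, so that every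
`Σ` with non-identity `f` and `g` is a genuinely new 2-cell. -/
abbrev LaxGray (X : Type u₁) [Bicategory.{w₁, v₁} X] [Strict X]
    (Y : Type u₂) [Bicategory.{w₂, v₂} Y] [Strict Y] := Gray (FStr.min X) (FStr.min Y)

namespace LaxGray
variable (A : Type u₁) [Bicategory.{w₁, v₁} A] [Strict A]
  (B : Type u₂) [Bicategory.{w₂, v₂} B] [Strict B]

/-- The data of the quotient map `X ⊗ Y ⟶ X × Y`. -/
def toProdData : Gray.Bifunctor (FStr.min A) (FStr.min B) (A × B) where
  obj a b := (a, b)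
  mapL f b := (f, 𝟙 b)
  mapR a _ _ g := (𝟙 a, g)
  mapL₂ α b := (α, 𝟙 (𝟙 b))
  mapR₂ a _ _ _ _ β := (𝟙 (𝟙 a), β)
  swap f _ _ g := (eqToHom ((Strict.comp_id f).trans (Strict.id_comp f).symm),
    eqToHom ((Strict.id_comp g).trans (Strict.comp_id g).symm))
  mapL_id _ _ := rfl
  mapL_comp f f' b := Prod.ext rfl (Strict.id_comp (𝟙 b)).symm
  mapR_id _ _ := rfl
  mapR_comp a _ _ _ g g' := Prod.ext (Strict.id_comp (𝟙 a)).symm rfl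
  mapL₂_id _ _ := rfl
  mapL₂_comp _ _ _ := by refine prod_hom₂_ext ?_ ?_ <;> simp
  mapL₂_whiskerLeft f _ _ α b := by
    refine prod_hom₂_ext ?_ ?_ <;> simp [prod_eqToHom_fst, prod_eqToHom_snd]
  mapL₂_whiskerRight α h b := by
    refine prod_hom₂_ext ?_ ?_ <;> simp [prod_eqToHom_fst, prod_eqToHom_snd]
  mapR₂_id _ _ := by intros; rfl
  mapR₂_comp _ _ _ := by intros; refine prod_hom₂_ext ?_ ?_ <;> simp
  mapR₂_whiskerLeft a _ _ _ f _ _ α := by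
    refine prod_hom₂_ext ?_ ?_ <;> simp [prod_eqToHom_fst, prod_eqToHom_snd]
  mapR₂_whiskerRight a _ _ _ f _ _ α := by
    refine prod_hom₂_ext ?_ ?_ <;> simp [prod_eqToHom_fst, prod_eqToHom_snd]
  swap_left α _ _ g := by
    refine prod_hom₂_ext ?_ ?_ <;> simp [prod_eqToHom_fst, prod_eqToHom_snd, Strict.rightUnitor_eqToIso, Strict.leftUnitor_eqToIso]
  swap_right f _ _ _ _ β := by
    refine prod_hom₂_ext ?_ ?_ <;> simp [prod_eqToHom_fst, prod_eqToHom_snd, Strict.rightUnitor_eqToIso, Strict.leftUnitor_eqToIso]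
  swap_comp_left f f' _ _ g := by
    refine prod_hom₂_ext ?_ ?_ <;> simp [prod_eqToHom_fst, prod_eqToHom_snd, Strict.associator_eqToIso]
  swap_comp_right f _ _ _ g g' := by
    refine prod_hom₂_ext ?_ ?_ <;> simp [prod_eqToHom_fst, prod_eqToHom_snd, Strict.associator_eqToIso]
  swap_tight f _ _ g _ := by
    refine ⟨Prod.ext ((Strict.comp_id f).trans (Strict.id_comp f).symm)
      ((Strict.id_comp g).trans (Strict.comp_id g).symm), ?_⟩
    refine prod_hom₂_ext ?_ ?_ <;> simp [prod_eqToHom_fst, prod_eqToHom_snd]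

/-- The quotient map from the lax Gray tensor product to the product, which sends every `Σ` to an
identity. -/
def toProd : StrictPseudofunctor (LaxGray A B) (A × B) := (toProdData A B).lift
end LaxGray

section
variable (X₁ : Type u₁) [Bicategory.{w₁, v₁} X₁] [Strict X₁]
  (X₂ : Type u₂) [Bicategory.{w₂, v₂} X₂] [Strict X₂]
  (Y₁ : Type u₃) [Bicategory.{w₃, v₃} Y₁] [Strict Y₁]
  (Y₂ : Type u₄) [Bicategory.{w₄, v₄} Y₂] [Strict Y₂]

/-- The data of the 2-functor `jFunctor`. -/
def jData : Gray.Bifunctor (FStr.fst X₁ X₂) (FStr.fst Y₁ Y₂) (X₁ × Y₁ × LaxGray X₂ Y₂) where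
  obj p q := (p.1, q.1, ⟨p.2, q.2⟩)
  mapL f q := (f.1, 𝟙 q.1, Gray.inl _ _ f.2 q.2)
  mapR p _ _ g := (𝟙 p.1, g.1, Gray.inr _ _ p.2 g.2)
  mapL₂ α q := (α.1, 𝟙 (𝟙 q.1), Gray.inl₂ _ _ α.2 q.2)
  mapR₂ p _ _ _ _ β := (𝟙 (𝟙 p.1), β.1, Gray.inr₂ _ _ p.2 β.2)
  swap f _ _ g := (eqToHom ((Strict.comp_id f.1).trans (Strict.id_comp f.1).symm),
    eqToHom ((Strict.id_comp g.1).trans (Strict.comp_id g.1).symm), Gray.gray _ _ f.2 g.2)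
  mapL_id p q := Prod.ext rfl (Prod.ext rfl (Gray.inl_id p.2 q.2))
  mapL_comp f f' q := Prod.ext rfl (Prod.ext (Strict.id_comp (𝟙 q.1)).symm
    (Gray.inl_comp f.2 f'.2 q.2))
  mapR_id p q := Prod.ext rfl (Prod.ext rfl (Gray.inr_id p.2 q.2))
  mapR_comp p _ _ _ g g' := Prod.ext (Strict.id_comp (𝟙 p.1)).symm (Prod.ext rfl
    (Gray.inr_comp p.2 g.2 g'.2))
  mapL₂_id f q := Prod.ext rfl (Prod.ext rfl (Gray.inl₂_id _ _ f.2 q.2))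
  mapL₂_comp α α' q := by refine prod_hom₂_ext ?_ (prod_hom₂_ext ?_ ?_) <;> simp [Gray.inl₂_comp]
  mapL₂_whiskerLeft f _ _ α b := by
    refine prod_hom₂_ext ?_ (prod_hom₂_ext ?_ ?_) <;> simp [prod_eqToHom_fst, prod_eqToHom_snd, Gray.inl₂_whiskerLeft]
  mapL₂_whiskerRight α h b := by
    refine prod_hom₂_ext ?_ (prod_hom₂_ext ?_ ?_) <;> simp [prod_eqToHom_fst, prod_eqToHom_snd, Gray.inl₂_whiskerRight]
  mapR₂_id p _ _ g := Prod.ext rfl (Prod.ext rfl (Gray.inr₂_id _ _ p.2 g.2))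
  mapR₂_comp _ _ _ := by intros; refine prod_hom₂_ext ?_ (prod_hom₂_ext ?_ ?_) <;> simp [Gray.inr₂_comp]
  mapR₂_whiskerLeft a _ _ _ f _ _ α := by
    refine prod_hom₂_ext ?_ (prod_hom₂_ext ?_ ?_) <;> simp [prod_eqToHom_fst, prod_eqToHom_snd, Gray.inr₂_whiskerLeft]
  mapR₂_whiskerRight a _ _ _ f _ _ α := by
    refine prod_hom₂_ext ?_ (prod_hom₂_ext ?_ ?_) <;> simp [prod_eqToHom_fst, prod_eqToHom_snd, Gray.inr₂_whiskerRight]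
  swap_left α _ _ g := by
    refine prod_hom₂_ext ?_ (prod_hom₂_ext ?_ ?_) <;> simp [prod_eqToHom_fst, prod_eqToHom_snd, Strict.rightUnitor_eqToIso, Strict.leftUnitor_eqToIso, Gray.gray_left]
  swap_right f _ _ _ _ β := by
    refine prod_hom₂_ext ?_ (prod_hom₂_ext ?_ ?_) <;> simp [prod_eqToHom_fst, prod_eqToHom_snd, Strict.rightUnitor_eqToIso, Strict.leftUnitor_eqToIso, Gray.gray_right]
  swap_comp_left f f' _ _ g := by
    refine prod_hom₂_ext ?_ (prod_hom₂_ext ?_ ?_) <;> simp [prod_eqToHom_fst, prod_eqToHom_snd, Strict.associator_eqToIso, Gray.gray_comp_left]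
  swap_comp_right f _ _ _ g g' := by
    refine prod_hom₂_ext ?_ (prod_hom₂_ext ?_ ?_) <;> simp [prod_eqToHom_fst, prod_eqToHom_snd, Strict.associator_eqToIso, Gray.gray_comp_right]
  swap_tight f _ _ g h := by
    have h' : (FStr.min X₂).Tight f.2 ∨ (FStr.min Y₂).Tight g.2 := by
      rcases h with ⟨⟨_, _⟩⟩ | ⟨⟨_, _⟩⟩
      · exact .inl (.mk _)
      · exact .inr (.mk _)
    refine ⟨Prod.ext ((Strict.comp_id f.1).trans (Strict.id_comp f.1).symm) (Prod.ext
      ((Strict.id_comp g.1).trans (Strict.comp_id g.1).symm) (Gray.inl_inr f.2 g.2 h')), ?_⟩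
    refine prod_hom₂_ext ?_ (prod_hom₂_ext ?_ ?_) <;> simp [prod_eqToHom_fst, prod_eqToHom_snd, Gray.gray_tight _ _ _ _ h']

/-- The comparison `(X₁ × X₂) ⊗ (Y₁ × Y₂) ⟶ X₁ × Y₁ × (X₂ ⊗ Y₂)` that exchanges the two middle
factors. The tight 1-cells are those of the form `(f, 1)`, so that only the Gray cells in `X₂` and
`Y₂` remain on the left. -/
def jFunctor : StrictPseudofunctor (Gray (FStr.fst X₁ X₂) (FStr.fst Y₁ Y₂))
    (X₁ × Y₁ × LaxGray X₂ Y₂) := (jData X₁ X₂ Y₁ Y₂).lift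
end

section FunSL
open scoped Lax.LaxTrans

/-- The 2-category of 2-functors `X ⟶ C`, semi-strict transformations (lax natural transformations
that are strictly natural on tight 1-cells) and modifications. All 1-cells of `C` are tight. This
structure is the type of its objects. -/
structure FunSL {X : Type u₁} [Bicategory.{w₁, v₁} X] (P : FStr X)
    (C : Type u₃) [Bicategory.{w₃, v₃} C] where
  functor : StrictPseudofunctor X C

namespace FunSL
variable {X : Type u₁} [Bicategory.{w₁, v₁} X] {P : FStr X} {C : Type u₃} [Bicategory.{w₃, v₃} C]

/-- The underlying lax functor. -/
abbrev lax (F : FunSL P C) : X ⥤ᴸ C := F.functor.toPseudofunctor.toLax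

/-- A semi-strict transformation. Its lax naturality cells are
`trans.naturality f : trans.app x ≫ G f ⟶ F f ≫ trans.app y`, identities for tight `f`. -/
structure Hom (F G : FunSL P C) where
  trans : F.lax ⟶ G.lax
  strict : ∀ {x y : X} (f : x ⟶ y), P.Tight f →
    ∃ h : trans.app x ≫ G.lax.map f = F.lax.map f ≫ trans.app y, trans.naturality f = eqToHom h

variable [Strict C]

/-- The identity transformation. -/
def Hom.id (F : FunSL P C) : Hom F F where
  trans := 𝟙 F.lax
  strict f _ := ⟨by simp, by
    simp [Strict.leftUnitor_eqToIso, Strict.rightUnitor_eqToIso]; rfl⟩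

/-- The composite of two semi-strict transformations. -/
def Hom.comp {F G H : FunSL P C} (η : Hom F G) (θ : Hom G H) : Hom F H where
  trans := η.trans ≫ θ.trans
  strict f hf := by
    obtain ⟨h₁, e₁⟩ := η.strict f hf
    obtain ⟨h₂, e₂⟩ := θ.strict f hf
    refine ⟨?_, ?_⟩
    · simp only [Lax.LaxTrans.comp_app, Strict.assoc]
      rw [h₂, ← Strict.assoc, h₁, Strict.assoc]
    · simp [e₁, e₂, Strict.associator_eqToIso]; rfl

instance : CategoryStruct (FunSL P C) where
  Hom := Hom
  id := Hom.id
  comp := Hom.comp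

instance homCategory (F G : FunSL P C) : Category (F ⟶ G) where
  Hom η θ := η.trans ⟶ θ.trans
  id η := 𝟙 η.trans
  comp Γ Λ := Lax.LaxTrans.homCategory.comp Γ Λ
  id_comp Γ := Lax.LaxTrans.homCategory.id_comp Γ
  comp_id Γ := Lax.LaxTrans.homCategory.comp_id Γ
  assoc Γ Λ Θ := Lax.LaxTrans.homCategory.assoc Γ Λ Θ

/-- An invertible modification is an isomorphism in the hom category. -/
def isoOf {F G : FunSL P C} {η θ : F ⟶ G} (e : η.trans ≅ θ.trans) : η ≅ θ where
  hom := e.hom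
  inv := e.inv
  hom_inv_id := e.hom_inv_id
  inv_hom_id := e.inv_hom_id

/-- The component at `x` of a modification. -/
def app₂ {F G : FunSL P C} {η θ : F ⟶ G} (Γ : η ⟶ θ) (x : X) : η.trans.app x ⟶ θ.trans.app x :=
  Lax.LaxTrans.Modification.app (Lax.LaxTrans.Hom.as Γ) x

theorem hom₂_ext {F G : FunSL P C} {η θ : F ⟶ G} {Γ Λ : η ⟶ θ} (h : ∀ x, app₂ Γ x = app₂ Λ x) :
    Γ = Λ := Lax.LaxTrans.homCategory.ext h

theorem app₂_eqToHom {F G : FunSL P C} {η θ : F ⟶ G} (h : η = θ) (x : X) :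
    app₂ (eqToHom h) x = eqToHom (by rw [h]) := by
  cases h; rfl

theorem app₂_comp {F G : FunSL P C} {η θ ι : F ⟶ G} (Γ : η ⟶ θ) (Λ : θ ⟶ ι) (x : X) :
    app₂ (Γ ≫ Λ) x = app₂ Γ x ≫ app₂ Λ x := rfl

instance bicategory : Bicategory (FunSL P C) :=
  letI wl {F G H : FunSL P C} (η : F ⟶ G) {θ ι : G ⟶ H} (Γ : θ ⟶ ι) : η ≫ θ ⟶ η ≫ ι :=
    Lax.LaxTrans.whiskerLeft η.trans Γ
  letI wr {F G H : FunSL P C} {η θ : F ⟶ G} (Γ : η ⟶ θ) (ι : G ⟶ H) : η ≫ ι ⟶ θ ≫ ι :=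
    Lax.LaxTrans.whiskerRight Γ ι.trans
  { homCategory := homCategory
    whiskerLeft := wl
    whiskerRight := wr
    associator := fun {F G H K} η θ ι =>
      (isoOf (Lax.LaxTrans.associator η.trans θ.trans ι.trans) : (η ≫ θ) ≫ ι ≅ η ≫ θ ≫ ι)
    leftUnitor := fun {F G} η => (isoOf (Lax.LaxTrans.leftUnitor η.trans) : 𝟙 F ≫ η ≅ η)
    rightUnitor := fun {F G} η => (isoOf (Lax.LaxTrans.rightUnitor η.trans) : η ≫ 𝟙 G ≅ η)
    whiskerLeft_id := fun {F G H} η θ => by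
      apply Lax.LaxTrans.homCategory.ext
      intro x
      exact Bicategory.whiskerLeft_id (η.trans.app x) (θ.trans.app x)
    whiskerLeft_comp := fun η _ _ _ Γ Λ => by
      apply Lax.LaxTrans.homCategory.ext
      intro x
      exact Bicategory.whiskerLeft_comp (η.trans.app x) (app₂ Γ x) (app₂ Λ x)
    id_whiskerLeft := fun Γ => by
      apply Lax.LaxTrans.homCategory.ext
      intro x
      exact Bicategory.id_whiskerLeft (app₂ Γ x)
    comp_whiskerLeft := fun η θ _ _ Γ => by
      apply Lax.LaxTrans.homCategory.ext
      intro x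
      exact Bicategory.comp_whiskerLeft (η.trans.app x) (θ.trans.app x) (app₂ Γ x)
    id_whiskerRight := fun η θ => by
      apply Lax.LaxTrans.homCategory.ext
      intro x
      exact Bicategory.id_whiskerRight (η.trans.app x) (θ.trans.app x)
    comp_whiskerRight := fun Γ Λ η => by
      apply Lax.LaxTrans.homCategory.ext
      intro x
      exact Bicategory.comp_whiskerRight (app₂ Γ x) (app₂ Λ x) (η.trans.app x)
    whiskerRight_id := fun Γ => by
      apply Lax.LaxTrans.homCategory.ext
      intro x
      exact Bicategory.whiskerRight_id (app₂ Γ x)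
    whiskerRight_comp := fun Γ θ ι => by
      apply Lax.LaxTrans.homCategory.ext
      intro x
      exact Bicategory.whiskerRight_comp (app₂ Γ x) (θ.trans.app x) (ι.trans.app x)
    whisker_assoc := fun η _ _ Γ ι => by
      apply Lax.LaxTrans.homCategory.ext
      intro x
      exact Bicategory.whisker_assoc (η.trans.app x) (app₂ Γ x) (ι.trans.app x)
    whisker_exchange := fun Γ Λ => by
      apply Lax.LaxTrans.homCategory.ext
      intro x
      exact Bicategory.whisker_exchange (app₂ Γ x) (app₂ Λ x)
    pentagon := fun η θ ι κ => by
      apply Lax.LaxTrans.homCategory.ext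
      intro x
      exact Bicategory.pentagon (η.trans.app x) (θ.trans.app x) (ι.trans.app x) (κ.trans.app x)
    triangle := fun η θ => by
      apply Lax.LaxTrans.homCategory.ext
      intro x
      exact Bicategory.triangle (η.trans.app x) (θ.trans.app x) }

theorem hom_ext {F G : FunSL P C} {η θ : F ⟶ G} (h : ∀ x, η.trans.app x = θ.trans.app x)
    (h' : ∀ {x y : X} (f : x ⟶ y), η.trans.naturality f =
      eqToHom (by rw [h]) ≫ θ.trans.naturality f ≫ eqToHom (by rw [h])) : η = θ := by
  rcases η with ⟨⟨a, n, _, _, _⟩, _⟩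
  rcases θ with ⟨⟨a', n', _, _, _⟩, _⟩
  obtain rfl : a = a' := funext h
  have : @n = @n' := by
    funext x y f
    simpa using h' f
  subst this
  rfl

end FunSL
end FunSL

section strictlemmas
variable {X : Type u₁} [Bicategory.{w₁, v₁} X] {C : Type u₃} [Bicategory.{w₃, v₃} C]
  (T : StrictPseudofunctor X C)

theorem map₂_wL {x y z : X} (f : x ⟶ y) {g h : y ⟶ z} (η : g ⟶ h) :
    T.map₂ (f ◁ η) = eqToHom (T.map_comp f g) ≫ T.map f ◁ T.map₂ η ≫
      eqToHom (T.map_comp f h).symm := by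
  simp [T.map₂_whisker_left, T.mapComp_eq_eqToIso]

theorem map₂_wR {x y z : X} {f g : x ⟶ y} (η : f ⟶ g) (h : y ⟶ z) :
    T.map₂ (η ▷ h) = eqToHom (T.map_comp f h) ≫ T.map₂ η ▷ T.map h ≫
      eqToHom (T.map_comp g h).symm := by
  simp [T.map₂_whisker_right, T.mapComp_eq_eqToIso]

theorem wL_map₂ {x y z : X} (f : x ⟶ y) {g h : y ⟶ z} (η : g ⟶ h) :
    T.map f ◁ T.map₂ η = eqToHom (T.map_comp f g).symm ≫ T.map₂ (f ◁ η) ≫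
      eqToHom (T.map_comp f h) := by
  rw [map₂_wL]; simp

theorem wR_map₂ {x y z : X} {f g : x ⟶ y} (η : f ⟶ g) (h : y ⟶ z) :
    T.map₂ η ▷ T.map h = eqToHom (T.map_comp f h).symm ≫ T.map₂ (η ▷ h) ≫
      eqToHom (T.map_comp g h) := by
  rw [map₂_wR]; simp
theorem map₂_eqToHom' {x y : X} {f g : x ⟶ y} (h : f = g) :
    T.map₂ (eqToHom h) = eqToHom (congrArg T.map h) := by
  cases h; simp
end strictlemmas

namespace Gray
variable {X : Type u₁} [Bicategory.{w₁, v₁} X] [Strict X]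
  {Y : Type u₂} [Bicategory.{w₂, v₂} Y] [Strict Y] {P : FStr X} {Q : FStr Y}
  {C : Type u₃} [Bicategory.{w₃, v₃} C] [Strict C]

variable (P Q) in
/-- The 2-functor `y ↦ (x, y)`. -/
def inc (x : X) : StrictPseudofunctor Y (Gray P Q) := StrictPseudofunctor.mk''
  { obj y := ⟨x, y⟩
    map g := inr P Q x g
    map₂ β := inr₂ P Q x β
    map₂_id g := inr₂_id P Q x g
    map₂_comp β β' := inr₂_comp P Q x β β'
    map_id y := inr_id x y
    map_comp g g' := inr_comp x g g'
    map₂_whisker_left g _ _ β := inr₂_whiskerLeft P Q x g β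
    map₂_whisker_right β h := inr₂_whiskerRight P Q x β h }

variable (T : StrictPseudofunctor (Gray P Q) C)

/-- The image of a Gray cell under a 2-functor. -/
def mapGray {x x' : X} (f : x ⟶ x') {y y' : Y} (g : y ⟶ y') :
    T.map (inl P Q f y) ≫ T.map (inr P Q x' g) ⟶ T.map (inr P Q x g) ≫ T.map (inl P Q f y') :=
  eqToHom (T.map_comp _ _).symm ≫ T.map₂ (gray P Q f g) ≫ eqToHom (T.map_comp _ _)

theorem mapGray_right {x x' : X} (f : x ⟶ x') {y y' : Y} {g g' : y ⟶ y'} (β : g ⟶ g') :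
    mapGray T f g ≫ T.map₂ (inr₂ P Q x β) ▷ T.map (inl P Q f y') =
      T.map (inl P Q f y) ◁ T.map₂ (inr₂ P Q x' β) ≫ mapGray T f g' := by
  have := congrArg T.map₂ (gray_right P Q f β)
  simp only [T.map₂_comp] at this
  simp only [mapGray, wL_map₂, wR_map₂]
  simp only [Category.assoc, eqToHom_trans, eqToHom_trans_assoc, eqToHom_refl, Category.id_comp,
    reassoc_of% this]

theorem mapGray_left {x x' : X} {f f' : x ⟶ x'} (α : f ⟶ f') {y y' : Y} (g : y ⟶ y') :
    T.map₂ (inl₂ P Q α y) ▷ T.map (inr P Q x' g) ≫ mapGray T f' g =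
      mapGray T f g ≫ T.map (inr P Q x g) ◁ T.map₂ (inl₂ P Q α y') := by
  have := congrArg T.map₂ (gray_left P Q α g)
  simp only [T.map₂_comp] at this
  simp only [mapGray, wL_map₂, wR_map₂]
  simp only [Category.assoc, eqToHom_trans, eqToHom_trans_assoc, eqToHom_refl, Category.id_comp,
    reassoc_of% this]

theorem mapGray_tight {x x' : X} (f : x ⟶ x') {y y' : Y} (g : y ⟶ y')
    (h : P.Tight f ∨ Q.Tight g) : mapGray T f g = eqToHom ((T.map_comp _ _).symm.trans
      ((congrArg T.map (inl_inr f g h)).trans (T.map_comp _ _))) := by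
  simp [mapGray, gray_tight P Q f g h, map₂_eqToHom']

theorem mapGray_comp_right {x x' : X} (f : x ⟶ x') {y y' y'' : Y} (g : y ⟶ y') (g' : y' ⟶ y'') :
    mapGray T f (g ≫ g') =
      eqToHom (by rw [inr_comp, T.map_comp, Strict.assoc]) ≫
        mapGray T f g ▷ T.map (inr P Q x' g') ≫ eqToHom (Strict.assoc _ _ _) ≫
          T.map (inr P Q x g) ◁ mapGray T f g' ≫
            eqToHom (by rw [inr_comp, T.map_comp, Strict.assoc]) := by
  simp only [mapGray, gray_comp_right, T.map₂_comp, map₂_eqToHom', map₂_wL, map₂_wR]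
  simp

theorem mapGray_comp_left {x x' x'' : X} (f : x ⟶ x') (f' : x' ⟶ x'') {y y' : Y} (g : y ⟶ y') :
    mapGray T (f ≫ f') g =
      eqToHom (by rw [inl_comp, T.map_comp, Strict.assoc]) ≫
        T.map (inl P Q f y) ◁ mapGray T f' g ≫ eqToHom (Strict.assoc _ _ _).symm ≫
          mapGray T f g ▷ T.map (inl P Q f' y') ≫
            eqToHom (by rw [inl_comp, T.map_comp, Strict.assoc]) := by
  simp only [mapGray, gray_comp_left, T.map₂_comp, map₂_eqToHom', map₂_wL, map₂_wR]
  simp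

/-- The 2-functor `y ↦ T (x, y)`. -/
def curryObj (x : X) : FunSL Q C := ⟨(inc P Q x).comp T⟩

theorem curryObj_mapId (x : X) (y : Y) : (curryObj T x).functor.mapId y =
    eqToIso ((curryObj T x).functor.map_id y) := (curryObj T x).functor.mapId_eq_eqToIso y

theorem aux_id {a b : C} (f : a ⟶ b) {g : b ⟶ b} (hg : g = 𝟙 b) {k : a ⟶ a}
    (hk : k = 𝟙 a) {σ : f ≫ g ⟶ k ≫ f} (h : f ≫ g = k ≫ f) (hσ : σ = eqToHom h) :
    f ◁ (eqToIso hg).inv ≫ σ = (ρ_ f).hom ≫ (λ_ f).inv ≫ (eqToIso hk).inv ▷ f := by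
  subst hg hk hσ
  simp [Strict.rightUnitor_eqToIso, Strict.leftUnitor_eqToIso]

theorem aux_comp {a b c a' b' c' : C} {p : a ⟶ a'} {q : b ⟶ b'} {r : c ⟶ c'} {f : a ⟶ b}
    {g : b ⟶ c} {h : a ⟶ c} (e : h = f ≫ g) {f' : a' ⟶ b'} {g' : b' ⟶ c'} {h' : a' ⟶ c'}
    (e' : h' = f' ≫ g') (σ : p ≫ f' ⟶ f ≫ q) (τ : q ≫ g' ⟶ g ≫ r) {u v w}
    {κ : p ≫ h' ⟶ h ≫ r}
    (hκ : κ = eqToHom u ≫ σ ▷ g' ≫ eqToHom v ≫ f ◁ τ ≫ eqToHom w) :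
    p ◁ (eqToIso e').inv ≫ κ = (α_ _ _ _).inv ≫ σ ▷ g' ≫ (α_ _ _ _).hom ≫ f ◁ τ ≫ (α_ _ _ _).inv ≫
      (eqToIso e).inv ▷ r := by
  subst e e' hκ
  simp [Strict.associator_eqToIso]

/-- The semi-strict transformation `T (x, -) ⟶ T (x', -)` with components `T (f, 1)` and lax
naturality cells `T Σ`. -/
def curryMap {x x' : X} (f : x ⟶ x') : curryObj T x ⟶ curryObj T x' where
  trans :=
    { app y := T.map (inl P Q f y)
      naturality {y y'} g := mapGray T f g
      naturality_naturality {y y' g g'} β := mapGray_right T f β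
      naturality_id y := by
        simp only [FunSL.lax, Pseudofunctor.toLax_mapId, curryObj_mapId]
        exact aux_id _ _ _ _ (mapGray_tight T f (𝟙 y) (.inr (Q.tight_id y)))
      naturality_comp {y y' y''} g g' := by
        simp only [FunSL.lax, Pseudofunctor.toLax_mapComp, StrictPseudofunctor.mapComp_eq_eqToIso]
        exact aux_comp _ _ _ _ (mapGray_comp_right T f g g') }
  strict {y y'} g hg := ⟨_, mapGray_tight T f g (.inr hg)⟩

end Gray

namespace FunSL
section
variable {C : Type u₃} [Bicategory.{w₃, v₃} C] [Strict C]

theorem aux_id_comp {a b c d : C} {f : a ⟶ b} {g : b ⟶ d} {k : a ⟶ c} {h : c ⟶ d}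
    (σ : f ≫ g ⟶ k ≫ h) :
    (α_ (𝟙 a) f g).hom ≫ 𝟙 a ◁ σ ≫ (α_ (𝟙 a) k h).inv ≫ ((λ_ k).hom ≫ (ρ_ k).inv) ▷ h ≫
      (α_ k (𝟙 c) h).hom = eqToHom (by simp) ≫ σ ≫ eqToHom (by simp) := by
  simp [Strict.associator_eqToIso, Strict.leftUnitor_eqToIso, Strict.rightUnitor_eqToIso]

theorem aux_comp_id {a b c d : C} {f : a ⟶ b} {g : b ⟶ d} {k : a ⟶ c} {h : c ⟶ d}
    (σ : f ≫ g ⟶ k ≫ h) :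
    (α_ f (𝟙 b) g).hom ≫ f ◁ ((λ_ g).hom ≫ (ρ_ g).inv) ≫ (α_ f g (𝟙 d)).inv ≫ σ ▷ 𝟙 d ≫
      (α_ k h (𝟙 d)).hom = eqToHom (by simp) ≫ σ ≫ eqToHom (by simp) := by
  simp [Strict.associator_eqToIso, Strict.leftUnitor_eqToIso, Strict.rightUnitor_eqToIso]

theorem aux_assoc {a b c d a' b' c' d' : C} {p : a ⟶ b} {q : b ⟶ c} {r : c ⟶ d} {p' : a' ⟶ b'}
    {q' : b' ⟶ c'} {r' : c' ⟶ d'} {f : a ⟶ a'} {g : b ⟶ b'} {h : c ⟶ c'} {k : d ⟶ d'}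
    (σ : p ≫ g ⟶ f ≫ p') (τ : q ≫ h ⟶ g ≫ q') (υ : r ≫ k ⟶ h ≫ r') :
    (α_ (p ≫ q) r k).hom ≫ (p ≫ q) ◁ υ ≫ (α_ (p ≫ q) h r').inv ≫
      ((α_ p q h).hom ≫ p ◁ τ ≫ (α_ p g q').inv ≫ σ ▷ q' ≫ (α_ f p' q').hom) ▷ r' ≫
        (α_ f (p' ≫ q') r').hom =
    eqToHom (by simp) ≫ ((α_ p (q ≫ r) k).hom ≫
      p ◁ ((α_ q r k).hom ≫ q ◁ υ ≫ (α_ q h r').inv ≫ τ ▷ r' ≫ (α_ g q' r').hom) ≫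
        (α_ p g (q' ≫ r')).inv ≫ σ ▷ (q' ≫ r') ≫ (α_ f p' (q' ≫ r')).hom) ≫ eqToHom (by simp) := by
  simp [Strict.associator_eqToIso]

variable {X : Type u₁} [Bicategory.{w₁, v₁} X] {P : FStr X}

theorem app_eqToHom {F G : FunSL P C} {η θ : F ⟶ G} (h : η = θ) (x : X) :
    app₂ (eqToHom h) x = eqToHom (congrArg (fun η : F ⟶ G => η.trans.app x) h) :=
  app₂_eqToHom h x

theorem id_comp' {F G : FunSL P C} (η : F ⟶ G) : 𝟙 F ≫ η = η :=
  hom_ext (fun x => Strict.id_comp (η.trans.app x)) fun f => aux_id_comp (η.trans.naturality f)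

theorem comp_id' {F G : FunSL P C} (η : F ⟶ G) : η ≫ 𝟙 G = η :=
  hom_ext (fun x => Strict.comp_id (η.trans.app x)) fun f => aux_comp_id (η.trans.naturality f)

theorem assoc' {F G H K : FunSL P C} (η : F ⟶ G) (θ : G ⟶ H) (ι : H ⟶ K) :
    (η ≫ θ) ≫ ι = η ≫ θ ≫ ι :=
  hom_ext (fun x => Strict.assoc (η.trans.app x) (θ.trans.app x) (ι.trans.app x))
    fun f => aux_assoc (η.trans.naturality f) (θ.trans.naturality f) (ι.trans.naturality f)

instance strict : Strict (FunSL P C) where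
  id_comp := id_comp'
  comp_id := comp_id'
  assoc := assoc'
  leftUnitor_eqToIso η := by
    ext
    refine hom₂_ext fun x => ?_
    exact (congrArg Iso.hom (Strict.leftUnitor_eqToIso (η.trans.app x))).trans
      (app_eqToHom (id_comp' η) x).symm
  rightUnitor_eqToIso η := by
    ext
    refine hom₂_ext fun x => ?_
    exact (congrArg Iso.hom (Strict.rightUnitor_eqToIso (η.trans.app x))).trans
      (app_eqToHom (comp_id' η) x).symm
  associator_eqToIso η θ ι := by
    ext
    refine hom₂_ext fun x => ?_
    exact (congrArg Iso.hom (Strict.associator_eqToIso (η.trans.app x) (θ.trans.app x)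
      (ι.trans.app x))).trans (app_eqToHom (assoc' η θ ι) x).symm
end
end FunSL

namespace Gray
section
variable {X : Type u₁} [Bicategory.{w₁, v₁} X] [Strict X]
  {Y : Type u₂} [Bicategory.{w₂, v₂} Y] [Strict Y] {P : FStr X} {Q : FStr Y}
  {C : Type u₃} [Bicategory.{w₃, v₃} C] [Strict C] (T : StrictPseudofunctor (Gray P Q) C)

/-- The modification with components `T (α, 1)`. -/
def curryMap₂ {x x' : X} {f f' : x ⟶ x'} (α : f ⟶ f') : curryMap T f ⟶ curryMap T f' :=
  ⟨{ app := fun y => T.map₂ (inl₂ P Q α y)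
     naturality := fun g => mapGray_left T α g }⟩

theorem aux_curry_id {a b : C} {g : a ⟶ b} (l : a ⟶ a) (r : b ⟶ b)
   (hl : l = 𝟙 a) (hr : r = 𝟙 b) {σ : l ≫ g ⟶ g ≫ r} (h) (hσ : σ = eqToHom h) :
    σ = eqToHom (by rw [hl]) ≫ ((λ_ g).hom ≫ (ρ_ g).inv) ≫ eqToHom (by rw [hr]) := by
  subst hl hr hσ
  simp [Strict.leftUnitor_eqToIso, Strict.rightUnitor_eqToIso]

theorem aux_curry_comp {a b c a' b' c' : C} {f : a ⟶ b} {f' : b ⟶ c} {p : a ⟶ a'} {q : b ⟶ b'}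
    {r : c ⟶ c'} {g : a' ⟶ b'} {g' : b' ⟶ c'} (σ : f ≫ q ⟶ p ≫ g) (τ : f' ≫ r ⟶ q ≫ g')
    {k : a ⟶ c} (hk : k = f ≫ f') {k' : a' ⟶ c'} (hk' : k' = g ≫ g') {κ : k ≫ r ⟶ p ≫ k'} {u v w}
    (hκ : κ = eqToHom u ≫ f ◁ τ ≫ eqToHom v ≫ σ ▷ g' ≫ eqToHom w) :
    κ = eqToHom (by rw [hk]) ≫
      ((α_ f f' r).hom ≫ f ◁ τ ≫ (α_ f q g').inv ≫ σ ▷ g' ≫ (α_ p g g').hom) ≫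
        eqToHom (by rw [hk']) := by
  subst hk hk' hκ
  simp [Strict.associator_eqToIso]

/-- The transpose `X ⟶ FunSL Q C` of a 2-functor `T : X ⊗ Y ⟶ C`. -/
def curry : StrictPseudofunctor X (FunSL Q C) := StrictPseudofunctor.mk''
  { obj x := curryObj T x
    map f := curryMap T f
    map₂ α := curryMap₂ T α
    map₂_id f := FunSL.hom₂_ext fun y =>
      (congrArg T.map₂ (inl₂_id P Q f y)).trans (T.map₂_id _)
    map₂_comp α α' := FunSL.hom₂_ext fun y =>
      (congrArg T.map₂ (inl₂_comp P Q α α' y)).trans (T.map₂_comp _ _)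
    map_id x := FunSL.hom_ext (fun y => (congrArg T.map (inl_id x y)).trans (T.map_id _)) fun g =>
      aux_curry_id _ _ ((congrArg T.map (inl_id x _)).trans (T.map_id _))
        ((congrArg T.map (inl_id x _)).trans (T.map_id _)) _
        (mapGray_tight T (𝟙 x) g (.inl (P.tight_id x)))
    map_comp f f' := FunSL.hom_ext
      (fun y => (congrArg T.map (inl_comp f f' y)).trans (T.map_comp _ _)) fun g =>
      aux_curry_comp _ _ ((congrArg T.map (inl_comp f f' _)).trans (T.map_comp _ _))
        ((congrArg T.map (inl_comp f f' _)).trans (T.map_comp _ _)) (mapGray_comp_left T f f' g)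
    map₂_whisker_left f _ _ α := by
      refine FunSL.hom₂_ext fun y => ?_
      simp only [FunSL.app₂_comp, FunSL.app₂_eqToHom]
      refine (congrArg T.map₂ (inl₂_whiskerLeft P Q f α y)).trans ?_
      simp only [T.map₂_comp, map₂_eqToHom', map₂_wL]
      simp
      rfl
    map₂_whisker_right α f := by
      refine FunSL.hom₂_ext fun y => ?_
      simp only [FunSL.app₂_comp, FunSL.app₂_eqToHom]
      refine (congrArg T.map₂ (inl₂_whiskerRight P Q α f y)).trans ?_
      simp only [T.map₂_comp, map₂_eqToHom', map₂_wR]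
      simp
      rfl }
end
end Gray

section act
variable {X : Type u₁} [Bicategory.{w₁, v₁} X] (T : StrictPseudofunctor X Cat.{v₃, u₃})

/-- The functor `T u : T p ⥤ T q` for a 1-cell `u : p ⟶ q`. -/
abbrev act {p q : X} (u : p ⟶ q) : T.obj p ⥤ T.obj q := (T.map u).toFunctor

/-- The component at `x` of the natural transformation `T α`. -/
abbrev act₂ {p q : X} {u v : p ⟶ q} (α : u ⟶ v) (x : T.obj p) : (act T u).obj x ⟶ (act T v).obj x :=
  (T.map₂ α).toNatTrans.app x

variable {T}

theorem act_congr {p q : X} {u v : p ⟶ q} (h : u = v) (x : T.obj p) :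
    (act T u).obj x = (act T v).obj x := by rw [h]

theorem act_id_obj {p : X} (x : T.obj p) : (act T (𝟙 p)).obj x = x :=
  congrArg (fun F : T.obj p ⟶ T.obj p => F.toFunctor.obj x) (T.map_id p)

theorem act_comp_obj {p q r : X} (u : p ⟶ q) (v : q ⟶ r) (x : T.obj p) :
    (act T (u ≫ v)).obj x = (act T v).obj ((act T u).obj x) :=
  congrArg (fun F : T.obj p ⟶ T.obj r => F.toFunctor.obj x) (T.map_comp u v)

theorem act_comp_map {p q r : X} (u : p ⟶ q) (v : q ⟶ r) {x y : T.obj p} (m : x ⟶ y) :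
    (act T (u ≫ v)).map m = eqToHom (act_comp_obj u v x) ≫ (act T v).map ((act T u).map m) ≫
      eqToHom (act_comp_obj u v y).symm :=
  Functor.congr_hom (congrArg Cat.Hom.toFunctor (T.map_comp u v)) m

end act

section
variable {A : Type u₁} [Bicategory.{w₁, v₁} A] [Strict A]
  (T : StrictPseudofunctor (Aᵒᵖ × A) Cat.{v₃, u₃})

/-- The 1-cell `(1, f)` of `Aᵒᵖ × A`. -/
def push (x : Aᵒᵖ) {a b : A} (f : a ⟶ b) : ((x, a) : Aᵒᵖ × A) ⟶ (x, b) := (𝟙 x, f)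
/-- The 1-cell `(f, 1)` of `Aᵒᵖ × A`. -/
def pull {a b : A} (f : a ⟶ b) (y : A) : ((op b, y) : Aᵒᵖ × A) ⟶ (op a, y) := (f.op, 𝟙 y)

/-- The 2-cell `(1, α)` of `Aᵒᵖ × A`. -/
def push₂ (x : Aᵒᵖ) {a b : A} {f g : a ⟶ b} (α : f ⟶ g) : push x f ⟶ push x g := (𝟙 (𝟙 x), α)
/-- The 2-cell `(α, 1)` of `Aᵒᵖ × A`. -/
def pull₂ {a b : A} {f g : a ⟶ b} (α : f ⟶ g) (y : A) : pull f y ⟶ pull g y := (op2 α, 𝟙 (𝟙 y))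

theorem push_id (x : Aᵒᵖ) (a : A) : push x (𝟙 a) = 𝟙 (x, a) := rfl
theorem pull_id (a y : A) : pull (𝟙 a) y = 𝟙 (op a, y) := rfl
theorem push_comp (x : Aᵒᵖ) {a b c : A} (f : a ⟶ b) (g : b ⟶ c) :
    push x (f ≫ g) = push x f ≫ push x g := Prod.ext (Strict.id_comp (𝟙 x)).symm rfl
theorem pull_comp {a b c : A} (f : a ⟶ b) (g : b ⟶ c) (y : A) :
    pull (f ≫ g) y = pull g y ≫ pull f y := Prod.ext rfl (Strict.id_comp (𝟙 y)).symm
theorem pull_push {a b c d : A} (f : a ⟶ b) (g : c ⟶ d) :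
    pull f c ≫ push (op a) g = push (op b) g ≫ pull f d :=
  Prod.ext ((Strict.comp_id f.op).trans (Strict.id_comp f.op).symm)
    ((Strict.id_comp g).trans (Strict.comp_id g).symm)

theorem push_pull_id {T : StrictPseudofunctor (Aᵒᵖ × A) Cat.{v₃, u₃}} (a : A) (x : T.obj (op a, a)) :
    (act T (push (op a) (𝟙 a))).obj x = (act T (pull (𝟙 a) a)).obj x := rfl

/-- The lax end of a 2-functor `T : Aᵒᵖ × A ⟶ Cat`, constructed explicitly. An object is a lax wedge
from the terminal category: objects `pt a` of `T (a, a)` and morphisms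
`cell f : T (1, f) (pt a) ⟶ T (f, 1) (pt b)` for `f : a ⟶ b`, with `cell 1 = 1`, natural in 2-cells
`f ⟶ g`, and such that `cell (f ≫ g)` is `T (1, g) (cell f)` followed by `T (f, 1) (cell g)`. The
universal property is proved in `LaxWedge.equivFunctor` and `LaxWedge.homEquiv`. -/
structure LaxEnd where
  pt (a : A) : T.obj (op a, a)
  cell {a b : A} (f : a ⟶ b) : (act T (push (op a) f)).obj (pt a) ⟶ (act T (pull f b)).obj (pt b)
  cell_id (a : A) : cell (𝟙 a) = eqToHom (push_pull_id a (pt a))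
  cell_naturality {a b : A} {f g : a ⟶ b} (α : f ⟶ g) :
    cell f ≫ act₂ T (pull₂ α b) (pt b) = act₂ T (push₂ (op a) α) (pt a) ≫ cell g
  cell_comp {a b c : A} (f : a ⟶ b) (g : b ⟶ c) : cell (f ≫ g) =
    eqToHom ((act_congr (push_comp (op a) f g) (pt a)).trans (act_comp_obj _ _ _)) ≫
      (act T (push (op a) g)).map (cell f) ≫
        eqToHom ((act_comp_obj _ _ _).symm.trans
          ((act_congr (pull_push f g) (pt b)).trans (act_comp_obj _ _ _))) ≫
          (act T (pull f c)).map (cell g) ≫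
            eqToHom ((act_congr (pull_comp f g c) (pt c)).trans (act_comp_obj _ _ _)).symm

namespace LaxEnd
variable {T}

/-- A morphism of the lax end: a modification of wedges. -/
@[ext]
structure Hom (x y : LaxEnd T) where
  app (a : A) : x.pt a ⟶ y.pt a
  comm {a b : A} (f : a ⟶ b) : (act T (push (op a) f)).map (app a) ≫ y.cell f =
    x.cell f ≫ (act T (pull f b)).map (app b)

instance : Category (LaxEnd T) where
  Hom := Hom
  id x := { app a := 𝟙 _, comm f := by simp }
  comp s t :=
    { app a := s.app a ≫ t.app a
      comm f := by
        simp only [Functor.map_comp, Category.assoc]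
        rw [t.comm, ← Category.assoc, s.comm, Category.assoc] }
  id_comp s := Hom.ext (funext fun a => Category.id_comp _)
  comp_id s := Hom.ext (funext fun a => Category.comp_id _)
  assoc s t u := Hom.ext (funext fun a => Category.assoc _ _ _)

theorem obj_ext {x y : LaxEnd T} (h : ∀ a, x.pt a = y.pt a)
    (h' : ∀ {a b : A} (f : a ⟶ b), x.cell f = eqToHom (by rw [h]) ≫ y.cell f ≫
      eqToHom (by rw [h])) : x = y := by
  rcases x with ⟨p, c, _, _, _⟩
  rcases y with ⟨p', c', _, _, _⟩
  obtain rfl : p = p' := funext h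
  have : @c = @c' := by
    funext x y f
    simpa using h' f
  subst this
  rfl

theorem hom_ext {x y : LaxEnd T} {s t : x ⟶ y} (h : ∀ a, s.app a = t.app a) : s = t :=
  Hom.ext (funext h)

theorem eqToHom_app {x y : LaxEnd T} (h : x = y) (a : A) :
    (eqToHom h : x ⟶ y).app a = eqToHom (by rw [h]) := by
  cases h; rfl

theorem comp_app {x y z : LaxEnd T} (s : x ⟶ y) (t : y ⟶ z) (a : A) :
    (s ≫ t).app a = s.app a ≫ t.app a := rfl

theorem conj_app {x y z w : LaxEnd T} (h : x = y) (s : y ⟶ z) (h' : z = w) (a : A) :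
    Hom.app (eqToHom h ≫ s ≫ eqToHom h') a =
      eqToHom (by rw [h]) ≫ Hom.app s a ≫ eqToHom (by rw [h']) := by
  rw [comp_app, comp_app, eqToHom_app, eqToHom_app]

variable (T) in
/-- The projection of the lax end to `T (a, a)`. -/
def proj (a : A) : LaxEnd T ⥤ T.obj (op a, a) where
  obj x := x.pt a
  map s := s.app a
end LaxEnd

end

namespace FunSL
section
variable {X : Type u₁} [Bicategory.{w₁, v₁} X] {P : FStr X} {F G : FunSL P Cat.{v₃, u₃}} (η : F ⟶ G)

/-- The component at `p` of a semi-strict transformation of `Cat`-valued 2-functors. -/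
abbrev at' (p : X) : F.functor.obj p ⥤ G.functor.obj p :=
  Cat.Hom.toFunctor (C := F.functor.obj p) (D := G.functor.obj p) (η.trans.app p)

/-- The lax naturality cell of `η` at `u`, evaluated at the object `x`. -/
def nat {p q : X} (u : p ⟶ q) (x : F.functor.obj p) :
    (act G.functor u).obj ((at' η p).obj x) ⟶ (at' η q).obj ((act F.functor u).obj x) :=
  (η.trans.naturality u).toNatTrans.app x

theorem nat_map {p q : X} (u : p ⟶ q) {x y : F.functor.obj p} (m : x ⟶ y) :
    (act G.functor u).map ((at' η p).map m) ≫ nat η u y =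
      nat η u x ≫ (at' η q).map ((act F.functor u).map m) :=
  (η.trans.naturality u).toNatTrans.naturality m

theorem nat_map₂ {p q : X} {u v : p ⟶ q} (α : u ⟶ v) (x : F.functor.obj p) :
    act₂ G.functor α ((at' η p).obj x) ≫ nat η v x =
      nat η u x ≫ (at' η q).map (act₂ F.functor α x) :=
  (congrArg (fun (t : (η.trans.app p ≫ G.lax.map u ⟶ F.lax.map v ≫ η.trans.app q)) =>
    t.toNatTrans.app x) (η.trans.naturality_naturality α)).symm

theorem strict_obj {p q : X} {u : p ⟶ q} (h : P.Tight u) (x : F.functor.obj p) :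
    (act G.functor u).obj ((at' η p).obj x) = (at' η q).obj ((act F.functor u).obj x) := by
  obtain ⟨h, _⟩ := η.strict u h
  exact congrArg (fun t : F.functor.obj p ⟶ G.functor.obj q => t.toFunctor.obj x) h

theorem nat_tight {p q : X} {u : p ⟶ q} (h : P.Tight u) (x : F.functor.obj p) :
    nat η u x = eqToHom (strict_obj η h x) := by
  obtain ⟨h, e⟩ := η.strict u h
  unfold nat
  rw [e]
  exact Cat.eqToHom_app _ _ h x

theorem nat_congr {p q : X} {u v : p ⟶ q} (h : u = v) (x : F.functor.obj p) :
    nat η u x = eqToHom (by rw [h]) ≫ nat η v x ≫ eqToHom (by rw [h]) := by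
  cases h; simp

theorem aux_nat_comp {a b c a' b' c' : Cat.{v₃, u₃}} {p : a ⟶ a'} {q : b ⟶ b'} {r : c ⟶ c'}
    {f : a ⟶ b} {g : b ⟶ c} {h : a ⟶ c} (e : h = f ≫ g) {f' : a' ⟶ b'} {g' : b' ⟶ c'}
    {h' : a' ⟶ c'} (e' : h' = f' ≫ g') (σ : p ≫ f' ⟶ f ≫ q) (τ : q ≫ g' ⟶ g ≫ r)
    {κ : p ≫ h' ⟶ h ≫ r}
    (hκ : p ◁ (eqToIso e').inv ≫ κ = (α_ _ _ _).inv ≫ σ ▷ g' ≫ (α_ _ _ _).hom ≫ f ◁ τ ≫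
      (α_ _ _ _).inv ≫ (eqToIso e).inv ▷ r) (x : a) :
    κ.toNatTrans.app x =
      eqToHom (congrArg (fun F : a' ⟶ c' => F.toFunctor.obj (p.toFunctor.obj x)) e') ≫
        g'.toFunctor.map (σ.toNatTrans.app x) ≫ τ.toNatTrans.app (f.toFunctor.obj x) ≫
          eqToHom (congrArg (fun F : a ⟶ c => r.toFunctor.obj (F.toFunctor.obj x)) e).symm := by
  subst e e'
  have := congrArg (fun t => t.toNatTrans.app x) hκ
  simpa using this

theorem nat_comp {p q r : X} (u : p ⟶ q) (v : q ⟶ r) (x : F.functor.obj p) :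
    nat η (u ≫ v) x = eqToHom (act_comp_obj u v _) ≫ (act G.functor v).map (nat η u x) ≫
      nat η v ((act F.functor u).obj x) ≫
        eqToHom (congrArg (at' η r).obj (act_comp_obj u v x).symm) := by
  have := η.trans.naturality_comp u v
  simp only [FunSL.lax, Pseudofunctor.toLax_mapComp, StrictPseudofunctor.mapComp_eq_eqToIso] at this
  exact aux_nat_comp _ _ _ _ this x
end
end FunSL

namespace FunSL
section
variable {X : Type u₁} [Bicategory.{w₁, v₁} X] {P : FStr X} {F G : FunSL P Cat.{v₃, u₃}}
    {η θ : F ⟶ G} (Γ : η ⟶ θ)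

/-- The component at `p` of a modification, evaluated at the object `x`. -/
def modApp (p : X) (x : F.functor.obj p) : (at' η p).obj x ⟶ (at' θ p).obj x :=
  (app₂ Γ p).toNatTrans.app x

theorem modApp_naturality (p : X) {x y : F.functor.obj p} (m : x ⟶ y) :
    (at' η p).map m ≫ modApp Γ p y = modApp Γ p x ≫ (at' θ p).map m :=
  (app₂ Γ p).toNatTrans.naturality m

theorem modApp_nat {p q : X} (u : p ⟶ q) (x : F.functor.obj p) :
    (act G.functor u).map (modApp Γ p x) ≫ nat θ u x =
      nat η u x ≫ modApp Γ q ((act F.functor u).obj x) :=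
  congrArg (fun (t : (η.trans.app p ≫ G.lax.map u ⟶ F.lax.map u ≫ θ.trans.app q)) =>
    t.toNatTrans.app x) ((Lax.LaxTrans.Hom.as Γ).naturality u)

theorem nat_id (F : FunSL P Cat.{v₃, u₃}) {p q : X} (u : p ⟶ q) (x : F.functor.obj p) :
    nat (𝟙 F) u x = 𝟙 ((act F.functor u).obj x) := by
  have : nat (𝟙 F) u x = 𝟙 ((act F.functor u).obj x) ≫ 𝟙 ((act F.functor u).obj x) := rfl
  rw [this, Category.comp_id]

theorem nat_comp_trans {F G H : FunSL P Cat.{v₃, u₃}} (η : F ⟶ G) (θ : G ⟶ H) {p q : X}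
    (u : p ⟶ q) (x : F.functor.obj p) :
    nat (η ≫ θ) u x = nat θ u ((at' η p).obj x) ≫ (at' θ q).map (nat η u x) := by
  have : nat (η ≫ θ) u x = 𝟙 _ ≫ nat θ u ((at' η p).obj x) ≫ 𝟙 _ ≫ (at' θ q).map (nat η u x) ≫
    𝟙 _ := rfl
  rw [this]
  simp only [Category.id_comp, Category.comp_id]
  rfl
end
end FunSL

namespace LaxEnd
section
variable {A : Type u₁} [Bicategory.{w₁, v₁} A] [Strict A]

theorem tight_pull {a b : A} (f : a ⟶ b) (y : A) : (FStr.fst Aᵒᵖ A).Tight (pull f y) :=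
  .mk f.op y

variable {F G : FunSL (FStr.fst Aᵒᵖ A) Cat.{v₃, u₃}} (η : F ⟶ G)

open FunSL

/-- The wedge induced by a wedge `x` for `F` and a semi-strict `η : F ⟶ G`: its points are
`η (pt a)`, and its cell at `f` is the lax naturality cell of `η` at `(1, f)`, followed by
`η (cell f)` and by the identity `η (T (f, 1) (pt b)) = T (f, 1) (η (pt b))`, which holds because
`(f, 1)` is tight. -/
def mapObj (x : LaxEnd F.functor) : LaxEnd G.functor where
  pt a := (at' η (op a, a)).obj (x.pt a)
  cell {a b} f := nat η (push (op a) f) (x.pt a) ≫ (at' η (op a, b)).map (x.cell f) ≫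
    eqToHom (strict_obj η (tight_pull f b) (x.pt b)).symm
  cell_id a := by
    rw [x.cell_id, eqToHom_map, eqToHom_trans,
      nat_tight η (u := push (op a) (𝟙 a)) (tight_pull (𝟙 a) a), eqToHom_trans]
  cell_naturality {a b f g} α := by
    have h1 := nat_map₂ η (push₂ (op a) α) (x.pt a)
    have h2 := nat_map₂ η (pull₂ α b) (x.pt b)
    have h3 := congrArg (at' η (op a, b)).map (x.cell_naturality α)
    rw [nat_tight η (tight_pull f b), nat_tight η (tight_pull g b)] at h2
    rw [comp_eqToHom_iff] at h2
    simp only [Functor.map_comp] at h3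
    simp only [h2, Category.assoc, eqToHom_trans_assoc, eqToHom_refl, Category.id_comp,
      reassoc_of% h3, reassoc_of% h1]
  cell_comp {a b c} f g := by
    have h1 := nat_congr η (push_comp (op a) f g) (x.pt a)
    rw [nat_comp] at h1
    have h2 := nat_map η (push (op a) g) (x.cell f)
    have h3 := nat_congr η (pull_push f g) (x.pt b)
    rw [nat_comp, nat_comp, nat_tight η (tight_pull f b), nat_tight η (tight_pull f c)] at h3
    have h4 := nat_map η (pull f c) (x.cell g)
    rw [nat_tight η (tight_pull f c), nat_tight η (tight_pull f c)] at h4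
    simp only [eqToHom_map, eqToHom_trans, Category.assoc, eqToHom_trans_assoc,
      eqToHom_comp_iff, comp_eqToHom_iff] at h3 h4
    rw [h1]
    simp only [x.cell_comp, Functor.map_comp, eqToHom_map, Category.assoc,
      eqToHom_trans_assoc, eqToHom_trans, eqToHom_refl, Category.id_comp, ← reassoc_of% h2]
    simp only [h3, h4, Category.assoc, eqToHom_trans_assoc, eqToHom_trans]

/-- The functor between lax ends induced by a semi-strict transformation. -/
def map : LaxEnd F.functor ⥤ LaxEnd G.functor where
  obj := mapObj η
  map {x y} s :=
    { app a := (at' η (op a, a)).map (s.app a)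
      comm {a b} f := by
        have h1 := nat_map η (push (op a) f) (s.app a)
        have h2 := nat_map η (pull f b) (s.app b)
        have h3 := congrArg (at' η (op a, b)).map (s.comm f)
        rw [nat_tight η (tight_pull f b), nat_tight η (tight_pull f b), comp_eqToHom_iff] at h2
        simp only [Functor.map_comp] at h3
        simp only [mapObj, h2, Category.assoc, eqToHom_trans_assoc, eqToHom_refl, Category.id_comp,
          reassoc_of% h1, reassoc_of% h3] }
  map_id x := LaxEnd.hom_ext fun a => (at' η (op a, a)).map_id _
  map_comp s t := LaxEnd.hom_ext fun a => (at' η (op a, a)).map_comp _ _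

variable {η} in
/-- The natural transformation between lax ends induced by a modification. -/
def map₂ {θ : F ⟶ G} (Γ : η ⟶ θ) : map η ⟶ map θ where
  app x :=
    { app a := modApp Γ (op a, a) (x.pt a)
      comm {a b} f := by
        have h1 := modApp_nat Γ (push (op a) f) (x.pt a)
        have h2 := modApp_nat Γ (pull f b) (x.pt b)
        have h3 := modApp_naturality Γ (op a, b) (x.cell f)
        rw [nat_tight η (tight_pull f b), nat_tight θ (tight_pull f b), comp_eqToHom_iff] at h2
        simp only [map, mapObj, h2, Category.assoc, eqToHom_trans_assoc, eqToHom_refl,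
          Category.id_comp, reassoc_of% h1, reassoc_of% h3] }
  naturality x y s := LaxEnd.hom_ext fun a => modApp_naturality Γ (op a, a) (s.app a)

end

section
variable (A : Type u₁) [Bicategory.{w₁, v₁} A] [Strict A]
open FunSL

theorem mapObj_id {F : FunSL (FStr.fst Aᵒᵖ A) Cat.{v₃, u₃}} (x : LaxEnd F.functor) :
    mapObj (𝟙 F) x = x := by
  refine obj_ext (fun a => rfl) fun f => ?_
  have h : (mapObj (𝟙 F) x).cell f = 𝟙 _ ≫ x.cell f ≫ 𝟙 _ := by
    change nat (𝟙 F) _ _ ≫ x.cell f ≫ 𝟙 _ = _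
    rw [nat_id]; rfl
  rw [h]; rfl

theorem map_id' (F : FunSL (FStr.fst Aᵒᵖ A) Cat.{v₃, u₃}) : map (𝟙 F) = 𝟭 (LaxEnd F.functor) := by
  refine CategoryTheory.Functor.ext (fun x => mapObj_id A x) ?_
  intro x y s
  refine hom_ext fun a => ?_
  refine Eq.trans ?_ (conj_app _ _ _ a).symm
  exact ((Category.id_comp (s.app a ≫ 𝟙 _)).trans (Category.comp_id (s.app a))).symm

theorem aux_mapObj_comp {C : Type u₁} [Category.{v₁} C] {D : Type u₂} [Category.{v₂} D] (K : C ⥤ D)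
    {X V : D} {Y Z W W' : C} (α : X ⟶ K.obj Y) (β : Y ⟶ Z) (γ : Z ⟶ W) (h : W = W')
    (h' : K.obj W = V) (h'' : K.obj W' = V) :
    (α ≫ K.map β) ≫ K.map γ ≫ eqToHom h' = α ≫ K.map (β ≫ γ ≫ eqToHom h) ≫ eqToHom h'' := by
  subst h
  simp

theorem mapObj_comp {F G H : FunSL (FStr.fst Aᵒᵖ A) Cat.{v₃, u₃}} (η : F ⟶ G) (θ : G ⟶ H)
    (x : LaxEnd F.functor) : mapObj (η ≫ θ) x = mapObj θ (mapObj η x) := by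
  refine obj_ext (fun a => rfl) fun {a b} f => ?_
  have h : (mapObj (η ≫ θ) x).cell f = (mapObj θ (mapObj η x)).cell f := by
    change nat (η ≫ θ) (push (op a) f) (x.pt a) ≫ _ = _
    rw [nat_comp_trans]
    exact aux_mapObj_comp (at' θ (op a, b)) _ _ _ _ _ _
  rw [h]
  exact ((Category.id_comp _).trans (Category.comp_id _)).symm

theorem map_comp' {F G H : FunSL (FStr.fst Aᵒᵖ A) Cat.{v₃, u₃}} (η : F ⟶ G) (θ : G ⟶ H) :
    map (η ≫ θ) = (map η ⋙ map θ : LaxEnd F.functor ⥤ LaxEnd H.functor) := by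
  refine CategoryTheory.Functor.ext (fun x => mapObj_comp A η θ x) ?_
  intro x y s
  refine hom_ext fun a => ?_
  refine Eq.trans ?_ (conj_app _ _ _ a).symm
  exact ((Category.id_comp (((map η ⋙ map θ).map s).app a ≫ 𝟙 _)).trans (Category.comp_id (((map η ⋙ map θ).map s).app a))).symm

theorem aux_eqToHom {C : Cat.{max u₁ v₃, max u₁ v₁ u₃ v₃}}
    {T : StrictPseudofunctor (Aᵒᵖ × A) Cat.{v₃, u₃}} {F G : C ⟶ Cat.of (LaxEnd T)} (h : F = G)
    (x : C) (a : A) : Hom.app ((eqToHom h).toNatTrans.app x) a =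
      eqToHom (congrArg (fun F : C ⟶ Cat.of (LaxEnd T) => LaxEnd.pt (F.toFunctor.obj x) a) h) := by
  cases h; rfl

theorem aux_conj {C : Cat.{max u₁ v₃, max u₁ v₁ u₃ v₃}}
    {T : StrictPseudofunctor (Aᵒᵖ × A) Cat.{v₃, u₃}} {F G H K : C ⟶ Cat.of (LaxEnd T)}
    (h : F = G) (α : G ⟶ H) (h' : H = K) (x : C) (a : A) :
    Hom.app ((eqToHom h ≫ α ≫ eqToHom h').toNatTrans.app x) a =
      eqToHom (congrArg (fun F : C ⟶ Cat.of (LaxEnd T) => LaxEnd.pt (F.toFunctor.obj x) a) h) ≫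
        Hom.app (α.toNatTrans.app x) a ≫
      eqToHom (congrArg (fun F : C ⟶ Cat.of (LaxEnd T) => LaxEnd.pt (F.toFunctor.obj x) a) h') := by
  cases h; cases h'; simp

/-- The 2-functor that sends `T : Aᵒᵖ × A ⟶ Cat` to its lax end, on the 2-category of 2-functors
and semi-strict transformations for the `F`-category structure on `Aᵒᵖ × A` with tight 1-cells
`(f, 1)`. -/
def laxEnd : StrictPseudofunctor (FunSL (FStr.fst Aᵒᵖ A) Cat.{v₃, u₃})
    Cat.{max u₁ v₃, max u₁ v₁ u₃ v₃} := StrictPseudofunctor.mk''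
  { obj F := Cat.of (LaxEnd F.functor)
    map η := (map η).toCatHom
    map₂ Γ := NatTrans.toCatHom₂ (map₂ Γ)
    map₂_id η := rfl
    map₂_comp Γ Λ := rfl
    map_id F := congrArg Functor.toCatHom (map_id' A F)
    map_comp η θ := congrArg Functor.toCatHom (map_comp' A η θ)
    map₂_whisker_left η _ _ Γ := by
      ext x
      refine hom_ext fun a => ?_
      refine Eq.trans ?_ (aux_conj A _ _ _ x a).symm
      exact ((Category.id_comp _).trans (Category.comp_id _)).symm
    map₂_whisker_right Γ η := by
      ext x
      refine hom_ext fun a => ?_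
      refine Eq.trans ?_ (aux_conj A _ _ _ x a).symm
      exact ((Category.id_comp _).trans (Category.comp_id _)).symm }
end
end LaxEnd

section
variable {A : Type u₁} [Bicategory.{w₁, v₁} A] [Strict A]
  (T : StrictPseudofunctor (Aᵒᵖ × A) Cat.{v₃, u₃}) (C : Type u₄) [Category.{v₄} C]

/-- A lax wedge from a category `C` to a 2-functor `T : Aᵒᵖ × A ⟶ Cat`. -/
structure LaxWedge where
  leg (a : A) : C ⥤ T.obj (op a, a)
  cell {a b : A} (f : a ⟶ b) : leg a ⋙ act T (push (op a) f) ⟶ leg b ⋙ act T (pull f b)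
  cell_id (a : A) (x : C) : (cell (𝟙 a)).app x = eqToHom (push_pull_id a ((leg a).obj x))
  cell_naturality {a b : A} {f g : a ⟶ b} (α : f ⟶ g) (x : C) :
    (cell f).app x ≫ act₂ T (pull₂ α b) ((leg b).obj x) =
      act₂ T (push₂ (op a) α) ((leg a).obj x) ≫ (cell g).app x
  cell_comp {a b c : A} (f : a ⟶ b) (g : b ⟶ c) (x : C) : (cell (f ≫ g)).app x =
    eqToHom ((act_congr (push_comp (op a) f g) ((leg a).obj x)).trans (act_comp_obj _ _ _)) ≫
      (act T (push (op a) g)).map ((cell f).app x) ≫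
        eqToHom ((act_comp_obj _ _ _).symm.trans
          ((act_congr (pull_push f g) ((leg b).obj x)).trans (act_comp_obj _ _ _))) ≫
          (act T (pull f c)).map ((cell g).app x) ≫
            eqToHom ((act_congr (pull_comp f g c) ((leg c).obj x)).trans (act_comp_obj _ _ _)).symm

namespace LaxWedge
variable {T C}

/-- A modification of lax wedges. -/
@[ext]
structure Hom (W V : LaxWedge T C) where
  app (a : A) : W.leg a ⟶ V.leg a
  comm {a b : A} (f : a ⟶ b) : Functor.whiskerRight (app a) (act T (push (op a) f)) ≫ V.cell f =
    W.cell f ≫ Functor.whiskerRight (app b) (act T (pull f b))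

/-- The universal property of the lax end, on 1-cells. -/
def equivFunctor : LaxWedge T C ≃ (C ⥤ LaxEnd T) where
  toFun W :=
    { obj x :=
        { pt a := (W.leg a).obj x
          cell f := (W.cell f).app x
          cell_id a := W.cell_id a x
          cell_naturality α := W.cell_naturality α x
          cell_comp f g := W.cell_comp f g x }
      map m :=
        { app a := (W.leg a).map m
          comm f := (W.cell f).naturality m }
      map_id x := LaxEnd.hom_ext fun a => (W.leg a).map_id x
      map_comp m n := LaxEnd.hom_ext fun a => (W.leg a).map_comp m n }
  invFun F :=
    { leg a := F ⋙ LaxEnd.proj T a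
      cell f :=
        { app x := (F.obj x).cell f
          naturality x y m := (F.map m).comm f }
      cell_id a x := (F.obj x).cell_id a
      cell_naturality α x := (F.obj x).cell_naturality α
      cell_comp f g x := (F.obj x).cell_comp f g }
  left_inv W := rfl
  right_inv F := rfl

/-- The universal property of the lax end, on 2-cells. -/
def homEquiv (W V : LaxWedge T C) : Hom W V ≃ (equivFunctor W ⟶ equivFunctor V) where
  toFun s :=
    { app x :=
        { app a := (s.app a).app x
          comm f := congrArg (fun t => t.app x) (s.comm f) }
      naturality x y m := LaxEnd.hom_ext fun a => (s.app a).naturality m }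
  invFun t :=
    { app a :=
        { app x := (t.app x).app a
          naturality x y m := congrArg (fun s => LaxEnd.Hom.app s a) (t.naturality m) }
      comm f := by
        ext x
        exact (t.app x).comm f }
  left_inv s := rfl
  right_inv t := rfl
end LaxWedge
end

section
variable {A : Type u₁} [Bicategory.{w₁, v₁} A] [Strict A] {B : Type u₂} [Bicategory.{w₂, v₂} B] [Strict B]

theorem unop2_conj {X : Type u₁} [Bicategory.{w₁, v₁} X] {a b : Xᵒᵖ} {f g h k : a ⟶ b} (e : f = g)
    (α : g ⟶ h) (e' : h = k) : (eqToHom e ≫ α ≫ eqToHom e').unop2 =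
      eqToHom (congrArg Quiver.Hom.unop e) ≫ α.unop2 ≫ eqToHom (congrArg Quiver.Hom.unop e') := by
  cases e; cases e'; simp

theorem fst_conj {X : Type u₁} [Bicategory.{w₁, v₁} X] {Y : Type u₂} [Bicategory.{w₂, v₂} Y]
    {a b : X × Y} {f g h k : a ⟶ b} (e : f = g) (α : g ⟶ h) (e' : h = k) :
    (eqToHom e ≫ α ≫ eqToHom e').1 =
      eqToHom (congrArg Prod.fst e) ≫ α.1 ≫ eqToHom (congrArg Prod.fst e') := by
  cases e; cases e'; simp

theorem snd_conj {X : Type u₁} [Bicategory.{w₁, v₁} X] {Y : Type u₂} [Bicategory.{w₂, v₂} Y]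
    {a b : X × Y} {f g h k : a ⟶ b} (e : f = g) (α : g ⟶ h) (e' : h = k) :
    (eqToHom e ≫ α ≫ eqToHom e').2 =
      eqToHom (congrArg Prod.snd e) ≫ α.2 ≫ eqToHom (congrArg Prod.snd e') := by
  cases e; cases e'; simp

variable (A B) in
/-- The 2-functor `(A ⊗ B)ᵒᵖ × (A ⊗ B) ⟶ Aᵒᵖ × Bᵒᵖ × (A ⊗ B)` induced by the quotient map
`A ⊗ B ⟶ A × B` in the contravariant variable. -/
def quotMap : StrictPseudofunctor ((LaxGray A B)ᵒᵖ × LaxGray A B) (Aᵒᵖ × Bᵒᵖ × LaxGray A B) :=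
  StrictPseudofunctor.mk''
  { obj p := (op p.1.unop.fst, op p.1.unop.snd, p.2)
    map s := (((LaxGray.toProd A B).map s.1.unop).1.op, ((LaxGray.toProd A B).map s.1.unop).2.op, s.2)
    map₂ η := (op2 ((LaxGray.toProd A B).map₂ η.1.unop2).1,
      op2 ((LaxGray.toProd A B).map₂ η.1.unop2).2, η.2)
    map₂_id s := by
      have h := (LaxGray.toProd A B).map₂_id s.1.unop
      exact prod_hom₂_ext (op_hom2_ext (congrArg (fun t => Prod.fst t) h))
        (prod_hom₂_ext (op_hom2_ext (congrArg (fun t => Prod.snd t) h)) rfl)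
    map₂_comp η θ := by
      have h := (LaxGray.toProd A B).map₂_comp η.1.unop2 θ.1.unop2
      exact prod_hom₂_ext (op_hom2_ext (congrArg (fun t => Prod.fst t) h))
        (prod_hom₂_ext (op_hom2_ext (congrArg (fun t => Prod.snd t) h)) rfl)
    map_id p := by
      have h := (LaxGray.toProd A B).map_id p.1.unop
      exact Prod.ext (congrArg (fun t => (Prod.fst t).op) h)
        (Prod.ext (congrArg (fun t => (Prod.snd t).op) h) rfl)
    map_comp s t := by
      have h := (LaxGray.toProd A B).map_comp t.1.unop s.1.unop
      exact Prod.ext (congrArg (fun t => (Prod.fst t).op) h)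
        (Prod.ext (congrArg (fun t => (Prod.snd t).op) h) rfl)
    map₂_whisker_left s _ _ η := by
      have h := map₂_wR (LaxGray.toProd A B) η.1.unop2 s.1.unop
      refine prod_hom₂_ext (op_hom2_ext ((congrArg (fun t => Prod.fst t) h).trans ?_))
        (prod_hom₂_ext (op_hom2_ext ((congrArg (fun t => Prod.snd t) h).trans ?_)) ?_)
      · rw [fst_conj, fst_conj]
        symm
        refine (unop2_conj _ _ _).trans ?_
        rfl
      · rw [snd_conj, snd_conj, fst_conj]
        symm
        refine (unop2_conj _ _ _).trans ?_
        rfl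
      · rw [snd_conj, snd_conj]
        simp
    map₂_whisker_right η s := by
      have h := map₂_wL (LaxGray.toProd A B) s.1.unop η.1.unop2
      refine prod_hom₂_ext (op_hom2_ext ((congrArg (fun t => Prod.fst t) h).trans ?_))
        (prod_hom₂_ext (op_hom2_ext ((congrArg (fun t => Prod.snd t) h).trans ?_)) ?_)
      · rw [fst_conj, fst_conj]
        symm
        refine (unop2_conj _ _ _).trans ?_
        rfl
      · rw [snd_conj, snd_conj, fst_conj]
        symm
        refine (unop2_conj _ _ _).trans ?_
        rfl
      · rw [snd_conj, snd_conj]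
        simp }

/-- The 2-functor whose lax end is the two-variable lax end of `T`. -/
def twoVar (T : StrictPseudofunctor (Aᵒᵖ × Bᵒᵖ × LaxGray A B) Cat.{v₃, u₃}) :
    StrictPseudofunctor ((LaxGray A B)ᵒᵖ × LaxGray A B) Cat.{v₃, u₃} := (quotMap A B).comp T

/-- The transpose `Aᵒᵖ × A ⟶ FunSL (Bᵒᵖ × B) Cat`, `(a, a') ↦ T (a, -, a', -)`, of `T ∘ j`. -/
def transpose (T : StrictPseudofunctor (Aᵒᵖ × Bᵒᵖ × LaxGray A B) Cat.{v₃, u₃}) :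
    StrictPseudofunctor (Aᵒᵖ × A) (FunSL (FStr.fst Bᵒᵖ B) Cat.{v₃, u₃}) :=
  Gray.curry ((jFunctor Aᵒᵖ A Bᵒᵖ B).comp T)

/-- The 2-functor `(a, a') ↦ ∫_b T (a, b, a', b)`: the composite of the transpose of
`T ∘ j` with the 2-functor `laxEnd B`. -/
def innerEnd (T : StrictPseudofunctor (Aᵒᵖ × Bᵒᵖ × LaxGray A B) Cat.{v₃, u₃}) :
    StrictPseudofunctor (Aᵒᵖ × A) Cat.{max u₂ v₃, max u₂ v₂ u₃ v₃} :=
  (transpose T).comp (LaxEnd.laxEnd B)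

end

end LaxFubini

open LaxFubini

/-! A lax wedge on `A ⊗ B` is determined by its points and by its cells at the generating 1-cells
`(f, 1)` and `(1, g)`, because the cell at a composite is forced. Conversely, cells at the
generators extend to a wedge as soon as they are functorial in each variable and natural for the
generating 2-cells `(α, 1)`, `(1, β)` and `Σ`, since naturality passes to vertical composites and
whiskerings. So a two-variable wedge amounts to points `s_{a,b}`, cells `s_{f,b}` and `s_{a,g}`, the
wedge axioms in each variable, and one mixed condition for each pair `(f, g)`: naturality at
`Σ_{f,g}`.

An object of the iterated lax end has the same content. Its wedges `s_a` over `B` supply the points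
and the `s_{a,g}`, the components of its cells `s_f` are the `s_{f,b}`, and the axioms over `A` are
equations between morphisms of lax ends over `B`, which hold componentwise. What remains is that
`s_f` is a morphism of wedges, a square for each `g`. The source of `s_f` is an image under `T (a,
-, f, -)`, whose lax naturality cell at `(1, g)` is `T Σ`. Its target is an image under `T (f, -,
a', -)`, whose lax naturality cells are identities because `(f, 1)` is tight. In the two-variable
lax end, `Σ` acts by `T Σ` covariantly and trivially contravariantly, because the quotient map sends
it to an identity. So the square is exactly the mixed condition. Morphisms on either side are
families `t_{a,b}` subject to the same squares at the generators.

Extension from generators is `Gray.Wedge.toLaxEnd`, its uniqueness `Gray.laxEnd_cell_heq`, the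
reduction for morphisms `Gray.laxEnd_comm`, and the mixed condition `Fubini.swap_iff`. The remaining
work is transport: the contravariant action of a 1-cell involves `(1, 1)` as a generator on one side
and as an identity on the other, and these are equal only by a relation of the tensor product. Hence
corresponding cells differ by an `eqToHom` on their targets. -/

namespace LaxFubini

/-! ### Evaluation of `Cat`-valued 2-functors on 1-cells and 2-cells. -/

section
variable {X : Type u₁} [Bicategory.{w₁, v₁} X] {S : StrictPseudofunctor X Cat.{v₃, u₃}}

theorem act_congr_map {p q : X} {u v : p ⟶ q} (h : u = v) {x y : S.obj p} (m : x ⟶ y) :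
    (act S u).map m = eqToHom (act_congr h x) ≫ (act S v).map m ≫
      eqToHom (act_congr h y).symm := by
  cases h; simp

theorem act_id_map {p : X} {x y : S.obj p} (m : x ⟶ y) :
    (act S (𝟙 p)).map m = eqToHom (act_id_obj x) ≫ m ≫ eqToHom (act_id_obj y).symm :=
  Functor.congr_hom (congrArg Cat.Hom.toFunctor (S.map_id p)) m

theorem act₂_id {p q : X} (u : p ⟶ q) (x : S.obj p) : act₂ S (𝟙 u) x = 𝟙 _ :=
  congrArg (fun t : S.map u ⟶ S.map u => t.toNatTrans.app x) (S.map₂_id u)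

theorem act₂_eqToHom {p q : X} {u v : p ⟶ q} (h : u = v) (x : S.obj p) :
    act₂ S (eqToHom h) x = eqToHom (act_congr h x) := by
  cases h; exact act₂_id u x

theorem act₂_comp {p q : X} {u v w : p ⟶ q} (α : u ⟶ v) (β : v ⟶ w) (x : S.obj p) :
    act₂ S (α ≫ β) x = act₂ S α x ≫ act₂ S β x :=
  congrArg (fun t : S.map u ⟶ S.map w => t.toNatTrans.app x) (S.map₂_comp α β)

theorem act₂_naturality {p q : X} {u v : p ⟶ q} (α : u ⟶ v) {x y : S.obj p} (m : x ⟶ y) :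
    (act S u).map m ≫ act₂ S α y = act₂ S α x ≫ (act S v).map m :=
  (S.map₂ α).toNatTrans.naturality m

theorem cat_conj_app {C D : Cat.{v₃, u₃}} {F G H K : C ⟶ D} (e : F = G) (α : G ⟶ H) (e' : H = K)
    (x : C) : (eqToHom e ≫ α ≫ eqToHom e').toNatTrans.app x =
      eqToHom (congrArg (fun F : C ⟶ D => F.toFunctor.obj x) e) ≫ α.toNatTrans.app x ≫
        eqToHom (congrArg (fun F : C ⟶ D => F.toFunctor.obj x) e') := by
  cases e; cases e'; simp

theorem act₂_whiskerLeft {p q r : X} (u : p ⟶ q) {v w : q ⟶ r} (α : v ⟶ w) (x : S.obj p) :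
    act₂ S (u ◁ α) x = eqToHom (act_comp_obj u v x) ≫ act₂ S α ((act S u).obj x) ≫
      eqToHom (act_comp_obj u w x).symm :=
  (congrArg (fun t : S.map (u ≫ v) ⟶ S.map (u ≫ w) => t.toNatTrans.app x) (map₂_wL S u α)).trans
    (cat_conj_app _ _ _ x)

theorem act₂_whiskerRight {p q r : X} {u v : p ⟶ q} (α : u ⟶ v) (w : q ⟶ r) (x : S.obj p) :
    act₂ S (α ▷ w) x = eqToHom (act_comp_obj u w x) ≫ (act S w).map (act₂ S α x) ≫
      eqToHom (act_comp_obj v w x).symm :=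
  (congrArg (fun t : S.map (u ≫ w) ⟶ S.map (v ≫ w) => t.toNatTrans.app x) (map₂_wR S α w)).trans
    (cat_conj_app _ _ _ x)

/-- In a strict 2-category, equations between 2-cells hold up to identity 2-cells, written
`eqToHom`. This carries such equations through an action. -/
theorem act₂_conj {p q : X} {u u' v v' : p ⟶ q} (e : u = u') (α : u' ⟶ v') (e' : v' = v)
    (x : S.obj p) : act₂ S (eqToHom e ≫ α ≫ eqToHom e') x =
      eqToHom (act_congr e x) ≫ act₂ S α x ≫ eqToHom (act_congr e' x) := by
  cases e; cases e'; simp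
end

/-! ### Whiskering and interchange of the 2-cells `(1, α)` and `(α, 1)`. -/

section
variable {K : Type u₁} [Bicategory.{w₁, v₁} K] [Strict K]

theorem conj_conj {C : Type u₁} [Category.{v₁} C] {a b c d e f : C} (h₁ : a = b) (h₂ : b = c)
    (m : c ⟶ d) (h₃ : d = e) (h₄ : e = f) :
    eqToHom (h₁.trans h₂) ≫ m ≫ eqToHom (h₃.trans h₄) =
      eqToHom h₁ ≫ (eqToHom h₂ ≫ m ≫ eqToHom h₃) ≫ eqToHom h₄ := by
  cases h₁; cases h₂; cases h₃; cases h₄; simp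

theorem conj_self {C : Type u₁} [Category.{v₁} C] {a b : C} (m : a ⟶ b) :
    m = eqToHom rfl ≫ m ≫ eqToHom rfl := by simp

theorem id_conj {C : Type u₁} [Category.{v₁} C] {a b : C} (h : a = b) :
    𝟙 a = eqToHom h ≫ 𝟙 b ≫ eqToHom h.symm := by simp

theorem leftUnitor_conj {a b : K} {u v : a ⟶ b} (α : u ⟶ v) :
    𝟙 a ◁ α = eqToHom (Strict.id_comp u) ≫ α ≫ eqToHom (Strict.id_comp v).symm := by
  simp [Strict.leftUnitor_eqToIso]

theorem rightUnitor_conj {a b : K} {u v : a ⟶ b} (α : u ⟶ v) :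
    α ▷ 𝟙 b = eqToHom (Strict.comp_id u) ≫ α ≫ eqToHom (Strict.comp_id v).symm := by
  simp [Strict.rightUnitor_eqToIso]

/-- The projections of a product send `eqToHom` to `eqToHom`. For `push₂` and `pull₂` this leaves
one coordinate that contains the 2-cell and one in which everything is an identity. -/
theorem prod_conj_ext {X : Type u₁} [Bicategory.{w₁, v₁} X] {Y : Type u₂} [Bicategory.{w₂, v₂} Y]
    {p q : X × Y} {f g h k : p ⟶ q} {η : f ⟶ k} {e : f = g} {α : g ⟶ h} {e' : h = k}
    (h₁ : η.1 = eqToHom (congrArg Prod.fst e) ≫ α.1 ≫ eqToHom (congrArg Prod.fst e'))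
    (h₂ : η.2 = eqToHom (congrArg Prod.snd e) ≫ α.2 ≫ eqToHom (congrArg Prod.snd e')) :
    η = eqToHom e ≫ α ≫ eqToHom e' :=
  prod_hom₂_ext (h₁.trans (fst_conj e α e').symm) (h₂.trans (snd_conj e α e').symm)

theorem push₂_whiskerLeft (x : Kᵒᵖ) {p q r : K} (u : p ⟶ q) {v w : q ⟶ r} (α : v ⟶ w) :
    push₂ x (u ◁ α) = eqToHom (push_comp x u v) ≫ push x u ◁ push₂ x α ≫
      eqToHom (push_comp x u w).symm :=
  prod_conj_ext ((id_conj _).trans (by rw [← Bicategory.whiskerLeft_id]; rfl)) (conj_self (u ◁ α))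

theorem push₂_whiskerRight (x : Kᵒᵖ) {p q r : K} {u v : p ⟶ q} (α : u ⟶ v) (w : q ⟶ r) :
    push₂ x (α ▷ w) = eqToHom (push_comp x u w) ≫ push₂ x α ▷ push x w ≫
      eqToHom (push_comp x v w).symm :=
  prod_conj_ext ((id_conj _).trans (by rw [← Bicategory.id_whiskerRight]; rfl)) (conj_self (α ▷ w))

/-- Passing to the opposite reverses 1-cells but not 2-cells, so left whiskering becomes right
whiskering. -/
theorem pull₂_whiskerLeft {p q r : K} (u : p ⟶ q) {v w : q ⟶ r} (α : v ⟶ w) (y : K) :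
    pull₂ (u ◁ α) y = eqToHom (pull_comp u v y) ≫ pull₂ α y ▷ pull u y ≫
      eqToHom (pull_comp u w y).symm :=
  prod_conj_ext (conj_self (op2 α ▷ u.op))
    ((id_conj _).trans (by rw [← Bicategory.id_whiskerRight]; rfl))

theorem pull₂_whiskerRight {p q r : K} {u v : p ⟶ q} (α : u ⟶ v) (w : q ⟶ r) (y : K) :
    pull₂ (α ▷ w) y = eqToHom (pull_comp u w y) ≫ pull w y ◁ pull₂ α y ≫
      eqToHom (pull_comp v w y).symm :=
  prod_conj_ext (conj_self (w.op ◁ op2 α))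
    ((id_conj _).trans (by rw [← Bicategory.whiskerLeft_id]; rfl))

/-- The two variables of `Kᵒᵖ × K` act independently. Each side is `α` whiskered by an identity
1-cell in the covariant coordinate, on the left or on the right, and strict unitors identify the
two. -/
theorem pull_push₂ {p q r s : K} (u : p ⟶ q) {v w : r ⟶ s} (α : v ⟶ w) :
    pull u r ◁ push₂ (op p) α = eqToHom (pull_push u v) ≫ push₂ (op q) α ▷ pull u s ≫
      eqToHom (pull_push u w).symm :=
  prod_conj_ext
    ((Bicategory.whiskerLeft_id _ _).trans ((id_conj _).trans
      (by rw [← Bicategory.id_whiskerRight]; rfl)))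
    ((leftUnitor_conj α).trans ((conj_conj _ _ α _ _).trans
      (congrArg (fun t => _ ≫ t ≫ _) (rightUnitor_conj α).symm)))

theorem pull₂_push {p q r s : K} {u v : p ⟶ q} (α : u ⟶ v) (w : r ⟶ s) :
    pull₂ α r ▷ push (op p) w = eqToHom (pull_push u w) ≫ push (op q) w ◁ pull₂ α s ≫
      eqToHom (pull_push v w).symm :=
  prod_conj_ext
    ((rightUnitor_conj (op2 α)).trans ((conj_conj _ _ (op2 α) _ _).trans
      (congrArg (fun t => _ ≫ t ≫ _) (leftUnitor_conj (op2 α)).symm)))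
    ((Bicategory.id_whiskerRight _ _).trans ((id_conj _).trans
      (by rw [← Bicategory.whiskerLeft_id]; rfl)))
end

/-! ### Covariant and contravariant actions on the values of a 2-functor on `Kᵒᵖ × K`. -/

section
variable {K : Type u₁} [Bicategory.{w₁, v₁} K] [Strict K]
  {S : StrictPseudofunctor (Kᵒᵖ × K) Cat.{v₃, u₃}}

theorem push_comp_obj (x : Kᵒᵖ) {p q r : K} (u : p ⟶ q) (v : q ⟶ r) (m : S.obj (x, p)) :
    (act S (push x (u ≫ v))).obj m = (act S (push x v)).obj ((act S (push x u)).obj m) :=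
  (act_congr (push_comp x u v) m).trans (act_comp_obj _ _ _)

theorem pull_comp_obj {p q r : K} (u : p ⟶ q) (v : q ⟶ r) (y : K) (m : S.obj (op r, y)) :
    (act S (pull (u ≫ v) y)).obj m = (act S (pull u y)).obj ((act S (pull v y)).obj m) :=
  (act_congr (pull_comp u v y) m).trans (act_comp_obj _ _ _)

theorem pull_push_obj {p q r s : K} (u : p ⟶ q) (v : r ⟶ s) (m : S.obj (op q, r)) :
    (act S (push (op p) v)).obj ((act S (pull u r)).obj m) =
      (act S (pull u s)).obj ((act S (push (op q) v)).obj m) :=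
  (act_comp_obj _ _ _).symm.trans ((act_congr (pull_push u v) m).trans (act_comp_obj _ _ _))

theorem push_comp_map (x : Kᵒᵖ) {p q r : K} (u : p ⟶ q) (v : q ⟶ r) {m n : S.obj (x, p)}
    (t : m ⟶ n) : (act S (push x (u ≫ v))).map t =
      eqToHom (push_comp_obj x u v m) ≫ (act S (push x v)).map ((act S (push x u)).map t) ≫
        eqToHom (push_comp_obj x u v n).symm := by
  rw [act_congr_map (push_comp x u v), act_comp_map]; simp

theorem pull_comp_map {p q r : K} (u : p ⟶ q) (v : q ⟶ r) (y : K) {m n : S.obj (op r, y)}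
    (t : m ⟶ n) : (act S (pull (u ≫ v) y)).map t =
      eqToHom (pull_comp_obj u v y m) ≫ (act S (pull u y)).map ((act S (pull v y)).map t) ≫
        eqToHom (pull_comp_obj u v y n).symm := by
  rw [act_congr_map (pull_comp u v y), act_comp_map]; simp

theorem pull_push_map {p q r s : K} (u : p ⟶ q) (v : r ⟶ s) {m n : S.obj (op q, r)}
    (t : m ⟶ n) : (act S (push (op p) v)).map ((act S (pull u r)).map t) =
      eqToHom (pull_push_obj u v m) ≫ (act S (pull u s)).map ((act S (push (op q) v)).map t) ≫
        eqToHom (pull_push_obj u v n).symm := by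
  have h := act_congr_map (S := S) (pull_push u v) t
  rw [act_comp_map, act_comp_map, eqToHom_comp_iff, comp_eqToHom_iff] at h
  rw [h]; simp

/-- The first factor of a composite acts first. A 2-cell in the second factor is therefore evaluated
at an image object, and a 2-cell in the first factor is mapped by the second functor. For `pull` the
two cases are exchanged. -/
theorem push₂_whiskerLeft_app (x : Kᵒᵖ) {p q r : K} (u : p ⟶ q) {v w : q ⟶ r} (α : v ⟶ w)
    (m : S.obj (x, p)) : act₂ S (push₂ x (u ◁ α)) m =
      eqToHom (push_comp_obj x u v m) ≫ act₂ S (push₂ x α) ((act S (push x u)).obj m) ≫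
        eqToHom (push_comp_obj x u w m).symm := by
  rw [push₂_whiskerLeft, act₂_conj, act₂_whiskerLeft]; simp

theorem push₂_whiskerRight_app (x : Kᵒᵖ) {p q r : K} {u v : p ⟶ q} (α : u ⟶ v) (w : q ⟶ r)
    (m : S.obj (x, p)) : act₂ S (push₂ x (α ▷ w)) m =
      eqToHom (push_comp_obj x u w m) ≫ (act S (push x w)).map (act₂ S (push₂ x α) m) ≫
        eqToHom (push_comp_obj x v w m).symm := by
  rw [push₂_whiskerRight, act₂_conj, act₂_whiskerRight]; simp

theorem pull₂_whiskerLeft_app {p q r : K} (u : p ⟶ q) {v w : q ⟶ r} (α : v ⟶ w) (y : K)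
    (m : S.obj (op r, y)) : act₂ S (pull₂ (u ◁ α) y) m =
      eqToHom (pull_comp_obj u v y m) ≫ (act S (pull u y)).map (act₂ S (pull₂ α y) m) ≫
        eqToHom (pull_comp_obj u w y m).symm := by
  rw [pull₂_whiskerLeft, act₂_conj, act₂_whiskerRight]; simp

theorem pull₂_whiskerRight_app {p q r : K} {u v : p ⟶ q} (α : u ⟶ v) (w : q ⟶ r) (y : K)
    (m : S.obj (op r, y)) : act₂ S (pull₂ (α ▷ w) y) m =
      eqToHom (pull_comp_obj u w y m) ≫ act₂ S (pull₂ α y) ((act S (pull w y)).obj m) ≫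
        eqToHom (pull_comp_obj v w y m).symm := by
  rw [pull₂_whiskerRight, act₂_conj, act₂_whiskerLeft]; simp

theorem pull_push₂_app {p q r s : K} (u : p ⟶ q) {v w : r ⟶ s} (α : v ⟶ w)
    (m : S.obj (op q, r)) : act₂ S (push₂ (op p) α) ((act S (pull u r)).obj m) =
      eqToHom (pull_push_obj u v m) ≫ (act S (pull u s)).map (act₂ S (push₂ (op q) α) m) ≫
        eqToHom (pull_push_obj u w m).symm := by
  have h := congrArg (fun t => act₂ S t m) (pull_push₂ u α)
  simp only [act₂_conj, act₂_whiskerLeft, act₂_whiskerRight] at h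
  rw [eqToHom_comp_iff, comp_eqToHom_iff] at h
  rw [h]; simp

theorem pull₂_push_app {p q r s : K} {u v : p ⟶ q} (α : u ⟶ v) (w : r ⟶ s)
    (m : S.obj (op q, r)) : (act S (push (op p) w)).map (act₂ S (pull₂ α r) m) =
      eqToHom (pull_push_obj u w m) ≫ act₂ S (pull₂ α s) ((act S (push (op q) w)).obj m) ≫
        eqToHom (pull_push_obj v w m).symm := by
  have h := congrArg (fun t => act₂ S t m) (pull₂_push α w)
  simp only [act₂_conj, act₂_whiskerLeft, act₂_whiskerRight] at h
  rw [eqToHom_comp_iff, comp_eqToHom_iff] at h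
  rw [h]; simp

theorem push_id_obj (x : Kᵒᵖ) (p : K) (m : S.obj (x, p)) : (act S (push x (𝟙 p))).obj m = m :=
  act_id_obj m

theorem pull_id_obj (p y : K) (m : S.obj (op p, y)) : (act S (pull (𝟙 p) y)).obj m = m :=
  act_id_obj m

theorem push_id_map (x : Kᵒᵖ) (p : K) {m n : S.obj (x, p)} (t : m ⟶ n) :
    (act S (push x (𝟙 p))).map t =
      eqToHom (push_id_obj x p m) ≫ t ≫ eqToHom (push_id_obj x p n).symm := act_id_map t

theorem pull_id_map (p y : K) {m n : S.obj (op p, y)} (t : m ⟶ n) :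
    (act S (pull (𝟙 p) y)).map t =
      eqToHom (pull_id_obj p y m) ≫ t ≫ eqToHom (pull_id_obj p y n).symm := act_id_map t

/-! ### The calculus of wedge cells over fixed points. -/

variable (pt : ∀ p : K, S.obj (op p, p))

/-- The type of the cells at `u` of the lax wedges to `S` with points `pt`. -/
abbrev WedgeCell {p q : K} (u : p ⟶ q) :=
  (act S (push (op p) u)).obj (pt p) ⟶ (act S (pull u q)).obj (pt q)

namespace WedgeCell

/-- The cell at an identity. -/
def id (p : K) : WedgeCell pt (𝟙 p) := eqToHom (push_pull_id p (pt p))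

variable {pt}

/-- The cell at a composite of 1-cells. -/
def comp {p q r : K} {u : p ⟶ q} {v : q ⟶ r} (σ : WedgeCell pt u) (τ : WedgeCell pt v) :
    WedgeCell pt (u ≫ v) :=
  eqToHom (push_comp_obj (op p) u v (pt p)) ≫ (act S (push (op p) v)).map σ ≫
    eqToHom (pull_push_obj u v (pt q)) ≫ (act S (pull u r)).map τ ≫
      eqToHom (pull_comp_obj u v r (pt r)).symm

/-- The type of a cell depends on its 1-cell, and equalities of 1-cells need not be definitional.
`HEq` is the form in which cells descend to a quotient of paths. Conjugation by `eqToHom` is the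
form in which they are computed. -/
theorem conj_heq {p q : K} {u v : p ⟶ q} (h : u = v) {σ : WedgeCell pt u} {τ : WedgeCell pt v}
    (e : σ = eqToHom (act_congr (congrArg (push (op p)) h) (pt p)) ≫ τ ≫
      eqToHom (act_congr (congrArg (fun u => pull u q) h) (pt q)).symm) : HEq σ τ := by
  cases h; simpa using e

theorem eq_conj {p q : K} {u v : p ⟶ q} (h : u = v) {σ : WedgeCell pt u} {τ : WedgeCell pt v}
    (e : HEq σ τ) : σ = eqToHom (act_congr (congrArg (push (op p)) h) (pt p)) ≫ τ ≫
      eqToHom (act_congr (congrArg (fun u => pull u q) h) (pt q)).symm := by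
  cases h; simpa using e

theorem comp_congr {p q r : K} {u u' : p ⟶ q} {v v' : q ⟶ r} (h : u = u') (h' : v = v')
    {σ : WedgeCell pt u} {σ' : WedgeCell pt u'} {τ : WedgeCell pt v} {τ' : WedgeCell pt v'}
    (e : HEq σ σ') (e' : HEq τ τ') : HEq (σ.comp τ) (σ'.comp τ') := by
  cases h; cases h'; cases e; cases e'; rfl

theorem id_comp {p q : K} {u : p ⟶ q} (σ : WedgeCell pt u) :
    HEq ((WedgeCell.id pt p).comp σ) σ := by
  refine conj_heq (Strict.id_comp u) ?_
  simp [comp, id, pull_id_map, eqToHom_map]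

theorem comp_id {p q : K} {u : p ⟶ q} (σ : WedgeCell pt u) :
    HEq (σ.comp (WedgeCell.id pt q)) σ := by
  refine conj_heq (Strict.comp_id u) ?_
  simp [comp, id, push_id_map, eqToHom_map]

/-- Both bracketings contain `σ` pushed along `v` and `w`, and `υ` pulled along `u` and `v`. The
middle cell `τ` is pushed along `w` and pulled along `u`, in opposite orders, which `pull_push_map`
interchanges. -/
theorem assoc {p q r s : K} {u : p ⟶ q} {v : q ⟶ r} {w : r ⟶ s} (σ : WedgeCell pt u)
    (τ : WedgeCell pt v) (υ : WedgeCell pt w) :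
    HEq ((σ.comp τ).comp υ) (σ.comp (τ.comp υ)) := by
  refine conj_heq (Strict.assoc u v w) ?_
  simp [comp, push_comp_map, pull_comp_map, pull_push_map, eqToHom_map]

/-- Compatibility of cells with a 2-cell `α`. -/
def Compat {p q : K} {u v : p ⟶ q} (α : u ⟶ v) (σ : WedgeCell pt u) (τ : WedgeCell pt v) : Prop :=
  σ ≫ act₂ S (pull₂ α q) (pt q) = act₂ S (push₂ (op p) α) (pt p) ≫ τ

theorem Compat.id {p q : K} {u : p ⟶ q} (σ : WedgeCell pt u) : Compat (𝟙 u) σ σ := by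
  have h₁ : act₂ S (pull₂ (𝟙 u) q) (pt q) = 𝟙 _ := act₂_id _ _
  have h₂ : act₂ S (push₂ (op p) (𝟙 u)) (pt p) = 𝟙 _ := act₂_id _ _
  rw [Compat, h₁, h₂]; simp

/-- Identity 2-cells act by identities, so the naturality square degenerates to an equality. Applied
to Gray cells with a tight factor, this gives the remaining relation between 1-cells. -/
theorem Compat.heq {p q : K} {u v : p ⟶ q} (h : u = v) {σ : WedgeCell pt u} {τ : WedgeCell pt v}
    (c : Compat (eqToHom h) σ τ) : HEq σ τ := by
  cases h
  have h₁ : act₂ S (pull₂ (𝟙 u) q) (pt q) = 𝟙 _ := act₂_id _ _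
  have h₂ : act₂ S (push₂ (op p) (𝟙 u)) (pt p) = 𝟙 _ := act₂_id _ _
  rw [eqToHom_refl, Compat, h₁, h₂] at c
  simpa using c

theorem Compat.comp {p q : K} {u v w : p ⟶ q} {α : u ⟶ v} {β : v ⟶ w} {σ : WedgeCell pt u}
    {τ : WedgeCell pt v} {υ : WedgeCell pt w} (h : Compat α σ τ) (h' : Compat β τ υ) :
    Compat (α ≫ β) σ υ := by
  have h₁ : pull₂ (α ≫ β) q = pull₂ α q ≫ pull₂ β q :=
    prod_hom₂_ext rfl (Category.id_comp (𝟙 (𝟙 q))).symm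
  have h₂ : push₂ (op p) (α ≫ β) = push₂ (op p) α ≫ push₂ (op p) β :=
    prod_hom₂_ext (Category.id_comp (𝟙 (𝟙 (op p)))).symm rfl
  unfold Compat at *
  rw [h₁, h₂, act₂_comp, act₂_comp, reassoc_of% h, h', Category.assoc]

/-- Pull the square of `α` back along `u`. The pulled-back covariant action of `α` is its action at
a pulled-back object, so it moves past the pushed `σ` by naturality. -/
theorem Compat.whiskerLeft {p q r : K} {u : p ⟶ q} (σ : WedgeCell pt u) {v w : q ⟶ r}
    {α : v ⟶ w} {τ : WedgeCell pt v} {υ : WedgeCell pt w} (h : Compat α τ υ) :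
    Compat (u ◁ α) (σ.comp τ) (σ.comp υ) := by
  have h₁ := congrArg (act S (pull u r)).map h
  have h₂ := act₂_naturality (push₂ (op p) α) σ
  simp only [Functor.map_comp] at h₁
  rw [pull_push₂_app] at h₂
  unfold Compat
  rw [pull₂_whiskerLeft_app, push₂_whiskerLeft_app]
  simp only [WedgeCell.comp, Category.assoc, eqToHom_trans_assoc, eqToHom_refl, Category.id_comp,
    reassoc_of% h₁, ← reassoc_of% h₂]

/-- Dual argument: push the square of `α` forward along `w`, interchange the two variables, and use
naturality of the contravariant action of `α` at `υ`. -/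
theorem Compat.whiskerRight {p q r : K} {u v : p ⟶ q} {α : u ⟶ v} {σ : WedgeCell pt u}
    {τ : WedgeCell pt v} (h : Compat α σ τ) {w : q ⟶ r} (υ : WedgeCell pt w) :
    Compat (α ▷ w) (σ.comp υ) (τ.comp υ) := by
  have h₁ := congrArg (act S (push (op p) w)).map h
  have h₂ := act₂_naturality (pull₂ α r) υ
  simp only [Functor.map_comp] at h₁
  rw [pull₂_push_app] at h₁
  unfold Compat
  rw [pull₂_whiskerRight_app, push₂_whiskerRight_app]
  simp only [WedgeCell.comp, Category.assoc, eqToHom_trans_assoc, eqToHom_refl, Category.id_comp,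
    reassoc_of% h₂, ← reassoc_of% h₁]

end WedgeCell

namespace LaxEnd

/-- The wedge with given points and cells. -/
def ofCell (cell : ∀ {p q : K} (u : p ⟶ q), WedgeCell pt u)
    (id : ∀ p, cell (𝟙 p) = WedgeCell.id pt p)
    (comp : ∀ {p q r : K} (u : p ⟶ q) (v : q ⟶ r), cell (u ≫ v) = (cell u).comp (cell v))
    (nat : ∀ {p q : K} {u v : p ⟶ q} (α : u ⟶ v), WedgeCell.Compat α (cell u) (cell v)) :
    LaxEnd S where
  pt := pt
  cell := cell
  cell_id := id
  cell_naturality := nat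
  cell_comp := comp

/-- The square at `u` pushed along `v` and the square at `v` pulled along `u` share the edge that
comes from `t q`, by interchange, and paste together. -/
theorem comm_comp {x y : LaxEnd S} (t : ∀ p, x.pt p ⟶ y.pt p) {p q r : K} {u : p ⟶ q} {v : q ⟶ r}
    (h : (act S (push (op p) u)).map (t p) ≫ y.cell u = x.cell u ≫ (act S (pull u q)).map (t q))
    (h' : (act S (push (op q) v)).map (t q) ≫ y.cell v = x.cell v ≫ (act S (pull v r)).map (t r)) :
    (act S (push (op p) (u ≫ v))).map (t p) ≫ y.cell (u ≫ v) =
      x.cell (u ≫ v) ≫ (act S (pull (u ≫ v) r)).map (t r) := by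
  have h₁ := congrArg (act S (push (op p) v)).map h
  have h₂ := congrArg (act S (pull u r)).map h'
  simp only [Functor.map_comp] at h₁ h₂
  rw [pull_push_map] at h₁
  simp only [x.cell_comp, y.cell_comp, push_comp_map, pull_comp_map, Category.assoc,
    eqToHom_trans_assoc, eqToHom_refl, Category.id_comp, reassoc_of% h₁, reassoc_of% h₂]

end LaxEnd
end

/-! ### Wedges on a Gray tensor product from their values on generators. -/

namespace Gray
section
variable {X : Type u₁} [Bicategory.{w₁, v₁} X] {Y : Type u₂} [Bicategory.{w₂, v₂} Y]
  {P : FStr X} {Q : FStr Y}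

/-- A lax wedge on a Gray tensor product, given by its cells at the generating 1-cells. -/
structure Wedge (S : StrictPseudofunctor ((Gray P Q)ᵒᵖ × Gray P Q) Cat.{v₃, u₃}) where
  pt (p : Gray P Q) : S.obj (op p, p)
  left {x x' : X} (f : x ⟶ x') (y : Y) : WedgeCell pt (inl P Q f y)
  right (x : X) {y y' : Y} (g : y ⟶ y') : WedgeCell pt (inr P Q x g)
  left_id (x : X) (y : Y) : HEq (left (𝟙 x) y) (WedgeCell.id pt ⟨x, y⟩)
  left_comp {x x' x'' : X} (f : x ⟶ x') (f' : x' ⟶ x'') (y : Y) :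
    HEq (left (f ≫ f') y) ((left f y).comp (left f' y))
  right_id (x : X) (y : Y) : HEq (right x (𝟙 y)) (WedgeCell.id pt ⟨x, y⟩)
  right_comp (x : X) {y y' y'' : Y} (g : y ⟶ y') (g' : y' ⟶ y'') :
    HEq (right x (g ≫ g')) ((right x g).comp (right x g'))
  left_naturality {x x' : X} {f f' : x ⟶ x'} (α : f ⟶ f') (y : Y) :
    WedgeCell.Compat (inl₂ P Q α y) (left f y) (left f' y)
  right_naturality (x : X) {y y' : Y} {g g' : y ⟶ y'} (β : g ⟶ g') :
    WedgeCell.Compat (inr₂ P Q x β) (right x g) (right x g')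
  swap {x x' : X} (f : x ⟶ x') {y y' : Y} (g : y ⟶ y') :
    WedgeCell.Compat (gray P Q f g) ((left f y).comp (right x' g)) ((right x g).comp (left f y'))

namespace Wedge
variable {S : StrictPseudofunctor ((Gray P Q)ᵒᵖ × Gray P Q) Cat.{v₃, u₃}} (W : Wedge S)

/-- The cell at a formal composite of 1-cells. -/
def pathCell : ∀ {p q : Gray P Q} (s : Path P Q p q),
    WedgeCell W.pt (Quot.mk PathRel s : p ⟶ q)
  | _, _, .nil p => WedgeCell.id W.pt p
  | _, _, .left f y => W.left f y
  | _, _, .right x g => W.right x g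
  | _, _, .comp s t => WedgeCell.comp (pathCell s) (pathCell t)

/-- The relations are of three kinds: the laws of a category, which composition of cells satisfies;
functoriality in each variable, which is part of `W`; and commutation of tight pairs. -/
theorem pathCell_rel {p q : Gray P Q} {s t : Path P Q p q} (h : PathRel s t) :
    HEq (W.pathCell s) (W.pathCell t) := by
  induction h with
  | comp_left t h ih => exact WedgeCell.comp_congr (Quot.sound h) rfl ih HEq.rfl
  | comp_right s h ih => exact WedgeCell.comp_congr rfl (Quot.sound h) HEq.rfl ih
  | nil_comp s => exact WedgeCell.id_comp _
  | comp_nil s => exact WedgeCell.comp_id _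
  | assoc f g h => exact WedgeCell.assoc _ _ _
  | left_id x y => exact W.left_id x y
  | left_comp f f' y => exact W.left_comp f f' y
  | right_id x y => exact W.right_id x y
  | right_comp x g g' => exact W.right_comp x g g'
  -- No separate axiom is needed here: the Gray cell of such a pair is an `eqToHom`, and
  -- compatibility with it is an equality of cells.
  | tight f g h =>
    have c := W.swap f g
    rw [gray_tight P Q f g h] at c
    exact c.heq (inl_inr f g h)

/-- The cell at a 1-cell. -/
def cell {p q : Gray P Q} (s : p ⟶ q) : WedgeCell W.pt s :=
  Quot.hrecOn (motive := fun s : p ⟶ q => WedgeCell W.pt s) s W.pathCell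
    fun _ _ h => W.pathCell_rel h

/-- Compatible 2-cells contain the generators and are closed under all formation rules. The
relations between 2-cells impose nothing further, because compatibility is a proposition. -/
theorem cell_compat {p q : Gray P Q} {s t : p ⟶ q} (η : Cell P Q s t) :
    WedgeCell.Compat (Quot.mk _ η : s ⟶ t) (W.cell s) (W.cell t) := by
  induction η with
  | id s => exact WedgeCell.Compat.id _
  | comp η θ h h' => exact h.comp h'
  | @whiskerLeft _ _ _ f g g' η ih =>
    -- On representatives, the cell at a composite unfolds to the composite of the cells.
    induction f using Quot.ind
    induction g using Quot.ind
    induction g' using Quot.ind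
    exact ih.whiskerLeft _
  | @whiskerRight _ _ _ f f' η g ih =>
    induction f using Quot.ind
    induction f' using Quot.ind
    induction g using Quot.ind
    exact ih.whiskerRight _
  | left α y => exact W.left_naturality α y
  | right x β => exact W.right_naturality x β
  | sigma f g => exact W.swap f g

/-- The lax wedge generated by `W`. -/
def toLaxEnd : LaxEnd S :=
  LaxEnd.ofCell W.pt W.cell (fun _ => rfl)
    (fun u v => Quot.inductionOn u fun _ => Quot.inductionOn v fun _ => rfl)
    (fun α => Quot.inductionOn α W.cell_compat)

end Wedge

variable {S : StrictPseudofunctor ((Gray P Q)ᵒᵖ × Gray P Q) Cat.{v₃, u₃}}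

/-- Wedges on a Gray tensor product with the same points agree if they agree on generators. -/
theorem laxEnd_cell_heq {x y : LaxEnd S} (h : x.pt = y.pt)
    (hl : ∀ {a a' : X} (f : a ⟶ a') (b : Y), HEq (x.cell (inl P Q f b)) (y.cell (inl P Q f b)))
    (hr : ∀ (a : X) {b b' : Y} (g : b ⟶ b'), HEq (x.cell (inr P Q a g)) (y.cell (inr P Q a g))) :
    x = y := by
  rcases x with ⟨p, c, ci, _, cc⟩
  rcases y with ⟨p', c', ci', _, cc'⟩
  obtain rfl : p = p' := h
  obtain rfl : @c = @c' := by
    funext p q s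
    induction s using Quot.ind
    rename_i s
    induction s with
    | nil p => exact (ci p).trans (ci' p).symm
    | left f y => exact eq_of_heq (hl f y)
    | right x g => exact eq_of_heq (hr x g)
    -- The axiom `cell_comp` of each wedge forces its cell at a composite.
    | comp s t hs ht =>
      refine (cc (Quot.mk _ s) (Quot.mk _ t)).trans (Eq.trans ?_ (cc' (Quot.mk _ s) (Quot.mk _ t)).symm)
      rw [hs, ht]
  rfl

/-- Compatibility of components with the cells of two wedges on a Gray tensor product may be
checked on generators. -/
theorem laxEnd_comm {x y : LaxEnd S} (t : ∀ p, x.pt p ⟶ y.pt p)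
    (hl : ∀ {a a' : X} (f : a ⟶ a') (b : Y),
      (act S (push (op ⟨a, b⟩) (inl P Q f b))).map (t ⟨a, b⟩) ≫ y.cell (inl P Q f b) =
        x.cell (inl P Q f b) ≫ (act S (pull (inl P Q f b) ⟨a', b⟩)).map (t ⟨a', b⟩))
    (hr : ∀ (a : X) {b b' : Y} (g : b ⟶ b'),
      (act S (push (op ⟨a, b⟩) (inr P Q a g))).map (t ⟨a, b⟩) ≫ y.cell (inr P Q a g) =
        x.cell (inr P Q a g) ≫ (act S (pull (inr P Q a g) ⟨a, b'⟩)).map (t ⟨a, b'⟩))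
    {p q : Gray P Q} (s : p ⟶ q) :
    (act S (push (op p) s)).map (t p) ≫ y.cell s = x.cell s ≫ (act S (pull s q)).map (t q) := by
  induction s using Quot.ind
  rename_i s
  induction s with
  -- At an identity, `push` and `pull` are the same 1-cell by definition, and both wedge cells are
  -- identities.
  | nil p =>
    refine Eq.trans (congrArg _ (y.cell_id p))
      (Eq.trans ?_ (congrArg (· ≫ _) (x.cell_id p)).symm)
    exact (Category.comp_id _).trans (Category.id_comp _).symm
  | left f y => exact hl f y
  | right x g => exact hr x g
  | comp s u hs hu => exact LaxEnd.comm_comp t hs hu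

end
end Gray
-- Transport of the wedge equations along equalities of objects and functors.
section
variable {C : Type u₁} [Category.{v₁} C] {D : Type u₂} [Category.{v₂} D] {E : Type u₃}
  [Category.{v₃} E]

/-- This and the next three equivalences are stated for arbitrary objects and functors, so that the
equalities can be eliminated by substitution. For the actual values of `T` they could not be. -/
theorem id_conj_iff {a b b' c d : D} {κ : a ⟶ b} (h : a = b) (e : b = b') (h₁ : a = c)
    (h₂ : c = d) (h₃ : d = b') :
    κ = eqToHom h ↔ κ ≫ eqToHom e = eqToHom h₁ ≫ eqToHom h₂ ≫ eqToHom h₃ := by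
  subst e; simp

/-- Used for two kinds of square: `α` is the contravariant action either of a 2-cell, or of a 1-cell
on a morphism between points. -/
theorem naturality_conj_iff {a b b' c c' d : D} {σ : a ⟶ b} {α : b ⟶ c} {β : a ⟶ d} {τ : d ⟶ c}
    {α' : b' ⟶ c'} (e : b = b') (e' : c = c') (h : α = eqToHom e ≫ α' ≫ eqToHom e'.symm) :
    σ ≫ α = β ≫ τ ↔ (σ ≫ eqToHom e) ≫ α' = β ≫ (τ ≫ eqToHom e') := by
  subst e e' h; simp

theorem comp_conj_iff {F : C ⥤ D} {G G' : E ⥤ D} (h : G = G') {x y y' : C} {z w w' : E}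
    {k k' l l' l'' : D} {σ : x ⟶ y} {τ : z ⟶ w} {κ : k ⟶ l} (e : y = y') (e' : w = w') (e'' : l = l')
    (h₁ : k = F.obj x) (h₂ : F.obj y = G.obj z) (h₃ : G.obj w = l) (h₁' : k = k')
    (h₁'' : k' = F.obj x) (h₂' : F.obj y' = G'.obj z) (h₃' : G'.obj w' = l'') (h₄ : l'' = l') :
    κ = eqToHom h₁ ≫ F.map σ ≫ eqToHom h₂ ≫ G.map τ ≫ eqToHom h₃ ↔
      κ ≫ eqToHom e'' = eqToHom h₁' ≫ (eqToHom h₁'' ≫ F.map (σ ≫ eqToHom e) ≫ eqToHom h₂' ≫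
        G'.map (τ ≫ eqToHom e') ≫ eqToHom h₃') ≫ eqToHom h₄ := by
  subst h e e' e''; subst h₁'; subst h₄; simp

/-- In the application `F` and `H` are the actions of `(1, g)` and `(1, f)`, and `G` and `L` the
contravariant actions of `f` and `g`, with `G'` and `L'` their two-variable forms. `γ` and `δ` are
the covariant and contravariant actions of `Σ`, and `n₁` and `n₂` are lax naturality cells. -/
theorem swap_conj_iff {C' : Type u₁} [Category.{v₁} C'] {E' : Type u₃} [Category.{v₃} E']
    {F : C ⥤ D} {G G' : E ⥤ D} {H : C' ⥤ D} {L L' : E' ⥤ D} (hG : G = G') (hL : L = L')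
    {a b b' : C} {c d d' : E} {a₁ b₁ b₁' : C'} {c₁ d₁ d₁' : E'} {σ : a ⟶ b} {τ : c ⟶ d} {ρ : a₁ ⟶ b₁}
    {υ : c₁ ⟶ d₁} {s s' t k : D} {n₁ : F.obj b ⟶ G.obj c} {n₂ : F.obj a ⟶ H.obj a₁}
    {γ : s ⟶ s'} {δ : t ⟶ k}
    (eb : b = b') (ed : d = d') (eb₁ : b₁ = b₁') (ed₁ : d₁ = d₁')
    (hn₁ : F.obj b = G.obj c) (hn : n₁ = eqToHom hn₁)
    (hm₁ : F.obj a = s) (hm₂ : s' = H.obj a₁) (hm : n₂ = eqToHom hm₁ ≫ γ ≫ eqToHom hm₂)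
    (hp : t = k) (hδ : δ = eqToHom hp)
    (i₁ : G.obj d = L.obj d₁) (i₂ : H.obj b₁ = L.obj c₁)
    (j₁ : s = F.obj a) (j₂ : F.obj b' = G'.obj c) (j₃ : G'.obj d' = t)
    (k₁ : s' = H.obj a₁) (k₂ : H.obj b₁' = L'.obj c₁) (k₃ : L'.obj d₁' = k) :
    F.map σ ≫ (n₁ ≫ G.map τ ≫ eqToHom i₁) = (n₂ ≫ H.map ρ ≫ eqToHom i₂) ≫ L.map υ ↔
      (eqToHom j₁ ≫ F.map (σ ≫ eqToHom eb) ≫ eqToHom j₂ ≫ G'.map (τ ≫ eqToHom ed) ≫ eqToHom j₃) ≫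
        δ = γ ≫ (eqToHom k₁ ≫ H.map (ρ ≫ eqToHom eb₁) ≫ eqToHom k₂ ≫
          L'.map (υ ≫ eqToHom ed₁) ≫ eqToHom k₃) := by
  subst hG hL eb ed eb₁ ed₁ hn hm hp hδ
  subst hm₁ hm₂ j₃
  simp only [eqToHom_refl, Category.comp_id, Category.id_comp, Category.assoc]
  -- After substitution the two squares differ only in their last corner, `G.obj d` or `L.obj d₁`.
  -- Composing with the identification of these objects passes from one to the other.
  constructor
  · intro h
    rw [← cancel_mono (eqToHom i₁)]
    simpa using h
  · intro h
    rw [← cancel_mono (eqToHom k₃)]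
    simpa using h
end

namespace LaxEnd
section
variable {A : Type u₁} [Bicategory.{w₁, v₁} A] {S : StrictPseudofunctor (Aᵒᵖ × A) Cat.{v₃, u₃}}

/-- The left side has the shape of the composite in `cell_comp`. This reads that axiom of the outer
wedge at one object of the inner 2-category. -/
theorem conj₂_app [Strict A] {x y z w v u : LaxEnd S} (h : x = y) (s : y ⟶ z) (h' : z = w) (t : w ⟶ v)
    (h'' : v = u) (a : A) : Hom.app (eqToHom h ≫ s ≫ eqToHom h' ≫ t ≫ eqToHom h'') a =
      eqToHom (congrArg (fun x => pt x a) h) ≫ Hom.app s a ≫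
        eqToHom (congrArg (fun x => pt x a) h') ≫ Hom.app t a ≫
          eqToHom (congrArg (fun x => pt x a) h'') := by
  simp only [comp_app, eqToHom_app]
end
end LaxEnd

/-! ### Actions in the iterated and in the two-variable lax end. -/

namespace Fubini
section
variable {A : Type u₁} [Bicategory.{w₁, v₁} A] [Strict A]
  {B : Type u₂} [Bicategory.{w₂, v₂} B] [Strict B]
  {T : StrictPseudofunctor (Aᵒᵖ × Bᵒᵖ × LaxGray A B) Cat.{v₃, u₃}}

variable (T) in
/-- The 2-functor `T (a, -, c, -)`. -/
abbrev partialEval (a c : A) : StrictPseudofunctor (Bᵒᵖ × B) Cat.{v₃, u₃} :=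
  ((transpose T).obj (op a, c)).functor

/-- The left side applies `T` to a triple whose last entry is the generator `(1, 𝟙 z)`, the right
side to one whose last entry is an identity. They agree by a relation of the tensor product, so the
equality is not definitional. -/
theorem act_pullR (a c : A) {y y' : B} (g : y ⟶ y') (z : B) :
    act (partialEval T a c) (pull g z) =
      act (twoVar T) (pull (Gray.inr (FStr.min A) (FStr.min B) a g) ⟨c, z⟩) :=
  congrArg (fun u : ((op a, op y', ⟨c, z⟩) : Aᵒᵖ × Bᵒᵖ × LaxGray A B) ⟶ (op a, op y, ⟨c, z⟩) =>
      act T u)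
    (Prod.ext rfl (Prod.ext rfl (Gray.inr_id c z)) :
      ((𝟙 (op a), g.op, Gray.inr _ _ c (𝟙 z)) :
        ((op a, op y', ⟨c, z⟩) : Aᵒᵖ × Bᵒᵖ × LaxGray A B) ⟶ (op a, op y, ⟨c, z⟩)) =
      (𝟙 (op a), g.op, 𝟙 _))

theorem act_pullL {a a' : A} (f : a ⟶ a') (c : A) (y z : B) :
    FunSL.at' ((transpose T).map (pull f c)) (op y, z) =
      act (twoVar T) (pull (Gray.inl (FStr.min A) (FStr.min B) f y) ⟨c, z⟩) :=
  congrArg (fun u : ((op a', op y, ⟨c, z⟩) : Aᵒᵖ × Bᵒᵖ × LaxGray A B) ⟶ (op a, op y, ⟨c, z⟩) =>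
      act T u)
    (Prod.ext rfl (Prod.ext rfl (Gray.inl_id c z)) :
      ((f.op, 𝟙 (op y), Gray.inl _ _ (𝟙 c) z) :
        ((op a', op y, ⟨c, z⟩) : Aᵒᵖ × Bᵒᵖ × LaxGray A B) ⟶ (op a, op y, ⟨c, z⟩)) =
      (f.op, 𝟙 (op y), 𝟙 _))

theorem act₂_pullR (a c : A) {y y' : B} {g g' : y ⟶ y'} (β : g ⟶ g') (z : B)
    (m : (partialEval T a c).obj (op y', z)) :
    act₂ (partialEval T a c) (pull₂ β z) m =
      eqToHom (Functor.congr_obj (act_pullR a c g z) m) ≫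
        act₂ (twoVar T) (pull₂ (Gray.inr₂ (FStr.min A) (FStr.min B) a β) ⟨c, z⟩) m ≫
          eqToHom (Functor.congr_obj (act_pullR a c g' z) m).symm := by
  have e : ∀ g : y ⟶ y', ((𝟙 (op a), g.op, Gray.inr _ _ c (𝟙 z)) :
        ((op a, op y', ⟨c, z⟩) : Aᵒᵖ × Bᵒᵖ × LaxGray A B) ⟶ (op a, op y, ⟨c, z⟩)) =
      (𝟙 (op a), g.op, 𝟙 _) := fun g => Prod.ext rfl (Prod.ext rfl (Gray.inr_id c z))
  refine Eq.trans ?_ (act₂_conj (S := T) (e g) (𝟙 (𝟙 (op a)), op2 β, 𝟙 (𝟙 _)) (e g').symm m)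
  refine congrArg (fun t => act₂ T t m) ?_
  refine prod_conj_ext (conj_self _) (prod_conj_ext (conj_self _) ?_)
  exact (Gray.inr₂_id _ _ c (𝟙 z)).trans (id_conj _)

theorem act₂_pullL {a a' : A} {f f' : a ⟶ a'} (α : f ⟶ f') (c : A) (y z : B)
    (m : (partialEval T a' c).obj (op y, z)) :
    FunSL.modApp ((transpose T).map₂ (pull₂ α c)) (op y, z) m =
      eqToHom (Functor.congr_obj (act_pullL f c y z) m) ≫
        act₂ (twoVar T) (pull₂ (Gray.inl₂ (FStr.min A) (FStr.min B) α y) ⟨c, z⟩) m ≫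
          eqToHom (Functor.congr_obj (act_pullL f' c y z) m).symm := by
  have e : ∀ f : a ⟶ a', ((f.op, 𝟙 (op y), Gray.inl _ _ (𝟙 c) z) :
        ((op a', op y, ⟨c, z⟩) : Aᵒᵖ × Bᵒᵖ × LaxGray A B) ⟶ (op a, op y, ⟨c, z⟩)) =
      (f.op, 𝟙 (op y), 𝟙 _) := fun f => Prod.ext rfl (Prod.ext rfl (Gray.inl_id c z))
  refine Eq.trans ?_ (act₂_conj (S := T) (e f) (op2 α, 𝟙 (𝟙 (op y)), 𝟙 (𝟙 _)) (e f').symm m)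
  refine congrArg (fun t => act₂ T t m) ?_
  refine prod_conj_ext (conj_self _) (prod_conj_ext (conj_self _) ?_)
  exact (Gray.inl₂_id _ _ (𝟙 c) z).trans (id_conj _)

/-- The 1-cell `(f, 1)` is tight in `Aᵒᵖ × A`, so its Gray cells are identities. -/
theorem nat_pullL {a a' : A} (f : a ⟶ a') (c : A) (y : B) {z z' : B} (g : z ⟶ z')
    (m : (partialEval T a' c).obj (op y, z)) :
    ∃ h, FunSL.nat ((transpose T).map (pull f c)) (push (op y) g) m = eqToHom h :=
  ⟨_, (congrArg (fun t => t.toNatTrans.app m)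
    (Gray.mapGray_tight ((jFunctor Aᵒᵖ A Bᵒᵖ B).comp T) (pull f c) (push (op y) g)
      (.inl (LaxEnd.tight_pull f c)))).trans (Cat.eqToHom_app _ _ _ m)⟩

/-- The lax naturality cells of a transpose are the images of Gray cells, and `jFunctor` sends the
Gray cell of `(1, f)` and `(1, g)` to that of `f` and `g`. This is where `Σ` enters the iterated lax
end. -/
theorem nat_pushL {a c c' : A} (f : c ⟶ c') {y z z' : B} (g : z ⟶ z')
    (m : (partialEval T a c).obj (op y, z)) :
    ∃ h₁ h₂, FunSL.nat ((transpose T).map (push (op a) f)) (push (op y) g) m =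
      eqToHom h₁ ≫ act₂ (twoVar T)
        (push₂ (op (⟨a, y⟩ : LaxGray A B)) (Gray.gray (FStr.min A) (FStr.min B) f g)) m ≫
          eqToHom h₂ := by
  have h₀ := cat_conj_app (((jFunctor Aᵒᵖ A Bᵒᵖ B).comp T).map_comp _ _).symm
    (((jFunctor Aᵒᵖ A Bᵒᵖ B).comp T).map₂
      (Gray.gray (FStr.fst Aᵒᵖ A) (FStr.fst Bᵒᵖ B) (push (op a) f) (push (op y) g)))
    (((jFunctor Aᵒᵖ A Bᵒᵖ B).comp T).map_comp _ _) m
  -- The image of a composite of two generators under `jFunctor` has composites of two identities in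
  -- its contravariant entries. They have to be contracted before comparison with `push₂`.
  have e : ∀ s : (⟨c, z⟩ : LaxGray A B) ⟶ ⟨c', z'⟩, ((𝟙 (op a) ≫ 𝟙 (op a), 𝟙 (op y) ≫ 𝟙 (op y), s) :
        ((op a, op y, ⟨c, z⟩) : Aᵒᵖ × Bᵒᵖ × LaxGray A B) ⟶ (op a, op y, ⟨c', z'⟩)) =
      (𝟙 (op a), 𝟙 (op y), s) := fun s =>
    Prod.ext (Strict.comp_id _) (Prod.ext (Strict.comp_id _) rfl)
  have h : ((jFunctor Aᵒᵖ A Bᵒᵖ B).map₂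
      (Gray.gray (FStr.fst Aᵒᵖ A) (FStr.fst Bᵒᵖ B) (push (op a) f) (push (op y) g))) =
      eqToHom (e _) ≫ ((𝟙 (𝟙 (op a)), 𝟙 (𝟙 (op y)), Gray.gray (FStr.min A) (FStr.min B) f g) :
        ((𝟙 (op a), 𝟙 (op y), Gray.inl _ _ f z ≫ Gray.inr _ _ c' g) :
        ((op a, op y, ⟨c, z⟩) : Aᵒᵖ × Bᵒᵖ × LaxGray A B) ⟶ (op a, op y, ⟨c', z'⟩)) ⟶
        (𝟙 (op a), 𝟙 (op y), Gray.inr _ _ c g ≫ Gray.inl _ _ f z')) ≫ eqToHom (e _).symm := by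
    refine prod_conj_ext ?_ (prod_conj_ext ?_ (conj_self _))
    · exact Eq.symm ((congrArg (fun t => _ ≫ t) (Category.id_comp _)).trans (eqToHom_trans _ _))
    · exact Eq.symm ((congrArg (fun t => _ ≫ t) (Category.id_comp _)).trans (eqToHom_trans _ _))
  have h' := (congrArg (fun t => act₂ T t m) h).trans
    (act₂_conj (S := T) (p := (op a, op y, ⟨c, z⟩)) _ _ _ m)
  exact ⟨_, _, h₀.trans ((congrArg (fun t => eqToHom _ ≫ t ≫ eqToHom _) h').trans
    (conj_conj _ _ _ _ _).symm)⟩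

theorem op2_eqToHom_triple {X : Type u₁} [Bicategory.{w₁, v₁} X] {Y : Type u₂}
    [Bicategory.{w₂, v₂} Y] {Z : Type u₃} [Bicategory.{w₃, v₃} Z] {a b : X} {f f' : a ⟶ b}
    {c d : Y} {g g' : c ⟶ d} {p q : Z} (s : p ⟶ q) (h : f = f') (h' : g = g')
    (e : ((f.op, g.op, s) : ((op b, op d, p) : Xᵒᵖ × Yᵒᵖ × Z) ⟶ (op a, op c, q)) =
      (f'.op, g'.op, s)) :
    eqToHom e = (op2 (eqToHom h), op2 (eqToHom h'), 𝟙 s) := by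
  cases h; cases h'; rfl

/-- The contravariant variable only sees the image of `Σ` in `A × B`, which is an identity 2-cell.
Thus naturality at `Σ` involves `T Σ` on one side only, as in a morphism of the inner lax end. -/
theorem act₂_pull_gray {a a' : A} (f : a ⟶ a') {y y' : B} (g : y ⟶ y') (p : LaxGray A B)
    (m : (twoVar T).obj (op ⟨a', y'⟩, p)) :
    ∃ h, act₂ (twoVar T) (pull₂ (Gray.gray (FStr.min A) (FStr.min B) f g) p) m = eqToHom h :=
  have h₁ := (Strict.comp_id f).trans (Strict.id_comp f).symm
  have h₂ := (Strict.id_comp g).trans (Strict.comp_id g).symm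
  ⟨_, (congrArg (fun t => act₂ T t m) (op2_eqToHom_triple (𝟙 p) h₁ h₂
    (Prod.ext (congrArg Quiver.Hom.op h₁) (Prod.ext (congrArg Quiver.Hom.op h₂) rfl))).symm).trans
    (act₂_eqToHom (S := T) (p := (op a', op y', p)) _ m)⟩

end

/-! ### Correspondence of cells and of the equations between them. -/

section
variable {A : Type u₁} [Bicategory.{w₁, v₁} A] [Strict A]
  {B : Type u₂} [Bicategory.{w₂, v₂} B] [Strict B]
  {T : StrictPseudofunctor (Aᵒᵖ × Bᵒᵖ × LaxGray A B) Cat.{v₃, u₃}}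
  {pt : ∀ p : LaxGray A B, (twoVar T).obj (op p, p)}

variable (pt) in
/-- The type of the cells at `(f, 1)` that occur in the iterated lax end. -/
abbrev CellL {a a' : A} (f : a ⟶ a') (b : B) :=
  (FunSL.at' ((transpose T).map (push (op a) f)) (op b, b)).obj (pt ⟨a, b⟩) ⟶
    (FunSL.at' ((transpose T).map (pull f a')) (op b, b)).obj (pt ⟨a', b⟩)

variable (pt) in
/-- The type of the cells at `(1, g)` that occur in the iterated lax end. -/
abbrev CellR (a : A) {b b' : B} (g : b ⟶ b') :=
  (act (partialEval T a a) (push (op b) g)).obj (pt ⟨a, b⟩) ⟶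
    (act (partialEval T a a) (pull g b')).obj (pt ⟨a, b'⟩)

/-- The cells at `(f, 1)` in the two lax ends correspond. -/
def cellL {a a' : A} {f : a ⟶ a'} {b : B} (σ : CellL pt f b) :
    WedgeCell pt (Gray.inl (FStr.min A) (FStr.min B) f b) :=
  -- Only the target needs correction: the covariant actions of `(f, 1)` agree by definition.
  σ ≫ eqToHom (Functor.congr_obj (act_pullL f a' b b) (pt ⟨a', b⟩))

/-- The cells at `(1, g)` in the two lax ends correspond. -/
def cellR {a : A} {b b' : B} {g : b ⟶ b'} (σ : CellR pt a g) :
    WedgeCell pt (Gray.inr (FStr.min A) (FStr.min B) a g) :=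
  σ ≫ eqToHom (Functor.congr_obj (act_pullR a a g b') (pt ⟨a, b'⟩))

/-- The inverse of `cellL`. -/
def cellL' {a a' : A} {f : a ⟶ a'} {b : B}
    (σ : WedgeCell pt (Gray.inl (FStr.min A) (FStr.min B) f b)) : CellL pt f b :=
  σ ≫ eqToHom (Functor.congr_obj (act_pullL f a' b b) (pt ⟨a', b⟩)).symm

/-- The inverse of `cellR`. -/
def cellR' {a : A} {b b' : B} {g : b ⟶ b'}
    (σ : WedgeCell pt (Gray.inr (FStr.min A) (FStr.min B) a g)) : CellR pt a g :=
  σ ≫ eqToHom (Functor.congr_obj (act_pullR a a g b') (pt ⟨a, b'⟩)).symm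

theorem conj_cancel {C : Type u₁} [Category.{v₁} C] {a b c : C} (m : a ⟶ b) (h : b = c) :
    (m ≫ eqToHom h) ≫ eqToHom h.symm = m := by simp

theorem cellL_cellL' {a a' : A} {f : a ⟶ a'} {b : B}
    (σ : WedgeCell pt (Gray.inl (FStr.min A) (FStr.min B) f b)) : cellL (cellL' σ) = σ :=
  conj_cancel σ _

theorem cellR_cellR' {a : A} {b b' : B} {g : b ⟶ b'}
    (σ : WedgeCell pt (Gray.inr (FStr.min A) (FStr.min B) a g)) : cellR (cellR' σ) = σ :=
  conj_cancel σ _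

theorem cellL'_cellL {a a' : A} {f : a ⟶ a'} {b : B} (σ : CellL pt f b) :
    cellL' (cellL σ) = σ := conj_cancel σ _

theorem cellR'_cellR {a : A} {b b' : B} {g : b ⟶ b'} (σ : CellR pt a g) :
    cellR' (cellR σ) = σ := conj_cancel σ _

theorem heq_iff_conj {p q : LaxGray A B} {u v : p ⟶ q} (h : u = v) {σ : WedgeCell pt u}
    {τ : WedgeCell pt v} : HEq σ τ ↔
      σ = eqToHom (act_congr (congrArg (push (op p)) h) (pt p)) ≫ τ ≫
        eqToHom (act_congr (congrArg (fun u => pull u q) h) (pt q)).symm :=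
  ⟨WedgeCell.eq_conj h, WedgeCell.conj_heq h⟩

/-- From here on each wedge axiom is matched with its counterpart by an equivalence, because both
directions are used: one to build a two-variable wedge, the other to restrict it. -/
theorem cellR_id_iff {a : A} {b : B} (σ : CellR pt a (𝟙 b)) (h) :
    σ = eqToHom h ↔ HEq (cellR σ) (WedgeCell.id pt ⟨a, b⟩) :=
  (id_conj_iff _ _ _ _ _).trans (heq_iff_conj (Gray.inr_id a b)).symm

theorem cellL_id_iff {a : A} {b : B} (σ : CellL pt (𝟙 a) b) (h) :
    σ = eqToHom h ↔ HEq (cellL σ) (WedgeCell.id pt ⟨a, b⟩) :=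
  (id_conj_iff _ _ _ _ _).trans (heq_iff_conj (Gray.inl_id a b)).symm

theorem cellR_naturality_iff {a : A} {b b' : B} {g g' : b ⟶ b'} (β : g ⟶ g') (σ : CellR pt a g)
    (τ : CellR pt a g') :
    σ ≫ act₂ (partialEval T a a) (pull₂ β b') (pt ⟨a, b'⟩) =
        act₂ (partialEval T a a) (push₂ (op b) β) (pt ⟨a, b⟩) ≫ τ ↔
      WedgeCell.Compat (Gray.inr₂ (FStr.min A) (FStr.min B) a β) (cellR σ) (cellR τ) :=
  naturality_conj_iff _ _ (act₂_pullR a a β b' (pt ⟨a, b'⟩))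

theorem cellL_naturality_iff {a a' : A} {f f' : a ⟶ a'} (α : f ⟶ f') {b : B} (σ : CellL pt f b)
    (τ : CellL pt f' b) :
    σ ≫ FunSL.modApp ((transpose T).map₂ (pull₂ α a')) (op b, b) (pt ⟨a', b⟩) =
        FunSL.modApp ((transpose T).map₂ (push₂ (op a) α)) (op b, b) (pt ⟨a, b⟩) ≫ τ ↔
      WedgeCell.Compat (Gray.inl₂ (FStr.min A) (FStr.min B) α b) (cellL σ) (cellL τ) :=
  naturality_conj_iff _ _ (act₂_pullL α a' b b (pt ⟨a', b⟩))

theorem cellR_comp_iff {a : A} {b b' b'' : B} {g : b ⟶ b'} {g' : b' ⟶ b''} (σ : CellR pt a g)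
    (τ : CellR pt a g') (κ : CellR pt a (g ≫ g')) (h₁ h₂ h₃) :
    κ = eqToHom h₁ ≫ (act (partialEval T a a) (push (op b) g')).map σ ≫ eqToHom h₂ ≫
        (act (partialEval T a a) (pull g b'')).map τ ≫ eqToHom h₃ ↔
      HEq (cellR κ) ((cellR σ).comp (cellR τ)) :=
  (comp_conj_iff (act_pullR a a g b'') _ _ _ _ _ _ _ _ _ _ _).trans
    (heq_iff_conj (Gray.inr_comp a g g')).symm

theorem cellL_comp_iff {a a' a'' : A} {b : B} {f : a ⟶ a'} {f' : a' ⟶ a''} (σ : CellL pt f b)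
    (τ : CellL pt f' b) (κ : CellL pt (f ≫ f') b) (h₁ h₂ h₃) :
    κ = eqToHom h₁ ≫ (FunSL.at' ((transpose T).map (push (op a) f')) (op b, b)).map σ ≫
        eqToHom h₂ ≫ (FunSL.at' ((transpose T).map (pull f a'')) (op b, b)).map τ ≫
          eqToHom h₃ ↔
      HEq (cellL κ) ((cellL σ).comp (cellL τ)) :=
  (comp_conj_iff (act_pullL f a'' b b) _ _ _ _ _ _ _ _ _ _ _).trans
    (heq_iff_conj (Gray.inl_comp f f' b)).symm

/-- The heart of the theorem. The naturality cell on the left is an identity by tightness and the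
one on the right is `T Σ`, while in the naturality condition for `Σ` the contravariant action is an
identity and the covariant one is `T Σ`. The other factors match one by one. -/
theorem swap_iff {a a' : A} {f : a ⟶ a'} {b b' : B} {g : b ⟶ b'} (σ : CellL pt f b)
    (τ : CellR pt a' g) (ρ : CellR pt a g) (υ : CellL pt f b') (h₁ h₂) :
    (act (partialEval T a a') (push (op b) g)).map σ ≫
        (FunSL.nat ((transpose T).map (pull f a')) (push (op b) g) (pt ⟨a', b⟩) ≫
          (FunSL.at' ((transpose T).map (pull f a')) (op b, b')).map τ ≫ eqToHom h₁) =
      (FunSL.nat ((transpose T).map (push (op a) f)) (push (op b) g) (pt ⟨a, b⟩) ≫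
          (FunSL.at' ((transpose T).map (push (op a) f)) (op b, b')).map ρ ≫ eqToHom h₂) ≫
        (act (partialEval T a a') (pull g b')).map υ ↔
      WedgeCell.Compat (Gray.gray (FStr.min A) (FStr.min B) f g) ((cellL σ).comp (cellR τ))
        ((cellR ρ).comp (cellL υ)) := by
  obtain ⟨_, n₁⟩ := nat_pullL f a' b g (pt ⟨a', b⟩)
  obtain ⟨_, _, n₂⟩ := nat_pushL f g (pt ⟨a, b⟩)
  obtain ⟨_, n₃⟩ := act₂_pull_gray f g ⟨a', b'⟩ (pt ⟨a', b'⟩)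
  exact swap_conj_iff (act_pullL f a' b b') (act_pullR a a' g b') _ _ _ _
    _ n₁ _ _ n₂ _ n₃ _ _ _ _ _ _ _ _

end

/-! ### The bijection on objects. -/

section
variable {A : Type u₁} [Bicategory.{w₁, v₁} A] [Strict A]
  {B : Type u₂} [Bicategory.{w₂, v₂} B] [Strict B]
  {T : StrictPseudofunctor (Aᵒᵖ × Bᵒᵖ × LaxGray A B) Cat.{v₃, u₃}}

/-- The object `s_a` of the lax end over `B` in an object `s` of the iterated lax end. -/
abbrev innerPt (x : LaxEnd (innerEnd T)) (a : A) : LaxEnd (partialEval T a a) := x.pt a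

/-- The points of an object of the iterated lax end. -/
abbrev points (x : LaxEnd (innerEnd T)) (p : LaxGray A B) : (twoVar T).obj (op p, p) :=
  (innerPt x p.fst).pt p.snd

/-- The morphism `s_f` of the lax end over `B` in an object `s` of the iterated lax end. -/
abbrev innerCell (x : LaxEnd (innerEnd T)) {a a' : A} (f : a ⟶ a') :
    LaxEnd.mapObj ((transpose T).map (push (op a) f)) (innerPt x a) ⟶
      LaxEnd.mapObj ((transpose T).map (pull f a')) (innerPt x a') := x.cell f

/-- The component at `b` of `s_f`. -/
abbrev rawL (x : LaxEnd (innerEnd T)) {a a' : A} (f : a ⟶ a') (b : B) :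
    CellL (points x) f b := LaxEnd.Hom.app (innerCell x f) b

/-- The cells of `s_a`. -/
abbrev rawR (x : LaxEnd (innerEnd T)) (a : A) {b b' : B} (g : b ⟶ b') :
    CellR (points x) a g := (innerPt x a).cell g

/-- The cells of the two-variable wedge given by an object of the iterated lax end. -/
def toWedge (x : LaxEnd (innerEnd T)) : Gray.Wedge (twoVar T) where
  pt := points x
  left f b := cellL (rawL x f b)
  right a _ _ g := cellR (rawR x a g)
  -- The axioms over `A` are equations between morphisms of lax ends over `B`, read here at the
  -- component `b`.
  left_id a b := (cellL_id_iff (rawL x (𝟙 a) b) _).1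
    ((congrArg (fun s => LaxEnd.Hom.app s b) (x.cell_id a)).trans (LaxEnd.eqToHom_app _ b))
  left_comp f f' b := (cellL_comp_iff (rawL x f b) (rawL x f' b) (rawL x (f ≫ f') b) _ _ _).1
    ((congrArg (fun s => LaxEnd.Hom.app s b) (x.cell_comp f f')).trans
      (LaxEnd.conj₂_app _ _ _ _ _ b))
  right_id a b := (cellR_id_iff (rawR x a (𝟙 b)) _).1 ((innerPt x a).cell_id b)
  right_comp a _ _ _ g g' := (cellR_comp_iff (rawR x a g) (rawR x a g') (rawR x a (g ≫ g')) _ _ _).1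
    ((innerPt x a).cell_comp g g')
  left_naturality {_ _ f f'} α b := (cellL_naturality_iff α (rawL x f b) (rawL x f' b)).1
    (congrArg (fun s => LaxEnd.Hom.app s b) (x.cell_naturality α))
  right_naturality a _ _ g g' β := (cellR_naturality_iff β (rawR x a g) (rawR x a g')).1
    ((innerPt x a).cell_naturality β)
  -- Naturality at `Σ` comes from the square at `g` of the morphism `s_f`.
  swap {a a'} f {b b'} g := (swap_iff (rawL x f b) (rawR x a' g) (rawR x a g) (rawL x f b') _ _).1
    (LaxEnd.Hom.comm (innerCell x f) g)

/-- The object of the two-variable lax end given by an object of the iterated lax end. -/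
def toTwoVar (x : LaxEnd (innerEnd T)) : LaxEnd (twoVar T) := (toWedge x).toLaxEnd

theorem heq_id (w : LaxEnd (twoVar T)) {p : LaxGray A B} {u : p ⟶ p} (h : u = 𝟙 p) :
    HEq (w.cell u) (WedgeCell.id w.pt p) := by
  subst h; exact heq_of_eq (w.cell_id p)

/-- Needed because a generator at `f ≫ f'` equals the composite of generators only by a relation,
which puts the two cells in different types. -/
theorem heq_comp (w : LaxEnd (twoVar T)) {p q r : LaxGray A B} {u : p ⟶ r} {v : p ⟶ q} {v' : q ⟶ r}
    (h : u = v ≫ v') :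
    HEq (w.cell u) (WedgeCell.comp (pt := w.pt) (w.cell v) (w.cell v')) := by
  subst h; exact heq_of_eq (w.cell_comp v v')

theorem compat_comp (w : LaxEnd (twoVar T)) {p q q' r : LaxGray A B} {u : p ⟶ q} {v : q ⟶ r}
    {u' : p ⟶ q'} {v' : q' ⟶ r} (α : u ≫ v ⟶ u' ≫ v') :
    WedgeCell.Compat α (WedgeCell.comp (pt := w.pt) (w.cell u) (w.cell v))
      (WedgeCell.comp (pt := w.pt) (w.cell u') (w.cell v')) := by
  have h : WedgeCell.Compat α (w.cell (u ≫ v)) (w.cell (u' ≫ v')) := w.cell_naturality α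
  have h₁ : w.cell (u ≫ v) = WedgeCell.comp (pt := w.pt) (w.cell u) (w.cell v) := w.cell_comp u v
  have h₂ : w.cell (u' ≫ v') = WedgeCell.comp (pt := w.pt) (w.cell u') (w.cell v') :=
    w.cell_comp u' v'
  rwa [h₁, h₂] at h

/-- The cell at `(f, 1)` of an object of the two-variable lax end. -/
abbrev resL (w : LaxEnd (twoVar T)) {a a' : A} (f : a ⟶ a') (b : B) : CellL w.pt f b :=
  cellL' (w.cell (Gray.inl _ _ f b))

/-- The cell at `(1, g)` of an object of the two-variable lax end. -/
abbrev resR (w : LaxEnd (twoVar T)) (a : A) {b b' : B} (g : b ⟶ b') : CellR w.pt a g :=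
  cellR' (w.cell (Gray.inr _ _ a g))

/-- The restriction to `{a} × B` of an object of the two-variable lax end. -/
def resPt (w : LaxEnd (twoVar T)) (a : A) : LaxEnd (partialEval T a a) where
  pt b := w.pt ⟨a, b⟩
  cell g := resR w a g
  cell_id b := (cellR_id_iff (resR w a (𝟙 b)) _).2
    (by rw [cellR_cellR']; exact heq_id w (Gray.inr_id a b))
  cell_naturality {b b' g g'} β := (cellR_naturality_iff β (resR w a g) (resR w a g')).2
    (by rw [cellR_cellR', cellR_cellR']; exact w.cell_naturality _)
  cell_comp g g' := (cellR_comp_iff (resR w a g) (resR w a g') (resR w a (g ≫ g')) _ _ _).2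
    (by rw [cellR_cellR', cellR_cellR', cellR_cellR']; exact heq_comp w (Gray.inr_comp a g g'))

/-- The cell at `f : a ⟶ a'` of the object of the iterated lax end given by `w`. -/
def resCell (w : LaxEnd (twoVar T)) {a a' : A} (f : a ⟶ a') :
    LaxEnd.mapObj ((transpose T).map (push (op a) f)) (resPt w a) ⟶
      LaxEnd.mapObj ((transpose T).map (pull f a')) (resPt w a') where
  app b := resL w f b
  -- Naturality of `w` at `Σ` is what makes the components at `(f, 1)` a morphism of wedges over
  -- `B`.
  comm {b b'} g := (swap_iff (resL w f b) (resR w a' g) (resR w a g) (resL w f b') _ _).2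
    (by rw [cellL_cellL', cellL_cellL', cellR_cellR', cellR_cellR']; exact compat_comp w _)

/-- The object of the iterated lax end given by an object of the two-variable lax end. -/
def toIterated (w : LaxEnd (twoVar T)) : LaxEnd (innerEnd T) where
  pt a := resPt w a
  cell f := resCell w f
  cell_id a := LaxEnd.hom_ext fun b => by
    -- The two endpoints are given explicitly because the values of `innerEnd T` are lax ends over
    -- `B` only after unfolding.
    refine Eq.trans ?_ (LaxEnd.eqToHom_app (T := partialEval T a a)
      (x := LaxEnd.mapObj ((transpose T).map (push (op a) (𝟙 a))) (resPt w a))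
      (y := LaxEnd.mapObj ((transpose T).map (pull (𝟙 a) a)) (resPt w a)) _ b).symm
    exact (cellL_id_iff (resL w (𝟙 a) b) _).2
      (by rw [cellL_cellL']; exact heq_id w (Gray.inl_id a b))
  cell_naturality {a a' f f'} α := LaxEnd.hom_ext fun b =>
    (cellL_naturality_iff α (resL w f b) (resL w f' b)).2
      (by rw [cellL_cellL', cellL_cellL']; exact w.cell_naturality _)
  cell_comp {a a' a''} f f' := LaxEnd.hom_ext fun b => by
    refine Eq.trans ?_ (LaxEnd.conj₂_app (S := partialEval T a a'') _
      ((LaxEnd.map ((transpose T).map (push (op a) f'))).map (resCell w f)) _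
      ((LaxEnd.map ((transpose T).map (pull f a''))).map (resCell w f')) _ b).symm
    exact (cellL_comp_iff (resL w f b) (resL w f' b) (resL w (f ≫ f') b) _ _ _).2
      (by rw [cellL_cellL', cellL_cellL', cellL_cellL']
          exact heq_comp w (Gray.inl_comp f f' b))

end

/-! ### Morphisms, and the isomorphism of categories. -/

section
variable {A : Type u₁} [Bicategory.{w₁, v₁} A] [Strict A]
  {B : Type u₂} [Bicategory.{w₂, v₂} B] [Strict B]
  {T : StrictPseudofunctor (Aᵒᵖ × Bᵒᵖ × LaxGray A B) Cat.{v₃, u₃}}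

/-- The equality `act_pullL` is one of functors, so it also relates their values on the morphisms
`t`, and the squares have the same shape as those for 2-cells. -/
theorem cellL_comm_iff {pt pt' : ∀ p : LaxGray A B, (twoVar T).obj (op p, p)}
    (t : ∀ p, pt p ⟶ pt' p) {a a' : A} {f : a ⟶ a'} {b : B} (σ : CellL pt f b) (τ : CellL pt' f b) :
    σ ≫ (FunSL.at' ((transpose T).map (pull f a')) (op b, b)).map (t ⟨a', b⟩) =
        (FunSL.at' ((transpose T).map (push (op a) f)) (op b, b)).map (t ⟨a, b⟩) ≫ τ ↔
      cellL σ ≫ (act (twoVar T) (pull (Gray.inl (FStr.min A) (FStr.min B) f b) ⟨a', b⟩)).map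
          (t ⟨a', b⟩) =
        (act (twoVar T) (push (op ⟨a, b⟩) (Gray.inl (FStr.min A) (FStr.min B) f b))).map
          (t ⟨a, b⟩) ≫ cellL τ :=
  naturality_conj_iff _ _ (Functor.congr_hom (act_pullL f a' b b) (t ⟨a', b⟩))

theorem cellR_comm_iff {pt pt' : ∀ p : LaxGray A B, (twoVar T).obj (op p, p)}
    (t : ∀ p, pt p ⟶ pt' p) {a : A} {b b' : B} {g : b ⟶ b'} (σ : CellR pt a g) (τ : CellR pt' a g) :
    σ ≫ (act (partialEval T a a) (pull g b')).map (t ⟨a, b'⟩) =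
        (act (partialEval T a a) (push (op b) g)).map (t ⟨a, b⟩) ≫ τ ↔
      cellR σ ≫ (act (twoVar T) (pull (Gray.inr (FStr.min A) (FStr.min B) a g) ⟨a, b'⟩)).map
          (t ⟨a, b'⟩) =
        (act (twoVar T) (push (op ⟨a, b⟩) (Gray.inr (FStr.min A) (FStr.min B) a g))).map
          (t ⟨a, b⟩) ≫ cellR τ :=
  naturality_conj_iff _ _ (Functor.congr_hom (act_pullR a a g b') (t ⟨a, b'⟩))

/-- The morphism of lax ends over `B` in a morphism of the iterated lax end. -/
abbrev innerHom {x y : LaxEnd (innerEnd T)} (t : x ⟶ y) (a : A) : innerPt x a ⟶ innerPt y a :=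
  LaxEnd.Hom.app t a

/-- The components of a morphism of the iterated lax end. -/
abbrev component {x y : LaxEnd (innerEnd T)} (t : x ⟶ y) (p : LaxGray A B) :
    points x p ⟶ points y p := LaxEnd.Hom.app (innerHom t p.fst) p.snd

variable (T) in
/-- The comparison functor from the iterated lax end to the two-variable lax end. -/
def fromIterated : LaxEnd (innerEnd T) ⥤ LaxEnd (twoVar T) where
  obj x := toTwoVar x
  map {x y} t :=
    { app := component t
      -- On generators, the squares at `(f, 1)` come from the outer morphism and those at `(1, g)`
      -- from its components, which are morphisms of the inner lax ends.
      comm s := Gray.laxEnd_comm (x := toTwoVar x) (y := toTwoVar y) (component t)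
        (fun f b => ((cellL_comm_iff (component t) (rawL x f b) (rawL y f b)).1
          (congrArg (fun s => LaxEnd.Hom.app s b) (LaxEnd.Hom.comm t f)).symm).symm)
        (fun a _ _ g => ((cellR_comm_iff (component t) (rawR x a g) (rawR y a g)).1
          (LaxEnd.Hom.comm (innerHom t a) g).symm).symm) s }
  map_id _ := rfl
  map_comp _ _ := rfl

/-- The restriction to `{a} × B` of a morphism of the two-variable lax end. -/
def resHom {w v : LaxEnd (twoVar T)} (t : w ⟶ v) (a : A) : resPt w a ⟶ resPt v a where
  app b := LaxEnd.Hom.app t ⟨a, b⟩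
  comm {b b'} g := ((cellR_comm_iff (LaxEnd.Hom.app t) (resR w a g) (resR v a g)).2
    (by rw [cellR_cellR', cellR_cellR']; exact (LaxEnd.Hom.comm t _).symm)).symm

variable (T) in
/-- The comparison functor from the two-variable lax end to the iterated lax end. -/
def iterated : LaxEnd (twoVar T) ⥤ LaxEnd (innerEnd T) where
  obj w := toIterated w
  map {w v} t :=
    { app a := resHom t a
      comm {a a'} f := LaxEnd.hom_ext fun b =>
        ((cellL_comm_iff (LaxEnd.Hom.app t) (resL w f b) (resL v f b)).2
          (by rw [cellL_cellL', cellL_cellL']; exact (LaxEnd.Hom.comm t _).symm)).symm }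
  map_id _ := rfl
  map_comp _ _ := rfl

/-- Points are unchanged, so uniqueness of the extension from generators reduces this to cancelling
the two target corrections. -/
theorem toTwoVar_toIterated (w : LaxEnd (twoVar T)) : toTwoVar (toIterated w) = w :=
  Gray.laxEnd_cell_heq rfl (fun f b => heq_of_eq (cellL_cellL' (w.cell (Gray.inl _ _ f b))))
    (fun a _ _ g => heq_of_eq (cellR_cellR' (w.cell (Gray.inr _ _ a g))))

/-- The points agree by definition, but the cells only after cancelling two `eqToHom`s. The points
of the outer wedge are thus only propositionally equal, and its cells have to be compared over this
equality. -/
theorem resPt_toTwoVar (x : LaxEnd (innerEnd T)) (a : A) : resPt (toTwoVar x) a = innerPt x a :=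
  LaxEnd.obj_ext (fun _ => rfl) fun g => (cellR'_cellR (rawR x a g)).trans (conj_self _)

theorem toIterated_toTwoVar (x : LaxEnd (innerEnd T)) : toIterated (toTwoVar x) = x := by
  refine LaxEnd.obj_ext (resPt_toTwoVar x) fun {a a'} f => LaxEnd.hom_ext fun b => ?_
  refine Eq.trans ?_ (LaxEnd.conj_app (T := partialEval T a a') _ (innerCell x f) _ b).symm
  -- Since the inner points agree definitionally, the transports are identities at each component.
  exact (cellL'_cellL (rawL x f b)).trans (conj_self _)

theorem iterated_fromIterated : iterated T ⋙ fromIterated T = 𝟭 _ := by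
  refine CategoryTheory.Functor.ext toTwoVar_toIterated fun w v t => LaxEnd.hom_ext fun p => ?_
  refine Eq.trans ?_ (LaxEnd.conj_app _ t _ p).symm
  exact conj_self _

/-- Neither functor changes the components of a morphism. The transports along the equalities of
objects become identities after passing to components twice, over `A` and then over `B`. -/
theorem fromIterated_iterated : fromIterated T ⋙ iterated T = 𝟭 _ := by
  refine CategoryTheory.Functor.ext toIterated_toTwoVar fun x y t => LaxEnd.hom_ext fun a => ?_
  refine Eq.trans ?_ (LaxEnd.conj_app (T := innerEnd T) _ t _ a).symm
  refine LaxEnd.hom_ext fun b => ?_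
  refine Eq.trans ?_ (LaxEnd.conj_app (T := partialEval T a a) (resPt_toTwoVar x a) (innerHom t a)
    (resPt_toTwoVar y a).symm b).symm
  exact conj_self _

end
end Fubini
end LaxFubini

theorem mainTheorem11 {A : Type u₁} [Bicategory.{w₁, v₁} A] [Strict A]
    {B : Type u₂} [Bicategory.{w₂, v₂} B] [Strict B]
    (T : StrictPseudofunctor (Aᵒᵖ × Bᵒᵖ × LaxGray A B) Cat.{v₃, u₃}) :
    ∃ e : Cat.of (LaxEnd (twoVar T)) ≅ Cat.of (LaxEnd (innerEnd T)),
      ∀ (a : A) (b : B),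
        e.hom.toFunctor ⋙ LaxEnd.proj (innerEnd T) a ⋙
          LaxEnd.proj ((transpose T).obj (op a, a)).functor b =
        LaxEnd.proj (twoVar T) ⟨a, b⟩ :=
  ⟨{ hom := (Fubini.iterated T).toCatHom
     inv := (Fubini.fromIterated T).toCatHom
     hom_inv_id := congrArg Functor.toCatHom Fubini.iterated_fromIterated
     inv_hom_id := congrArg Functor.toCatHom Fubini.fromIterated_iterated },
    -- The comparison leaves points and components of morphisms untouched, so the projections agree
    -- by definition.
    fun _ _ => rfl⟩
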